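/- **Setting.** Let $\Gamma$ be a plumbing graph with finite totally ordered vertex set $\mathcal J$ (a simple graph, possibly with cycles or disconnected, all genera zero) with integer decorations $e_j$, and let $L=\mathbb Z\langle E_j\rangle_{j\in\mathcal J}$ carry the form $(E_j,E_j)=e_j$ and, for $i\ne j$, $(E_i,E_j)=1$ if $i,j$ are adjacent and $0$ otherwise. Assume the form is non-degenerate. Let $L'=\{l'\in L\otimes\mathbb Q:(l',L)\subset\mathbb Z\}$, with basis $E_j^*$ given by $(E_j^*,E_i)=-\delta_{ij}$, and $\mathrm{Char}=\{k\in L':-\tfrac12(k+l,l)\in\mathbb Z\ \forall l\in L\}$, with classes $[k]=k+2L$. Put $w(k)=-(k^2+|\mathcal J|)/8$; a $q$-cube is a pair $(k,I)$ with $k\in\mathrm{Char}$, $I\subset\mathcal J$, $|I|=q$, and $w(k,I)=\max_{I'\subset I}w(k+2\sum_{j\in I'}E_j)$. Let $\mathcal T_0^+=\mathbb Z[U,U^{-1}]/U\mathbb Z[U]$, let $\mathcal F^q(\Gamma)$ be the $\mathbb Z[U]$-module of finitely supported $\mathcal T_0^+$-valued functions on $q$-cubes, and for $I=\{j_1<\dots<j_{q+1}\}$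 let $$(\delta\phi)(k,I)=\sum_{l}(-1)^l\Big(U^{w(k,I)-w(k,I\setminus j_l)}\phi(k,I\setminus j_l)-U^{w(k,I)-w(k+2E_{j_l},I\setminus j_l)}\phi(k+2E_{j_l},I\setminus j_l)\Big).$$ Then $\mathbb H^q(\Gamma)=H^q(\mathcal F^*(\Gamma),\delta)$ is the lattice cohomology. If $\Gamma$ is negative definite, $\mathbb T(\Gamma)\subset\mathbb H^0(\Gamma)$ is the image of $\bigoplus_{[k]\in \mathrm{Char}/2L}\mathcal T_0^+\to\mathbb H^0(\Gamma)$, $(x_{[k]})\mapsto\big(k\mapsto U^{\,w(k)-\min_{[k]}w}\,x_{[k]}\big)$. Fix a vertex $j_0$. Let $\Gamma\setminus j_0$ be obtained by deleting $j_0$ with its edges, $\Gamma_{j_0}^+$ by replacing $e_{j_0}$ by $e_{j_0}+1$, and $\Gamma^b$ by attaching to $j_0$, by one edge, a new vertex with decoration $-1$. For each class $[k]$ of $\Gamma\setminus j_0$ fix a representative $r_{[k]}\in[k]$. Define $$(\overline B^q\phi)\Big(\sum_{j\ne j_0}a_jE_j^*,I\Big)=\sum_{a\equiv e_{j_0}(2)}(-1)^{n(k,a)/2}\,\phi\Big(\sum_{j\ne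 j_0}a_jE_j^*+aE_{j_0}^*,I\Big),$$ where $k=\sum_{j\neq j_0} a_jE_j^*$, $n(k,a)=(k-r_{[k]},R(E_{j_0}))+a+e_{j_0}$ and $R(E_{j_0})=-\sum_{j\text{ adjacent to }j_0}E_j^*$ in $L'(\Gamma\setminus j_0)$; and $$(A^q\phi)\Big(\sum_j a_jE_j^*,I\Big)=\sum_{a\ \mathrm{odd}}U^{\,w_{\Gamma^b}(k^b_a,I)-w_{\Gamma_{j_0}^+}(k_a,I)}\,\phi(k_a,I),\qquad k^b_a=\sum_j a_jE_{j,\Gamma^b}^*+aE_{new}^*,\quad k_a=\sum_j a_jE_{j,\Gamma_{j_0}^+}^*+aE_{j_0,\Gamma_{j_0}^+}^*.$$ **Theorem.** Assume that $\Gamma_{j_0}^+$ is negative definite (then so are $\Gamma$ and $\Gamma\setminus j_0$). Then $$0\to\mathcal F^*(\Gamma_{j_0}^+)\xrightarrow{A^*}\mathcal F^*(\Gamma)\xrightarrow{\overline B^*}\mathcal F^*(\Gamma\setminus j_0)\to0$$ is a short exact sequence of complexes of $\mathbb Z[U]$-modules, and in its long exact cohomology sequence $$0\to\mathbb H^0(\Gamma_{j_0}^+)\xrightarrow{\mathbb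 A^0}\mathbb H^0(\Gamma)\xrightarrow{\overline{\mathbb B}^0}\mathbb H^0(\Gamma\setminus j_0)\xrightarrow{\mathbb C^0}\mathbb H^1(\Gamma_{j_0}^+)\to\cdots$$ one has $\mathbb T(\Gamma\setminus j_0)\subset\operatorname{im}\overline{\mathbb B}^0$; equivalently, the restriction of $\mathbb C^0$ to $\mathbb T(\Gamma\setminus j_0)$ is zero. -/

import Mathlib

open Polynomial CategoryTheory

set_option linter.unusedSectionVars false

noncomputable section

/-- A plumbing graph with vertex set `J` (all genera zero): a simple graph, possibly with cycles and
possibly disconnected, together with an integer decoration `e j` of every vertex. -/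
structure PlumbingGraph (J : Type*) where
  graph : SimpleGraph J
  e : J → ℤ

namespace LatticeCohomology

/-! ### The module `𝒯₀⁺` -/

/-- The `ℤ[U]`-module `𝒯₀⁺ = ℤ[U, U⁻¹] / U ℤ[U]`; the variable `X` of `ℤ[X]` plays the role of `U`. -/
abbrev TPlus : Type :=
  LaurentPolynomial ℤ ⧸ Submodule.span ℤ[X] {(LaurentPolynomial.T 1 : LaurentPolynomial ℤ)}

/-- `U ^ x` for a rational exponent `x`. It is only used when `x` is a non-negative integer. -/
def uPow (x : ℚ) : ℤ[X] := X ^ ⌊x⌋₊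

lemma TPlus.exists_pow_smul_eq_zero (x : TPlus) : ∃ n : ℕ, (X ^ n : ℤ[X]) • x = 0 := by
  obtain ⟨f, rfl⟩ := Submodule.Quotient.mk_surjective _ x
  obtain ⟨n, g, hg⟩ := LaurentPolynomial.exists_T_pow f
  refine ⟨n + 1, ?_⟩
  rw [← Submodule.Quotient.mk_smul, Submodule.Quotient.mk_eq_zero, Submodule.mem_span_singleton]
  refine ⟨g, ?_⟩
  rw [Algebra.smul_def, Algebra.smul_def, LaurentPolynomial.algebraMap_eq_toLaurent,
    LaurentPolynomial.algebraMap_eq_toLaurent, hg, Polynomial.toLaurent_X_pow, mul_assoc,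
    ← LaurentPolynomial.T_add, mul_comm]
  push_cast
  rfl

lemma pow_smul_eq_zero_of_le {x : TPlus} {m n : ℕ} (h : (X ^ m : ℤ[X]) • x = 0) (hmn : m ≤ n) :
    (X ^ n : ℤ[X]) • x = 0 := by
  obtain ⟨d, rfl⟩ := Nat.exists_eq_add_of_le hmn
  rw [add_comm, pow_add, mul_smul, h, smul_zero]

lemma uPow_mul {x y : ℚ} (hx : 0 ≤ x) (hy : 0 ≤ y) (hx' : ∃ n : ℤ, x = n) (hy' : ∃ n : ℤ, y = n) :
    uPow x * uPow y = uPow (x + y) := by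
  obtain ⟨m, rfl⟩ := hx'
  obtain ⟨n, rfl⟩ := hy'
  lift m to ℕ using by exact_mod_cast hx
  lift n to ℕ using by exact_mod_cast hy
  have : (((m : ℤ) : ℚ) + ((n : ℤ) : ℚ)) = ((m + n : ℕ) : ℚ) := by push_cast; rfl
  rw [uPow, uPow, uPow, this, Int.cast_natCast, Int.cast_natCast, Nat.floor_natCast,
    Nat.floor_natCast, Nat.floor_natCast, pow_add]

end LatticeCohomology

namespace PlumbingGraph

open LatticeCohomology

variable {J : Type*} [Fintype J] [LinearOrder J] (Γ : PlumbingGraph J)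

/-! ### The lattice `L = ℤ⟨E_j⟩`, the dual lattice `L'` and characteristic elements -/

open Classical in
/-- The intersection matrix `(E_i, E_j)`. An element `l = ∑ l_j E_j` of `L` is represented by
`l : J → ℤ`. -/
def mat : Matrix J J ℤ :=
  Matrix.of fun i j => if i = j then Γ.e i else if Γ.graph.Adj i j then 1 else 0

/-- The intersection matrix over `ℚ`. -/
def matQ : Matrix J J ℚ := Γ.mat.map (fun n : ℤ => (n : ℚ))

/-- The intersection form is non-degenerate. -/
def Nondegenerate : Prop := Γ.matQ.det ≠ 0

/-- The intersection form (on `L ⊗ ℚ`) is negative definite. -/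
def NegDef : Prop := ∀ x : J → ℚ, x ≠ 0 → x ⬝ᵥ (Γ.matQ.mulVec x) < 0

/-- An element `∑ a_j E_j^*` of the dual lattice `L'` is represented by its coordinates
`a : J → ℤ`, where `(E_j^*, E_i) = -δ_{ij}`. Since `E_j^* = -∑_i (M⁻¹)_{ij} E_i` for the intersection
matrix `M`, the rational intersection form on `L'` is given by `M⁻¹` in these coordinates. -/
def dualForm (a b : J → ℤ) : ℚ :=
  (fun j => (a j : ℚ)) ⬝ᵥ (Γ.matQ⁻¹.mulVec fun j => (b j : ℚ))

/-- The coordinates of `l ∈ L` as an element of `L'`, namely `-(l, E_j)`. -/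
def toDual (l : J → ℤ) : J → ℤ := -(Γ.mat.mulVec l)

/-- `k = ∑ a_j E_j^*` is characteristic: `χ_k(l) = -(k + l, l) / 2` is an integer for all `l ∈ L`.
Here `(k, l) = -∑ a_j l_j`. -/
def IsChar (a : J → ℤ) : Prop := ∀ l : J → ℤ, Even (-(a ⬝ᵥ l) + l ⬝ᵥ (Γ.mat.mulVec l))

/-- The set of characteristic elements. -/
def Char : Type _ := {a : J → ℤ // Γ.IsChar a}

lemma mat_symm (i j : J) : Γ.mat i j = Γ.mat j i := by
  classical
  simp only [mat, Matrix.of_apply]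
  by_cases h : i = j
  · subst h; rfl
  · rw [if_neg h, if_neg (Ne.symm h), Γ.graph.adj_comm]

lemma mat_transpose : Γ.mat.transpose = Γ.mat := by
  ext i j
  exact Γ.mat_symm j i

lemma matQ_transpose : Γ.matQ.transpose = Γ.matQ := by
  ext i j
  simp [matQ, Γ.mat_symm j i]

lemma mat_self (j : J) : Γ.mat j j = Γ.e j := by
  simp [mat]

lemma isChar_iff (a : J → ℤ) : Γ.IsChar a ↔ ∀ j, a j ≡ Γ.e j [ZMOD 2] := by
  constructor
  · intro h j
    have := h (Pi.single j 1)
    simp only [dotProduct_single, mul_one, Matrix.mulVec_single_one, single_dotProduct, one_mul,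
      Matrix.col_apply, mat_self] at this
    rw [Int.modEq_iff_dvd]
    obtain ⟨c, hc⟩ := this
    exact ⟨c, by omega⟩
  · intro h l
    have key : ∀ s : Finset J, ∀ l : J → ℤ, (∀ j ∉ s, l j = 0) →
        Even (-(a ⬝ᵥ l) + l ⬝ᵥ (Γ.mat.mulVec l)) := by
      intro s
      induction s using Finset.induction_on with
      | empty =>
        intro l hl
        have : l = 0 := funext fun j => hl j (Finset.notMem_empty j)
        simp [this]
      | insert i s hi ih =>
        intro l hl
        have h1 := ih (l - Pi.single i (l i)) (by
          intro j hj
          by_cases hji : j = i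
          · subst hji; simp
          · simp [hji, hl j (by simp [hji, hj])])
        generalize hm : l - Pi.single i (l i) = m at h1
        have hl' : l = m + Pi.single i (l i) := by rw [← hm]; simp
        generalize l i = c at hl'
        subst hl'
        have hsym : (Pi.single i c : J → ℤ) ⬝ᵥ (Γ.mat.mulVec m)
            = m ⬝ᵥ (Γ.mat.mulVec (Pi.single i c)) := by
          rw [Matrix.dotProduct_mulVec, ← Matrix.mulVec_transpose, mat_transpose, dotProduct_comm]
        have hc : Even (-(a i * c) + c * (Γ.e i * c)) := by
          obtain ⟨t, ht⟩ := (Int.modEq_iff_dvd.mp (h i))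
          have h2 : Even (c * (c - 1)) := Int.even_mul_pred_self c
          obtain ⟨u, hu⟩ := h2
          refine ⟨t * c + Γ.e i * u, ?_⟩
          have h3 : a i = Γ.e i - 2 * t := by omega
          rw [h3]
          linear_combination Γ.e i * hu
        have e2 : (Pi.single i c : J → ℤ) ⬝ᵥ (Γ.mat.mulVec (Pi.single i c))
            = c * (Γ.e i * c) := by
          simp [single_dotProduct, Matrix.mulVec_single, mat_self, mul_comm]
        have e3 : a ⬝ᵥ (Pi.single i c) = a i * c := by simp
        rw [Matrix.mulVec_add, dotProduct_add, add_dotProduct, dotProduct_add, dotProduct_add, hsym,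
          e2, e3]
        obtain ⟨u, hu⟩ := h1
        obtain ⟨v, hv⟩ := hc
        exact ⟨u + v + m ⬝ᵥ (Γ.mat.mulVec (Pi.single i c)), by linarith⟩
    exact key Finset.univ l (by simp)

namespace Char

variable {Γ}

@[ext]
lemma ext {k k' : Γ.Char} (h : k.1 = k'.1) : k = k' := Subtype.ext h

/-- The characteristic element `k + 2l`, for `l ∈ L`. -/
def shift (k : Γ.Char) (l : J → ℤ) : Γ.Char :=
  ⟨k.1 + 2 • Γ.toDual l, by
    rw [isChar_iff]
    intro j
    have := (Γ.isChar_iff _).1 k.2 j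
    have h2 : (2 • Γ.toDual l) j ≡ 0 [ZMOD 2] := by
      simp [Int.modEq_zero_iff_dvd]
    simpa using this.add h2⟩

lemma shift_val (k : Γ.Char) (l : J → ℤ) : (k.shift l).1 = k.1 + 2 • Γ.toDual l := rfl

lemma shift_apply (k : Γ.Char) (l : J → ℤ) (j : J) :
    (k.shift l).1 j = k.1 j - 2 * Γ.mat.mulVec l j := by
  change k.1 j + 2 • -(Γ.mat.mulVec l j) = _
  rw [two_nsmul]
  ring

lemma shift_zero (k : Γ.Char) : k.shift 0 = k := by
  apply Char.ext
  simp [shift_val, toDual]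

lemma shift_shift (k : Γ.Char) (l m : J → ℤ) : (k.shift l).shift m = k.shift (l + m) := by
  apply Char.ext
  simp only [shift_val, toDual, Matrix.mulVec_add]
  simp only [smul_neg, neg_add]
  rw [smul_add, smul_neg, smul_neg]
  abel

end Char

/-- Two characteristic elements are in the same class iff they differ by an element of `2L`. -/
def charSetoid : Setoid Γ.Char where
  r k k' := ∃ l : J → ℤ, k' = k.shift l
  iseqv :=
    { refl := fun k => ⟨0, k.shift_zero.symm⟩
      symm := by
        rintro k _ ⟨l, rfl⟩
        exact ⟨-l, by rw [Char.shift_shift, add_neg_cancel, Char.shift_zero]⟩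
      trans := by
        rintro k _ _ ⟨l, rfl⟩ ⟨m, rfl⟩
        exact ⟨l + m, Char.shift_shift _ _ _⟩ }

/-- The set of classes `Char / 2L`. -/
def CharClass : Type _ := Quotient Γ.charSetoid

/-- The class `[k]` of a characteristic element. -/
def charClass (k : Γ.Char) : Γ.CharClass := Quotient.mk Γ.charSetoid k

/-! ### Weights and cubes -/

/-- The weight `w(k) = -(k² + s) / 8`, with `s` the number of vertices. -/
def w (k : Γ.Char) : ℚ := -(Γ.dualForm k.1 k.1 + Fintype.card J) / 8

/-- The element `E_I = ∑_{j ∈ I} E_j` of `L`. -/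
def E (I : Finset J) : J → ℤ := fun j => if j ∈ I then 1 else 0

/-- A cube `(k, I)`; its vertices are `k + 2 E_{I'}` for `I' ⊆ I` and its dimension is `|I|`. -/
abbrev Cube : Type _ := Γ.Char × Finset J

/-- The weight of a cube: the maximum of the weights of its vertices. -/
def wCube (c : Γ.Cube) : ℚ :=
  c.2.powerset.sup' ⟨∅, Finset.empty_mem_powerset _⟩ fun I' => Γ.w (c.1.shift (E I'))

lemma matQ_mul_cast (l : J → ℤ) :
    Γ.matQ.mulVec (fun j => (l j : ℚ)) = fun j => ((Γ.mat.mulVec l j : ℤ) : ℚ) := by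
  ext i
  simp [Matrix.mulVec, dotProduct, matQ]

/-- `(k, k) = a · u` if the coordinate vector `a` of `k` is `M u`. -/
lemma dualForm_eq (h : Γ.Nondegenerate) (a b : J → ℤ) (u : J → ℚ)
    (hu : Γ.matQ.mulVec u = fun j => (b j : ℚ)) :
    Γ.dualForm a b = (fun j => (a j : ℚ)) ⬝ᵥ u := by
  rw [dualForm, ← hu, Matrix.mulVec_mulVec, Matrix.nonsing_inv_mul _ (isUnit_iff_ne_zero.mpr h),
    Matrix.one_mulVec]

lemma dualForm_comm (a b : J → ℤ) : Γ.dualForm a b = Γ.dualForm b a := by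
  rw [dualForm, dualForm, Matrix.dotProduct_mulVec, ← Matrix.mulVec_transpose,
    Matrix.transpose_nonsing_inv, matQ_transpose, dotProduct_comm]

lemma dualForm_toDual (h : Γ.Nondegenerate) (a l : J → ℤ) :
    Γ.dualForm a (Γ.toDual l) = -((a ⬝ᵥ l : ℤ) : ℚ) := by
  rw [Γ.dualForm_eq h a (Γ.toDual l) (fun j => ((-l j : ℤ) : ℚ))]
  · simp [dotProduct]
  · rw [matQ_mul_cast]
    ext i
    simp only [toDual, ← Matrix.mulVec_neg]
    rfl

lemma dualForm_add_right (a b c : J → ℤ) :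
    Γ.dualForm a (b + c) = Γ.dualForm a b + Γ.dualForm a c := by
  simp only [dualForm, ← dotProduct_add, ← Matrix.mulVec_add]
  congr 2
  ext j
  simp

lemma dualForm_add_left (a b c : J → ℤ) :
    Γ.dualForm (a + b) c = Γ.dualForm a c + Γ.dualForm b c := by
  rw [dualForm_comm, dualForm_add_right, dualForm_comm Γ c a, dualForm_comm Γ c b]

lemma w_shift (h : Γ.Nondegenerate) (k : Γ.Char) (l : J → ℤ) :
    Γ.w (k.shift l) = Γ.w k + ((k.1 ⬝ᵥ l - l ⬝ᵥ (Γ.mat.mulVec l) : ℤ) : ℚ) / 2 := by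
  have e1 : Γ.dualForm (Γ.toDual l) (Γ.toDual l) = ((l ⬝ᵥ (Γ.mat.mulVec l) : ℤ) : ℚ) := by
    rw [Γ.dualForm_toDual h, toDual, neg_dotProduct, dotProduct_comm]
    push_cast; ring
  have e2 := Γ.dualForm_toDual h k.1 l
  have e3 : Γ.dualForm (Γ.toDual l) k.1 = -((k.1 ⬝ᵥ l : ℤ) : ℚ) := by rw [dualForm_comm, e2]
  rw [w, w, Char.shift_val, two_smul]
  simp only [dualForm_add_left, dualForm_add_right, e1, e2, e3]
  push_cast
  ring

lemma w_shift_sub_int (k : Γ.Char) (l : J → ℤ) : ∃ n : ℤ, Γ.w (k.shift l) - Γ.w k = n := by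
  by_cases h : Γ.Nondegenerate
  · obtain ⟨c, hc⟩ := k.2 l
    refine ⟨-c, ?_⟩
    rw [w_shift _ h]
    have : k.1 ⬝ᵥ l - l ⬝ᵥ (Γ.mat.mulVec l) = -(2 * c) := by linarith
    rw [this]
    push_cast
    ring
  · refine ⟨0, ?_⟩
    have : Γ.matQ⁻¹ = 0 := Matrix.nonsing_inv_apply_not_isUnit _ (by
      rw [isUnit_iff_ne_zero]; exact h)
    simp [w, dualForm, this]

lemma wCube_sub_w_int (k : Γ.Char) (l : J → ℤ) (I : Finset J) :
    ∃ n : ℤ, Γ.wCube (k.shift l, I) - Γ.w k = n := by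
  obtain ⟨I', -, h⟩ := Finset.exists_mem_eq_sup' (s := I.powerset)
    ⟨∅, Finset.empty_mem_powerset _⟩ fun I' => Γ.w ((k.shift l).shift (E I'))
  rw [wCube, h, Char.shift_shift]
  exact Γ.w_shift_sub_int _ _

lemma wCube_sub_int (k : Γ.Char) (l : J → ℤ) (I I' : Finset J) :
    ∃ n : ℤ, Γ.wCube (k, I) - Γ.wCube (k.shift l, I') = n := by
  obtain ⟨m, hm⟩ := Γ.wCube_sub_w_int k 0 I
  obtain ⟨n, hn⟩ := Γ.wCube_sub_w_int k l I'
  rw [Char.shift_zero] at hm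
  exact ⟨m - n, by push_cast; linarith⟩

lemma wCube_mono (k : Γ.Char) {I I' : Finset J} (h : I' ⊆ I) :
    Γ.wCube (k, I') ≤ Γ.wCube (k, I) :=
  Finset.sup'_mono _ (Finset.powerset_mono.mpr h) _

lemma E_insert {I : Finset J} {j : J} (h : j ∉ I) : E (insert j I) = E {j} + E I := by
  ext i
  by_cases hi : i = j
  · subst hi; simp [E, h]
  · simp [E, hi]

lemma wCube_shift_le (k : Γ.Char) {I : Finset J} {j : J} (h : j ∈ I) :
    Γ.wCube (k.shift (E {j}), I.erase j) ≤ Γ.wCube (k, I) := by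
  refine Finset.sup'_le _ _ fun I' hI' => ?_
  rw [Finset.mem_powerset] at hI'
  have hj : j ∉ I' := fun hj => Finset.notMem_erase j I (hI' hj)
  rw [Char.shift_shift, ← E_insert hj]
  refine Finset.le_sup' (fun I' => Γ.w (k.shift (E I'))) ?_
  rw [Finset.mem_powerset]
  exact Finset.insert_subset h (hI'.trans (Finset.erase_subset _ _))

lemma wCube_empty (k : Γ.Char) : Γ.wCube (k, ∅) = Γ.w k := by
  have : E (∅ : Finset J) = 0 := by ext; simp [E]
  simp [wCube, this, Char.shift_zero]

/-! ### The complex `(ℱ^*, δ)` -/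

/-- The part of the coboundary operator in the direction `E_j`:
`φ ↦ U^{w(k,I)-w(k,I∖j)} φ(k, I∖j) - U^{w(k,I)-w(k+2E_j,I∖j)} φ(k+2E_j, I∖j)`. -/
def deltaDir (j : J) : (Γ.Cube → TPlus) →ₗ[ℤ[X]] (Γ.Cube → TPlus) where
  toFun φ c :=
    uPow (Γ.wCube c - Γ.wCube (c.1, c.2.erase j)) • φ (c.1, c.2.erase j)
      - uPow (Γ.wCube c - Γ.wCube (c.1.shift (E {j}), c.2.erase j))
        • φ (c.1.shift (E {j}), c.2.erase j)
  map_add' φ ψ := by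
    ext c
    simp only [Pi.add_apply, smul_add]
    abel
  map_smul' p φ := by
    ext c
    simp only [Pi.smul_apply, RingHom.id_apply, smul_sub, smul_smul, mul_comm]

/-- The sign `(-1)^l` of `j = j_l` in `I = {j_1 < ⋯ < j_q}`. -/
def sgn (I : Finset J) (j : J) : ℤ := (-1) ^ (I.filter (· ≤ j)).card

/-- The coboundary operator
`(δφ)(k,I) = ∑_l (-1)^l (U^{w(k,I)-w(k,I∖j_l)} φ(k,I∖j_l) - U^{w(k,I)-w(k+2E_{j_l},I∖j_l)}
φ(k+2E_{j_l},I∖j_l))`, where `I = {j_1 < ⋯ < j_q}`. -/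
def delta : (Γ.Cube → TPlus) →ₗ[ℤ[X]] (Γ.Cube → TPlus) where
  toFun φ c := ∑ j ∈ c.2, sgn c.2 j • Γ.deltaDir j φ c
  map_add' φ ψ := by
    ext c
    simp only [map_add, Pi.add_apply, smul_add, Finset.sum_add_distrib]
  map_smul' p φ := by
    ext c
    simp only [map_smul, Pi.smul_apply, RingHom.id_apply, Finset.smul_sum]
    exact Finset.sum_congr rfl fun j _ => smul_comm _ _ _

lemma delta_apply (φ : Γ.Cube → TPlus) (c : Γ.Cube) :
    Γ.delta φ c = ∑ j ∈ c.2, sgn c.2 j • Γ.deltaDir j φ c := rfl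

lemma deltaDir_apply (j : J) (φ : Γ.Cube → TPlus) (k : Γ.Char) (I : Finset J) :
    Γ.deltaDir j φ (k, I) = uPow (Γ.wCube (k, I) - Γ.wCube (k, I.erase j)) • φ (k, I.erase j)
      - uPow (Γ.wCube (k, I) - Γ.wCube (k.shift (E {j}), I.erase j))
        • φ (k.shift (E {j}), I.erase j) := rfl

lemma deltaDir_apply_of_mem_iff (j : J) (φ : Γ.Cube → TPlus) (k : Γ.Char) (I I' : Finset J)
    (hI' : ∀ i, i ∈ I' ↔ i ≠ j ∧ i ∈ I) :
    Γ.deltaDir j φ (k, I) = uPow (Γ.wCube (k, I) - Γ.wCube (k, I')) • φ (k, I')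
      - uPow (Γ.wCube (k, I) - Γ.wCube (k.shift (E {j}), I')) • φ (k.shift (E {j}), I') := by
  obtain rfl : I' = I.erase j := Finset.ext fun i => by rw [hI', Finset.mem_erase]
  rfl

lemma deltaDir_deltaDir {i j : J} (φ : Γ.Cube → TPlus) (k : Γ.Char) {I : Finset J} (hj : j ∈ I)
    (hi : i ∈ I) (hij : i ≠ j) :
    Γ.deltaDir j (Γ.deltaDir i φ) (k, I) =
      uPow (Γ.wCube (k, I) - Γ.wCube (k, (I.erase j).erase i)) • φ (k, (I.erase j).erase i)
      - uPow (Γ.wCube (k, I) - Γ.wCube (k.shift (E {i}), (I.erase j).erase i))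
        • φ (k.shift (E {i}), (I.erase j).erase i)
      - uPow (Γ.wCube (k, I) - Γ.wCube (k.shift (E {j}), (I.erase j).erase i))
        • φ (k.shift (E {j}), (I.erase j).erase i)
      + uPow (Γ.wCube (k, I) - Γ.wCube (k.shift (E {i} + E {j}), (I.erase j).erase i))
        • φ (k.shift (E {i} + E {j}), (I.erase j).erase i) := by
  have hi' : i ∈ I.erase j := Finset.mem_erase.mpr ⟨hij, hi⟩
  have a0 : ∀ (k : Γ.Char) {i : J} {I : Finset J}, 0 ≤ Γ.wCube (k, I) - Γ.wCube (k, I.erase i) :=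
    fun k i I => sub_nonneg.mpr (Γ.wCube_mono k (Finset.erase_subset _ _))
  have a1 : ∀ (k : Γ.Char) {i : J} {I : Finset J}, i ∈ I →
      0 ≤ Γ.wCube (k, I) - Γ.wCube (k.shift (E {i}), I.erase i) :=
    fun k i I h => sub_nonneg.mpr (Γ.wCube_shift_le k h)
  have b0 : ∀ (k : Γ.Char) {I I' : Finset J}, ∃ n : ℤ, Γ.wCube (k, I) - Γ.wCube (k, I') = n := by
    intro k I I'
    simpa [Char.shift_zero] using Γ.wCube_sub_int k 0 I I'
  have b1 := Γ.wCube_sub_int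
  simp only [deltaDir_apply, smul_sub, smul_smul]
  rw [uPow_mul (a0 _) (a0 _) (b0 _) (b0 _), uPow_mul (a0 _) (a1 _ hi') (b0 _) (b1 _ _ _ _),
    uPow_mul (a1 _ hj) (a0 _) (b1 _ _ _ _) (b0 _),
    uPow_mul (a1 _ hj) (a1 _ hi') (b1 _ _ _ _) (b1 _ _ _ _)]
  simp only [sub_add_sub_cancel, Char.shift_shift, add_comm (E {j}) (E {i})]
  abel

lemma deltaDir_comm {i j : J} (φ : Γ.Cube → TPlus) (k : Γ.Char) {I : Finset J} (hj : j ∈ I)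
    (hi : i ∈ I) (hij : i ≠ j) :
    Γ.deltaDir j (Γ.deltaDir i φ) (k, I) = Γ.deltaDir i (Γ.deltaDir j φ) (k, I) := by
  rw [Γ.deltaDir_deltaDir φ k hj hi hij, Γ.deltaDir_deltaDir φ k hi hj hij.symm,
    Finset.erase_right_comm, add_comm (E {i}) (E {j})]
  abel

lemma sgn_mul_sgn {i j : J} {I : Finset J} (hj : j ∈ I) (hi : i ∈ I) (hij : i ≠ j) :
    sgn I j * sgn (I.erase j) i = -(sgn I i * sgn (I.erase i) j) := by
  have key : ∀ {i j : J}, j ∈ I → i ∈ I → i < j →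
      sgn (I.erase j) i = sgn I i ∧ sgn (I.erase i) j = - sgn I j := by
    intro i j hj hi hlt
    constructor
    · rw [sgn, sgn, Finset.filter_erase, Finset.erase_eq_of_notMem]
      simp [hlt]
    · rw [sgn, sgn, Finset.filter_erase]
      have hm : i ∈ I.filter (· ≤ j) := by simp [hi, hlt.le]
      rw [← Finset.card_erase_add_one hm, pow_succ]
      ring
  rcases lt_or_gt_of_ne hij with h | h
  · obtain ⟨h1, h2⟩ := key hj hi h
    rw [h1, h2]; ring
  · obtain ⟨h1, h2⟩ := key hi hj h
    rw [h1, h2]; ring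

lemma delta_delta (φ : Γ.Cube → TPlus) : Γ.delta (Γ.delta φ) = 0 := by
  ext ⟨k, I⟩
  have h1 : ∀ j ∈ I, Γ.deltaDir j (Γ.delta φ) (k, I)
      = ∑ i ∈ I.erase j, sgn (I.erase j) i • Γ.deltaDir j (Γ.deltaDir i φ) (k, I) := by
    intro j hj
    simp only [deltaDir_apply, delta_apply, Finset.smul_sum, ← Finset.sum_sub_distrib, smul_sub]
    refine Finset.sum_congr rfl fun i hi => ?_
    simp only [smul_comm (sgn _ _)]
  rw [delta_apply, Pi.zero_apply]
  rw [Finset.sum_congr rfl fun j hj => by rw [h1 j hj, Finset.smul_sum]]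
  rw [Finset.sum_sigma']
  refine Finset.sum_involution (fun x _ => ⟨x.2, x.1⟩) ?_ ?_ ?_ ?_
  · rintro ⟨j, i⟩ h
    simp only [Finset.mem_sigma, Finset.mem_erase] at h
    obtain ⟨hj, hij, hi⟩ := h
    simp only [smul_smul]
    rw [sgn_mul_sgn hj hi hij, Γ.deltaDir_comm φ k hj hi hij, neg_smul, neg_add_cancel]
  · rintro ⟨j, i⟩ h _ heq
    simp only [Finset.mem_sigma, Finset.mem_erase] at h
    simp only [Sigma.mk.injEq, heq_eq_eq] at heq
    exact h.2.1 heq.1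
  · rintro ⟨j, i⟩ h
    simp only [Finset.mem_sigma, Finset.mem_erase] at h ⊢
    exact ⟨h.2.2, h.2.1.symm, h.1⟩
  · rintro ⟨j, i⟩ h
    rfl

/-- `ℱ^q`: the `𝒯₀⁺`-valued functions with finite support on the set of `q`-cubes (represented as
functions on the set of all cubes which vanish on the cubes of dimension different from `q`). -/
def cochains (q : ℕ) : Submodule ℤ[X] (Γ.Cube → TPlus) where
  carrier := {φ | (Function.support φ).Finite ∧ ∀ c : Γ.Cube, φ c ≠ 0 → c.2.card = q}
  add_mem' {φ ψ} hφ hψ := by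
    refine ⟨(hφ.1.union hψ.1).subset (Function.support_add φ ψ), fun c hc => ?_⟩
    by_cases h : φ c = 0
    · exact hψ.2 c fun h' => hc (by simp [h, h'])
    · exact hφ.2 c h
  zero_mem' := by simp
  smul_mem' p φ hφ := by
    have : ∀ c, (p • φ) c ≠ 0 → φ c ≠ 0 := fun c hc h => hc (by simp [h])
    exact ⟨hφ.1.subset this, fun c hc => hφ.2 c (this c hc)⟩

lemma cochains_apply_eq_zero {q : ℕ} {φ : Γ.Cube → TPlus} (hφ : φ ∈ Γ.cochains q) {c : Γ.Cube}
    (hc : c.2.card ≠ q) : φ c = 0 := by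
  by_contra h
  exact hc (hφ.2 c h)

lemma shift_injective (l : J → ℤ) : Function.Injective fun k : Γ.Char => k.shift l := by
  intro k k' h
  have := congrArg (fun k : Γ.Char => k.shift (-l)) h
  simpa [Char.shift_shift, Char.shift_zero] using this

lemma delta_mem {q : ℕ} {φ : Γ.Cube → TPlus} (hφ : φ ∈ Γ.cochains q) :
    Γ.delta φ ∈ Γ.cochains (q + 1) := by
  have key : ∀ c, Γ.delta φ c ≠ 0 → ∃ j ∈ c.2, φ (c.1, c.2.erase j) ≠ 0 ∨
      φ (c.1.shift (E {j}), c.2.erase j) ≠ 0 := by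
    intro c hc
    by_contra! hcon
    refine hc (Finset.sum_eq_zero fun j hj => ?_)
    obtain ⟨h1, h2⟩ := hcon j hj
    rw [show Γ.deltaDir j φ c = _ from Γ.deltaDir_apply j φ c.1 c.2, h1, h2]
    simp
  constructor
  · have hfin : (⋃ j : J, ⋃ c ∈ Function.support φ, {(c.1, insert j c.2),
        (c.1.shift (-E {j}), insert j c.2)} : Set Γ.Cube).Finite :=
      Set.finite_iUnion fun j => hφ.1.biUnion fun c _ => Set.toFinite _
    refine hfin.subset ?_
    rintro ⟨k, I⟩ hc
    obtain ⟨j, hj, h | h⟩ := key _ hc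
    · simp only [Set.mem_iUnion]
      refine ⟨j, _, h, ?_⟩
      left
      simp [Finset.insert_erase hj]
    · simp only [Set.mem_iUnion]
      refine ⟨j, _, h, ?_⟩
      right
      simp [Finset.insert_erase hj, Char.shift_shift, Char.shift_zero]
  · intro c hc
    obtain ⟨j, hj, h | h⟩ := key _ hc
    · rw [← hφ.2 _ h, Finset.card_erase_add_one hj]
    · rw [← hφ.2 _ h, Finset.card_erase_add_one hj]

/-- The coboundary operator `δ : ℱ^q → ℱ^{q+1}`. -/
def deltaHom (q : ℕ) : Γ.cochains q →ₗ[ℤ[X]] Γ.cochains (q + 1) :=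
  Γ.delta.restrict fun _ h => Γ.delta_mem h

lemma deltaHom_deltaHom (q : ℕ) : Γ.deltaHom (q + 1) ∘ₗ Γ.deltaHom q = 0 := by
  ext φ : 1
  exact Subtype.ext (Γ.delta_delta φ.1)

/-- The cochain complex `(ℱ^*(Γ), δ)` of `ℤ[U]`-modules. -/
def cochainComplex : CochainComplex (ModuleCat ℤ[X]) ℕ :=
  CochainComplex.of (fun q => ModuleCat.of ℤ[X] (Γ.cochains q))
    (fun q => ModuleCat.ofHom (Γ.deltaHom q)) fun q => by
      rw [← ModuleCat.ofHom_comp, deltaHom_deltaHom]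
      rfl

lemma cochainComplex_d (q : ℕ) :
    Γ.cochainComplex.d q (q + 1) = ModuleCat.ofHom (Γ.deltaHom q) :=
  CochainComplex.of_d (fun q => ModuleCat.of ℤ[X] (Γ.cochains q))
    (fun q => ModuleCat.ofHom (Γ.deltaHom q)) q

/-- The lattice cohomology `ℍ^q(Γ)`. -/
abbrev latticeCohomology (q : ℕ) : ModuleCat ℤ[X] := Γ.cochainComplex.homology q

/-! ### The canonical submodule `𝕋 ⊆ ℍ⁰` of a negative definite graph -/

variable {Γ}

lemma nondegenerate_of_mulVec (h : ∀ x : J → ℚ, Γ.matQ.mulVec x = 0 → x = 0) : Γ.Nondegenerate := by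
  intro hdet
  obtain ⟨x, hx, hx'⟩ := Matrix.exists_mulVec_eq_zero_iff.mpr hdet
  exact hx (h x hx')

lemma NegDef.nondegenerate (h : Γ.NegDef) : Γ.Nondegenerate := by
  refine nondegenerate_of_mulVec fun x hx => ?_
  by_contra hne
  have := h x hne
  rw [hx, dotProduct_zero] at this
  exact lt_irrefl _ this

lemma NegDef.finite_le (h : Γ.NegDef) (r : ℚ) : {k : Γ.Char | Γ.w k ≤ r}.Finite := by
  obtain ⟨N, hN⟩ : ∃ N : ℕ, ∀ j, (8 * r + Fintype.card J - Γ.e j) / 2 ≤ N := by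
    obtain ⟨N, hN⟩ := Finite.exists_le (fun j : J => ⌈(8 * r + Fintype.card J - Γ.e j) / 2⌉₊)
    exact ⟨N, fun j => (Nat.le_ceil _).trans (by exact_mod_cast hN j)⟩
  have hfin : (Set.Icc (fun _ : J => -(N : ℤ)) fun _ : J => (N : ℤ)).Finite := Set.finite_Icc _ _
  refine Set.Finite.of_finite_image (f := Subtype.val) (hfin.subset ?_) Subtype.val_injective.injOn
  rintro _ ⟨k, hk, rfl⟩
  have hnd := h.nondegenerate
  set u : J → ℚ := Γ.matQ⁻¹.mulVec fun j => (k.1 j : ℚ) with hu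
  have hMu : Γ.matQ.mulVec u = fun j => (k.1 j : ℚ) := by
    rw [hu, Matrix.mulVec_mulVec, Matrix.mul_nonsing_inv _ (isUnit_iff_ne_zero.mpr hnd),
      Matrix.one_mulVec]
  have hkk : Γ.dualForm k.1 k.1 = u ⬝ᵥ (Γ.matQ.mulVec u) := by
    rw [hMu, dotProduct_comm, Γ.dualForm_eq hnd _ _ u hMu]
  have hw : -(u ⬝ᵥ (Γ.matQ.mulVec u)) ≤ 8 * r + Fintype.card J := by
    have hk' : Γ.w k ≤ r := hk
    rw [w, hkk] at hk'
    linarith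
  have hle : ∀ x : J → ℚ, x ⬝ᵥ (Γ.matQ.mulVec x) ≤ 0 := by
    intro x
    by_cases hx : x = 0
    · simp [hx]
    · exact (h x hx).le
  have key : ∀ (j : J) (t : ℚ), u ⬝ᵥ (Γ.matQ.mulVec u) + 2 * t * k.1 j + t * t * Γ.e j ≤ 0 := by
    intro j t
    have := hle (u + Pi.single j t)
    rw [Matrix.mulVec_add, dotProduct_add, add_dotProduct, add_dotProduct,
      Matrix.dotProduct_mulVec u Γ.matQ (Pi.single j t), ← Matrix.mulVec_transpose, matQ_transpose,
      hMu, single_dotProduct, dotProduct_single, single_dotProduct] at this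
    rw [hMu]
    have e1 : Γ.matQ.mulVec (Pi.single j t) j = Γ.e j * t := by
      simp [Matrix.mulVec_single, matQ, mat_self, mul_comm]
    rw [e1] at this
    linarith
  constructor <;> intro j
  · have h1 := key j (-1)
    have h2 := hN j
    have : -(N : ℚ) ≤ k.1 j := by linarith
    exact_mod_cast this
  · have h1 := key j 1
    have h2 := hN j
    have : (k.1 j : ℚ) ≤ N := by linarith
    exact_mod_cast this

lemma NegDef.exists_isLeast (h : Γ.NegDef) (c : Γ.CharClass) :
    ∃ m : ℚ, IsLeast (Γ.w '' {k | Γ.charClass k = c}) m := by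
  obtain ⟨k₀, rfl⟩ := Quotient.exists_rep c
  have hfin : {k : Γ.Char | Γ.charClass k = Γ.charClass k₀ ∧ Γ.w k ≤ Γ.w k₀}.Finite :=
    (h.finite_le (Γ.w k₀)).subset fun k hk => hk.2
  obtain ⟨k, hk, hmin⟩ := Set.exists_min_image _ Γ.w hfin ⟨k₀, rfl, le_rfl⟩
  refine ⟨Γ.w k, ⟨k, hk.1, rfl⟩, ?_⟩
  rintro _ ⟨k', hk', rfl⟩
  by_cases hle : Γ.w k' ≤ Γ.w k₀
  · exact hmin k' ⟨hk', hle⟩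
  · exact hk.2.trans (not_le.mp hle).le

/-- The minimum of the weights `w(k)` of the elements `k` of a given class, i.e. half of the number
`d[k]`. -/
def NegDef.minWeight (h : Γ.NegDef) (c : Γ.CharClass) : ℚ := (h.exists_isLeast c).choose

lemma NegDef.minWeight_isLeast (h : Γ.NegDef) (c : Γ.CharClass) :
    IsLeast (Γ.w '' {k | Γ.charClass k = c}) (h.minWeight c) := (h.exists_isLeast c).choose_spec

lemma NegDef.minWeight_le (h : Γ.NegDef) (k : Γ.Char) : h.minWeight (Γ.charClass k) ≤ Γ.w k :=
  (h.minWeight_isLeast _).2 ⟨k, rfl, rfl⟩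

lemma NegDef.sub_minWeight_int (h : Γ.NegDef) (k : Γ.Char) :
    ∃ n : ℤ, Γ.w k - h.minWeight (Γ.charClass k) = n := by
  obtain ⟨k', hk', he⟩ := (h.minWeight_isLeast (Γ.charClass k)).1
  obtain ⟨l, rfl⟩ : ∃ l, k = k'.shift l := Quotient.exact (s := Γ.charSetoid) hk'
  rw [← he]
  exact Γ.w_shift_sub_int _ _

/-- The value at `(k, I)` of the augmentation: `U^{w(k) - min_{[k]} w} x_{[k]}` if `I = ∅`. -/
def NegDef.augmentationFun (h : Γ.NegDef) :
    (Γ.CharClass →₀ TPlus) →ₗ[ℤ[X]] (Γ.Cube → TPlus) where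
  toFun x c :=
    if c.2 = ∅ then uPow (Γ.w c.1 - h.minWeight (Γ.charClass c.1)) • x (Γ.charClass c.1) else 0
  map_add' x y := by
    ext c
    by_cases hc : c.2 = ∅ <;> simp [hc]
  map_smul' p x := by
    ext c
    by_cases hc : c.2 = ∅ <;> simp [hc, smul_smul, mul_comm]

lemma NegDef.augmentationFun_mem (h : Γ.NegDef) (x : Γ.CharClass →₀ TPlus) :
    h.augmentationFun x ∈ Γ.cochains 0 := by
  choose N hN using fun c => TPlus.exists_pow_smul_eq_zero (x c)
  refine ⟨?_, ?_⟩
  · have hfin : (⋃ c ∈ (x.support : Set Γ.CharClass),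
        (fun k : Γ.Char => ((k, ∅) : Γ.Cube)) '' {k | Γ.w k ≤ h.minWeight c + N c}).Finite :=
      x.support.finite_toSet.biUnion fun c _ => (h.finite_le _).image _
    refine hfin.subset ?_
    rintro ⟨k, I⟩ hc
    simp only [augmentationFun, LinearMap.coe_mk, AddHom.coe_mk, Function.mem_support] at hc
    by_cases hI : I = ∅
    · subst hI
      rw [if_pos rfl] at hc
      simp only [Set.mem_iUnion]
      refine ⟨Γ.charClass k, ?_, k, ?_, rfl⟩
      · simp only [Finset.mem_coe, Finsupp.mem_support_iff]
        intro h0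
        exact hc (by rw [h0, smul_zero])
      · by_contra hlt
        refine hc (pow_smul_eq_zero_of_le (hN _) (Nat.le_floor ?_))
        rw [Set.mem_ofPred_eq, not_le] at hlt
        linarith
    · exact absurd (if_neg hI) hc
  · intro c hc
    by_contra hcard
    refine hc (if_neg fun hI => hcard ?_)
    rw [hI, Finset.card_empty]

/-- The augmentation `ε : ⨁_{[k]} 𝒯⁺_{d[k]} → ℱ⁰`, `ε(x)(k) = U^{w(k) - d[k]/2} x_{[k]}`.
(As a `ℤ[U]`-module without its grading, `𝒯⁺_{d[k]}` is `𝒯₀⁺`.) -/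
def NegDef.augmentation (h : Γ.NegDef) : (Γ.CharClass →₀ TPlus) →ₗ[ℤ[X]] Γ.cochains 0 :=
  h.augmentationFun.codRestrict _ h.augmentationFun_mem

lemma NegDef.delta_augmentationFun (h : Γ.NegDef) (x : Γ.CharClass →₀ TPlus) :
    Γ.delta (h.augmentationFun x) = 0 := by
  ext ⟨k, I⟩
  refine Finset.sum_eq_zero fun j hj => ?_
  change j ∈ I at hj
  suffices Γ.deltaDir j (h.augmentationFun x) (k, I) = 0 by rw [this, smul_zero]
  rw [deltaDir_apply]
  by_cases hI : I.erase j = ∅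
  · have hcl : Γ.charClass (k.shift (E {j})) = Γ.charClass k :=
      Quotient.sound (s := Γ.charSetoid) (Setoid.symm' _ ⟨_, rfl⟩)
    have h1 := Γ.wCube_mono k (Finset.erase_subset j I)
    have h2 := Γ.wCube_shift_le k hj
    have i1 := Γ.wCube_sub_int k 0 I (I.erase j)
    have i2 := Γ.wCube_sub_int k (E {j}) I (I.erase j)
    have m1 := h.minWeight_le k
    have m2 := h.minWeight_le (k.shift (E {j}))
    have n1 := h.sub_minWeight_int k
    have n2 := h.sub_minWeight_int (k.shift (E {j}))
    rw [Char.shift_zero] at i1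
    simp only [hI, wCube_empty, hcl] at h1 h2 i1 i2 m1 m2 n1 n2 ⊢
    simp only [augmentationFun, LinearMap.coe_mk, AddHom.coe_mk, if_true, hcl, smul_smul]
    rw [uPow_mul (sub_nonneg.mpr h1) (sub_nonneg.mpr m1) i1 n1,
      uPow_mul (sub_nonneg.mpr h2) (sub_nonneg.mpr m2) i2 n2, sub_add_sub_cancel,
      sub_add_sub_cancel, sub_self]
  · simp [augmentationFun, hI]

lemma NegDef.augmentation_d (h : Γ.NegDef) :
    (ModuleCat.ofHom h.augmentation : ModuleCat.of ℤ[X] (Γ.CharClass →₀ TPlus) ⟶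
      Γ.cochainComplex.X 0) ≫ Γ.cochainComplex.d 0 1 = 0 := by
  rw [Γ.cochainComplex_d 0]
  exact ModuleCat.hom_ext (LinearMap.ext fun x => Subtype.ext (h.delta_augmentationFun x))

/-- The canonical submodule `𝕋(Γ) = ⨁_{[k]} 𝒯⁺_{d[k]}` of `ℍ⁰(Γ)`: the image of the map
`⨁_{[k]} 𝒯⁺_{d[k]} → ℍ⁰(Γ)` induced by the augmentation. -/
def NegDef.canonicalSubmodule (h : Γ.NegDef) : Submodule ℤ[X] (Γ.latticeCohomology 0) :=
  LinearMap.range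
    (Γ.cochainComplex.liftCycles (ModuleCat.ofHom h.augmentation) 1 (by simp) h.augmentation_d ≫
      Γ.cochainComplex.homologyπ 0).hom

variable (Γ)

/-! ### The graphs `Γ∖j₀`, `Γ_{j₀}^+` and `Γ^b` -/

/-- The graph `Γ∖j₀`: the vertex `j₀` and its adjacent edges are deleted. -/
def delete (j₀ : J) : PlumbingGraph {j : J // j ≠ j₀} where
  graph := Γ.graph.comap Subtype.val
  e j := Γ.e j

/-- The graph `Γ_{j₀}^+`: the decoration `e_{j₀}` is replaced by `e_{j₀} + 1`. -/
def incr (j₀ : J) : PlumbingGraph J where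
  graph := Γ.graph
  e := Function.update Γ.e j₀ (Γ.e j₀ + 1)

/-- The graph `Γ^b`: a new vertex `⊤` with decoration `-1` is attached to `j₀` by one edge. -/
def attach (j₀ : J) : PlumbingGraph (WithTop J) where
  graph := Γ.graph.map Function.Embedding.coeWithTop ⊔ SimpleGraph.edge ⊤ (j₀ : WithTop J)
  e := WithTop.recTopCoe (-1) Γ.e

variable (j₀ : J)

lemma delete_mat (i j : {j : J // j ≠ j₀}) : (Γ.delete j₀).mat i j = Γ.mat i j := by
  classical
  simp [mat, delete, Subtype.ext_iff]

lemma incr_mat (i j : J) :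
    (Γ.incr j₀).mat i j = Γ.mat i j + if i = j₀ ∧ j = j₀ then 1 else 0 := by
  classical
  by_cases hij : i = j
  · subst hij
    by_cases hi : i = j₀
    · subst hi; simp [mat, incr]
    · simp [mat, incr, hi]
  · have : ¬(i = j₀ ∧ j = j₀) := fun h => hij (h.1.trans h.2.symm)
    simp only [mat, incr, Matrix.of_apply, if_neg hij, if_neg this, add_zero]
    rfl

lemma attach_mat_coe (i j : J) :
    (Γ.attach j₀).mat (i : WithTop J) (j : WithTop J) = Γ.mat i j := by
  classical
  simp [mat, attach, SimpleGraph.edge_adj, SimpleGraph.map_adj]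

lemma attach_mat_top_coe (j : J) :
    (Γ.attach j₀).mat ⊤ (j : WithTop J) = if j = j₀ then 1 else 0 := by
  classical
  simp [mat, attach, SimpleGraph.edge_adj, SimpleGraph.map_adj]

lemma attach_mat_top_top : (Γ.attach j₀).mat ⊤ ⊤ = -1 := by
  simp [mat_self, attach]

lemma incr_matQ_mulVec (x : J → ℚ) (i : J) :
    (Γ.incr j₀).matQ.mulVec x i = Γ.matQ.mulVec x i + if i = j₀ then x j₀ else 0 := by
  have : ∀ j, (Γ.incr j₀).matQ i j * x j
      = Γ.matQ i j * x j + if j = j₀ then (if i = j₀ then x j else 0) else 0 := by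
    intro j
    simp only [matQ, Matrix.map_apply, incr_mat]
    by_cases h1 : i = j₀ <;> by_cases h2 : j = j₀ <;> simp [h1, h2, add_mul]
  simp only [Matrix.mulVec, dotProduct, this, Finset.sum_add_distrib]
  simp

lemma incr_mat_mulVec (x : J → ℤ) (i : J) :
    (Γ.incr j₀).mat.mulVec x i = Γ.mat.mulVec x i + if i = j₀ then x j₀ else 0 := by
  have : ∀ j, (Γ.incr j₀).mat i j * x j
      = Γ.mat i j * x j + if j = j₀ then (if i = j₀ then x j else 0) else 0 := by
    intro j
    simp only [incr_mat]
    by_cases h1 : i = j₀ <;> by_cases h2 : j = j₀ <;> simp [h1, h2, add_mul]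
  simp only [Matrix.mulVec, dotProduct, this, Finset.sum_add_distrib]
  simp

lemma sum_withTop {M : Type*} [AddCommMonoid M] (f : WithTop J → M) :
    ∑ x, f x = f ⊤ + ∑ j : J, f j :=
  Fintype.sum_option f

lemma attach_matQ_mulVec_top (y : WithTop J → ℚ) :
    (Γ.attach j₀).matQ.mulVec y ⊤ = y j₀ - y ⊤ := by
  simp only [Matrix.mulVec, dotProduct, sum_withTop, matQ, Matrix.map_apply, attach_mat_top_top,
    attach_mat_top_coe]
  simp
  ring

lemma attach_matQ_mulVec_coe (y : WithTop J → ℚ) (i : J) :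
    (Γ.attach j₀).matQ.mulVec y (i : WithTop J)
      = Γ.matQ.mulVec (fun j => y j) i + if i = j₀ then y ⊤ else 0 := by
  simp only [Matrix.mulVec, dotProduct, sum_withTop, matQ, Matrix.map_apply, attach_mat_coe,
    (Γ.attach j₀).mat_symm i ⊤, attach_mat_top_coe]
  by_cases h : i = j₀ <;> simp [h, add_comm]

variable {Γ j₀}

lemma NegDef.of_incr (h : (Γ.incr j₀).NegDef) : Γ.NegDef := by
  intro x hx
  have h1 := h x hx
  have h2 : x ⬝ᵥ ((Γ.incr j₀).matQ.mulVec x) = x ⬝ᵥ (Γ.matQ.mulVec x) + x j₀ * x j₀ := by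
    simp only [dotProduct, incr_matQ_mulVec, mul_add, Finset.sum_add_distrib]
    simp
  nlinarith [mul_self_nonneg (x j₀)]

lemma NegDef.delete (h : Γ.NegDef) : (Γ.delete j₀).NegDef := by
  intro x hx
  set y : J → ℚ := fun j => if hj : j ≠ j₀ then x ⟨j, hj⟩ else 0 with hy
  have hyx : ∀ i : {j : J // j ≠ j₀}, y i = x i := fun i => by simp [hy, i.2]
  have hy0 : ∀ j ∉ Set.range (Subtype.val : {j : J // j ≠ j₀} → J), y j = 0 := by
    intro j hj
    by_cases hj' : j = j₀
    · simp [hy, hj']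
    · exact absurd ⟨⟨j, hj'⟩, rfl⟩ hj
  have hne : y ≠ 0 := by
    intro h0
    apply hx
    ext i
    rw [← hyx, h0]; rfl
  refine lt_of_eq_of_lt ?_ (h y hne)
  refine Fintype.sum_of_injective Subtype.val Subtype.val_injective _ _ (fun j hj => ?_) fun i => ?_
  · rw [hy0 j hj, zero_mul]
  · rw [hyx]
    congr 1
    refine Fintype.sum_of_injective Subtype.val Subtype.val_injective _ _ (fun j hj => ?_)
      fun j => ?_
    · rw [hy0 j hj, mul_zero]
    · change (Γ.delete j₀).matQ i j * x j = Γ.matQ i j * y j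
      rw [hyx, matQ, matQ, Matrix.map_apply, Matrix.map_apply, delete_mat]

lemma Nondegenerate.attach (h : (Γ.incr j₀).Nondegenerate) : (Γ.attach j₀).Nondegenerate := by
  refine nondegenerate_of_mulVec fun y hy => ?_
  have h1 : y j₀ - y ⊤ = 0 := by rw [← Γ.attach_matQ_mulVec_top, hy]; rfl
  have h2 : (Γ.incr j₀).matQ.mulVec (fun j : J => y j) = 0 := by
    ext i
    rw [incr_matQ_mulVec, sub_eq_zero.mp h1, ← attach_matQ_mulVec_coe, hy]
    rfl
  have h3 : (fun j : J => y j) = 0 := by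
    by_contra hne
    exact h (Matrix.exists_mulVec_eq_zero_iff.mp ⟨_, hne, h2⟩)
  have h4 : ∀ j : J, y j = 0 := fun j => congrFun h3 j
  ext x
  induction x using WithTop.recTopCoe with
  | top => rw [← sub_eq_zero.mp h1, h4]; rfl
  | coe j => exact h4 j

/-! ### Comparison of weights along an inclusion of graphs -/

section Incl

variable {K : Type*} [Fintype K] [LinearOrder K] {H : PlumbingGraph K} {f : K ↪o J}

lemma extend_not_range (l : K → ℤ) {j : J} (hj : j ∉ Set.range f) :
    Function.extend f l 0 j = 0 :=
  Function.extend_apply' _ _ _ hj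

lemma extend_map (l : K → ℤ) (i : K) : Function.extend f l 0 (f i) = l i :=
  f.injective.extend_apply _ _ _

lemma mulVec_extend (hM : ∀ i j, H.mat i j = Γ.mat (f i) (f j)) (l : K → ℤ) (i : K) :
    Γ.mat.mulVec (Function.extend f l 0) (f i) = H.mat.mulVec l i := by
  symm
  refine Fintype.sum_of_injective f f.injective _ _ (fun j hj => ?_) fun j => ?_
  · rw [extend_not_range l hj, mul_zero]
  · change H.mat i j * l j = Γ.mat (f i) (f j) * Function.extend f l 0 (f j)
    rw [hM, extend_map]

lemma w_shift_extend (hΓ : Γ.Nondegenerate) (hH : H.Nondegenerate)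
    (hM : ∀ i j, H.mat i j = Γ.mat (f i) (f j)) (k : Γ.Char) (κ : H.Char)
    (hk : ∀ i, k.1 (f i) = κ.1 i) (l : K → ℤ) :
    Γ.w (k.shift (Function.extend f l 0)) = H.w (κ.shift l) + (Γ.w k - H.w κ) := by
  rw [w_shift _ hΓ, w_shift _ hH]
  have e1 : k.1 ⬝ᵥ (Function.extend f l 0) = κ.1 ⬝ᵥ l := by
    symm
    refine Fintype.sum_of_injective f f.injective _ _ (fun j hj => ?_) fun j => ?_
    · rw [extend_not_range l hj, mul_zero]
    · rw [hk, extend_map]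
  have e2 : (Function.extend f l 0) ⬝ᵥ (Γ.mat.mulVec (Function.extend f l 0))
      = l ⬝ᵥ (H.mat.mulVec l) := by
    symm
    refine Fintype.sum_of_injective f f.injective _ _ (fun j hj => ?_) fun j => ?_
    · rw [extend_not_range l hj, zero_mul]
    · rw [mulVec_extend hM, extend_map]
  rw [e1, e2]
  ring

lemma E_map (I : Finset K) : E (I.map f.toEmbedding) = Function.extend f (E I) 0 := by
  ext j
  by_cases hj : j ∈ Set.range f
  · obtain ⟨i, rfl⟩ := hj
    rw [extend_map]
    simp [E]
  · rw [extend_not_range _ hj, E, if_neg]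
    intro hj'
    obtain ⟨i, -, rfl⟩ := Finset.mem_map.mp hj'
    exact hj ⟨i, rfl⟩

lemma wCube_extend (hΓ : Γ.Nondegenerate) (hH : H.Nondegenerate)
    (hM : ∀ i j, H.mat i j = Γ.mat (f i) (f j)) (k : Γ.Char) (κ : H.Char)
    (hk : ∀ i, k.1 (f i) = κ.1 i) (l : K → ℤ) (I : Finset K) :
    Γ.wCube (k.shift (Function.extend f l 0), I.map f.toEmbedding)
      = H.wCube (κ.shift l, I) + (Γ.w k - H.w κ) := by
  have key : ∀ I' : Finset K,
      Γ.w ((k.shift (Function.extend f l 0)).shift (E (I'.map f.toEmbedding)))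
        = H.w ((κ.shift l).shift (E I')) + (Γ.w k - H.w κ) := by
    intro I'
    rw [Char.shift_shift, Char.shift_shift, ← w_shift_extend hΓ hH hM k κ hk, E_map]
    congr 2
    ext j
    by_cases hj : j ∈ Set.range f
    · obtain ⟨i, rfl⟩ := hj
      simp only [Pi.add_apply, extend_map]
    · simp only [Pi.add_apply, extend_not_range _ hj, add_zero]
  apply le_antisymm
  · refine Finset.sup'_le _ _ fun I' hI' => ?_
    obtain ⟨I'', hI'', rfl⟩ := Finset.subset_map_iff.mp (Finset.mem_powerset.mp hI')
    rw [key]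
    gcongr
    exact Finset.le_sup' (fun I' => H.w ((κ.shift l).shift (E I'))) (Finset.mem_powerset.mpr hI'')
  · rw [← le_sub_iff_add_le]
    refine Finset.sup'_le _ _ fun I' hI' => ?_
    rw [le_sub_iff_add_le, ← key]
    exact Finset.le_sup' (fun I' => Γ.w ((k.shift (Function.extend f l 0)).shift (E I')))
      (Finset.mem_powerset.mpr (Finset.map_subset_map.mpr (Finset.mem_powerset.mp hI')))

lemma sgn_map (I : Finset K) (i : K) : sgn (I.map f.toEmbedding) (f i) = sgn I i := by
  have : (I.map f.toEmbedding).filter (· ≤ f i) = (I.filter (· ≤ i)).map f.toEmbedding := by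
    ext j
    simp only [Finset.mem_filter, Finset.mem_map, RelEmbedding.coe_toEmbedding]
    constructor
    · rintro ⟨⟨a, ha, rfl⟩, h⟩
      exact ⟨a, ⟨ha, f.le_iff_le.mp h⟩, rfl⟩
    · rintro ⟨a, ⟨ha, h⟩, rfl⟩
      exact ⟨⟨a, ha, rfl⟩, f.le_iff_le.mpr h⟩
  rw [sgn, sgn, this, Finset.card_map]

lemma map_erase (I : Finset K) (i : K) :
    (I.erase i).map f.toEmbedding = (I.map f.toEmbedding).erase (f i) :=
  Finset.map_erase _ _ _

lemma E_singleton_map (i : K) : E ({f i} : Finset J) = Function.extend f (E {i}) 0 := by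
  rw [← E_map]
  rfl

end Incl

variable (Γ j₀)

/-! ### The operator `B̄` -/

/-- The inclusion of the vertices of `Γ∖j₀`. -/
abbrev inclDelete : {j : J // j ≠ j₀} ↪o J := OrderEmbedding.subtype _

/-- The integers `a` with `a ≡ e_{j₀} (mod 2)`. -/
abbrev Parity : Type := {a : ℤ // a ≡ Γ.e j₀ [ZMOD 2]}

variable {Γ j₀}

/-- The characteristic element `b(k) + a E_{j₀}^*` of `Γ`, where `b(∑ a_j E_{j,Γ∖j₀}^*) =
∑ a_j E_{j,Γ}^*`: its coordinates are those of `k`, together with the coordinate `a` at `j₀`. -/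
def Char.extendBy (k : (Γ.delete j₀).Char) (a : Γ.Parity j₀) : Γ.Char :=
  ⟨fun j => if hj : j ≠ j₀ then k.1 ⟨j, hj⟩ else a.1, by
    rw [isChar_iff]
    intro j
    by_cases hj : j = j₀
    · subst hj; simpa using a.2
    · rw [dif_pos hj]
      exact ((Γ.delete j₀).isChar_iff _).1 k.2 ⟨j, hj⟩⟩

lemma Char.extendBy_coe (k : (Γ.delete j₀).Char) (a : Γ.Parity j₀) (j : {j : J // j ≠ j₀}) :
    (k.extendBy a).1 j = k.1 j := by
  simp [extendBy, j.2]

lemma Char.extendBy_self (k : (Γ.delete j₀).Char) (a : Γ.Parity j₀) :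
    (k.extendBy a).1 j₀ = a := by
  simp [extendBy]

lemma Char.extendBy_injective :
    Function.Injective fun p : (Γ.delete j₀).Char × Γ.Parity j₀ => p.1.extendBy p.2 := by
  rintro ⟨k, a⟩ ⟨k', a'⟩ h
  have h' : (k.extendBy a).1 = (k'.extendBy a').1 := congrArg Subtype.val h
  refine Prod.ext (Char.ext (funext fun j => ?_)) (Subtype.ext ?_)
  · have := congrFun h' j
    rwa [extendBy_coe, extendBy_coe] at this
  · have := congrFun h' j₀
    rwa [extendBy_self, extendBy_self] at this

/-- Translation of the parameter `a` by an even number. -/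
def parityShift (n : ℤ) : Γ.Parity j₀ ≃ Γ.Parity j₀ where
  toFun a := ⟨a.1 - 2 * n, by
    have h := a.2
    rw [Int.ModEq] at h ⊢
    omega⟩
  invFun a := ⟨a.1 + 2 * n, by
    have h := a.2
    rw [Int.ModEq] at h ⊢
    omega⟩
  left_inv a := Subtype.ext (by simp)
  right_inv a := Subtype.ext (by simp)

lemma extend_inclDelete_self (l : {j : J // j ≠ j₀} → ℤ) :
    Function.extend (inclDelete j₀) l 0 j₀ = 0 :=
  extend_not_range l (by rintro ⟨i, hi⟩; exact i.2 hi)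

lemma Char.extendBy_shift (k : (Γ.delete j₀).Char) (a : Γ.Parity j₀) (i : {j : J // j ≠ j₀}) :
    (k.extendBy a).shift (E {(i : J)})
      = (k.shift (E {i})).extendBy (parityShift (Γ.mat j₀ i) a) := by
  have hE : ∀ j : J, Γ.mat.mulVec (E {(i : J)}) j = Γ.mat j i := by
    intro j
    have : E {(i : J)} = Pi.single (i : J) 1 := by
      ext m; simp [E, Pi.single_apply]
    rw [this, Matrix.mulVec_single_one]; rfl
  have hE' : ∀ j, (Γ.delete j₀).mat.mulVec (E {i}) j = Γ.mat j i := by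
    intro j
    have : E {i} = Pi.single i 1 := by
      ext m; simp [E, Pi.single_apply]
    rw [this, Matrix.mulVec_single_one]; exact delete_mat _ _ _ _
  apply Char.ext
  ext j
  by_cases hj : j = j₀
  · subst hj
    rw [extendBy_self]
    simp only [shift_val, Pi.add_apply, extendBy_self, toDual, Pi.smul_apply, Pi.neg_apply, hE,
      parityShift, Equiv.coe_fn_mk]
    simp only [nsmul_eq_mul]
    push_cast
    ring
  · have h1 := extendBy_coe (k.shift (E {i})) (parityShift (Γ.mat j₀ i) a) ⟨j, hj⟩
    have h2 := extendBy_coe k a ⟨j, hj⟩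
    simp only at h1 h2
    rw [h1]
    simp only [shift_val, Pi.add_apply, h2, toDual, Pi.smul_apply, Pi.neg_apply, hE, hE']

/-- The restriction `R(E_{j₀}) ∈ L'(Γ∖j₀)` of `E_{j₀}`. The restriction `R : L'(Γ) → L'(Γ∖j₀)`,
`E_{j,Γ}^* ↦ E_{j,Γ∖j₀}^*` for `j ≠ j₀` and `E_{j₀,Γ}^* ↦ 0`, forgets the coordinate at `j₀`. -/
def restrictE (Γ : PlumbingGraph J) (j₀ : J) : {j : J // j ≠ j₀} → ℤ :=
  fun j => Γ.toDual (E {j₀}) j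

/-- The number `n(k, a) = (k - r_{[k]}, R(E_{j₀})) + a + e_{j₀}`; it is an even integer if `r_{[k]}` is
a representative of the class `[k]`. -/
def signExponent (r : (Γ.delete j₀).CharClass → (Γ.delete j₀).Char) (k : (Γ.delete j₀).Char)
    (a : Γ.Parity j₀) : ℚ :=
  (Γ.delete j₀).dualForm (k.1 - (r ((Γ.delete j₀).charClass k)).1) (restrictE Γ j₀) + a.1 + Γ.e j₀

/-- The sign `(-1)^{n(k,a)/2}`. -/
def bSign (r : (Γ.delete j₀).CharClass → (Γ.delete j₀).Char) (k : (Γ.delete j₀).Char)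
    (a : Γ.Parity j₀) : ℤ :=
  ((Int.negOnePow ⌊signExponent r k a / 2⌋ : ℤˣ) : ℤ)

lemma bSign_shift (hdel : (Γ.delete j₀).Nondegenerate)
    (r : (Γ.delete j₀).CharClass → (Γ.delete j₀).Char) (k : (Γ.delete j₀).Char)
    (a : Γ.Parity j₀) (i : {j : J // j ≠ j₀}) :
    bSign r (k.shift (E {i})) (parityShift (Γ.mat j₀ i) a) = bSign r k a := by
  have hcl : (Γ.delete j₀).charClass (k.shift (E {i})) = (Γ.delete j₀).charClass k :=
    Quotient.sound (s := (Γ.delete j₀).charSetoid) (Setoid.symm' _ ⟨_, rfl⟩)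
  have hR : (Γ.delete j₀).dualForm ((Γ.delete j₀).toDual (E {i})) (restrictE Γ j₀)
      = Γ.mat j₀ i := by
    rw [dualForm_comm, dualForm_toDual _ hdel]
    have e1 : restrictE Γ j₀ ⬝ᵥ E {i} = restrictE Γ j₀ i := by
      have : E {i} = Pi.single i 1 := by
        ext m; simp [E, Pi.single_apply]
      rw [this]; simp
    have e2 : restrictE Γ j₀ i = -Γ.mat j₀ i := by
      have : E {j₀} = Pi.single j₀ 1 := by
        ext m; simp [E, Pi.single_apply]
      rw [restrictE, toDual, this, Matrix.mulVec_single_one, Pi.neg_apply, mat_symm]; rfl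
    rw [e1, e2]
    push_cast
    ring
  have : signExponent r (k.shift (E {i})) (parityShift (Γ.mat j₀ i) a) = signExponent r k a := by
    rw [signExponent, signExponent, hcl, Char.shift_val, add_sub_right_comm, dualForm_add_left,
      two_smul, dualForm_add_left, hR]
    simp only [parityShift, Equiv.coe_fn_mk]
    push_cast
    ring
  rw [bSign, bSign, this]

/-- The operator `(B̄^q φ)(k, I) = ∑_{a ≡ e_{j₀} (2)} (-1)^{n(k,a)/2} φ(b(k) + a E_{j₀}^*, I)`. The sum
is finite for `φ` of finite support. -/
def bFun (r : (Γ.delete j₀).CharClass → (Γ.delete j₀).Char) (φ : Γ.Cube → TPlus) :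
    (Γ.delete j₀).Cube → TPlus :=
  fun c => ∑ᶠ a : Γ.Parity j₀,
    bSign r c.1 a • φ (c.1.extendBy a, c.2.map (inclDelete j₀).toEmbedding)

lemma finite_support_smul {ι R : Type*} [SMulZeroClass R TPlus] {f : ι → TPlus}
    (hf : (Function.support f).Finite) (g : ι → R) :
    (Function.support fun a => g a • f a).Finite :=
  hf.subset fun a ha h => ha (by simp only [h, smul_zero])

lemma exists_of_finsum_ne_zero {ι : Type*} {f : ι → TPlus} (h : ∑ᶠ a, f a ≠ 0) :
    ∃ a, f a ≠ 0 := by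
  by_contra! hcon
  exact h (finsum_eq_zero_of_forall_eq_zero hcon)

lemma finite_extendBy {φ : Γ.Cube → TPlus} (hφ : (Function.support φ).Finite)
    (k : (Γ.delete j₀).Char) (I : Finset J) :
    (Function.support fun a : Γ.Parity j₀ => φ (k.extendBy a, I)).Finite := by
  refine hφ.preimage (f := fun a : Γ.Parity j₀ => ((k.extendBy a, I) : Γ.Cube)) fun a _ a' _ h => ?_
  have h1 : k.extendBy a = k.extendBy a' := congrArg Prod.fst h
  have := Char.extendBy_injective (a₁ := (k, a)) (a₂ := (k, a')) h1
  exact congrArg Prod.snd this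

lemma bFun_mem (r : (Γ.delete j₀).CharClass → (Γ.delete j₀).Char) {q : ℕ} {φ : Γ.Cube → TPlus}
    (hφ : φ ∈ Γ.cochains q) : bFun r φ ∈ (Γ.delete j₀).cochains q := by
  have key : ∀ c, bFun r φ c ≠ 0 →
      ∃ a : Γ.Parity j₀, φ (c.1.extendBy a, c.2.map (inclDelete j₀).toEmbedding) ≠ 0 := by
    intro c hc
    obtain ⟨a, ha⟩ := exists_of_finsum_ne_zero hc
    exact ⟨a, fun h => ha (by rw [h, smul_zero])⟩
  constructor
  · have hfin := hφ.1.preimage (f := fun p : (Γ.delete j₀).Cube × Γ.Parity j₀ =>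
      ((p.1.1.extendBy p.2, p.1.2.map (inclDelete j₀).toEmbedding) : Γ.Cube)) (by
        rintro ⟨⟨k, I⟩, a⟩ - ⟨⟨k', I'⟩, a'⟩ - h
        have h1 : k.extendBy a = k'.extendBy a' := congrArg Prod.fst h
        have h2 : I.map (inclDelete j₀).toEmbedding = I'.map (inclDelete j₀).toEmbedding :=
          congrArg Prod.snd h
        have h3 := Char.extendBy_injective (a₁ := (k, a)) (a₂ := (k', a')) h1
        rw [Prod.mk.injEq] at h3
        rw [h3.1, h3.2, Finset.map_injective _ h2])
    refine (hfin.image Prod.fst).subset fun c hc => ?_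
    obtain ⟨a, ha⟩ := key c hc
    exact ⟨(c, a), ha, rfl⟩
  · intro c hc
    obtain ⟨a, ha⟩ := key c hc
    rw [← hφ.2 _ ha, Finset.card_map]

/-- `B̄^q : ℱ^q(Γ) → ℱ^q(Γ∖j₀)`. -/
def bHom (r : (Γ.delete j₀).CharClass → (Γ.delete j₀).Char) (q : ℕ) :
    Γ.cochains q →ₗ[ℤ[X]] (Γ.delete j₀).cochains q where
  toFun φ := ⟨bFun r φ.1, bFun_mem r φ.2⟩
  map_add' φ ψ := by
    refine Subtype.ext (funext fun c => ?_)
    simp only [bFun, Submodule.coe_add, Pi.add_apply, smul_add]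
    exact finsum_add_distrib (finite_support_smul (finite_extendBy φ.2.1 c.1 _) _)
      (finite_support_smul (finite_extendBy ψ.2.1 c.1 _) _)
  map_smul' p φ := by
    refine Subtype.ext (funext fun c => ?_)
    simp only [bFun, Submodule.coe_smul, Pi.smul_apply, RingHom.id_apply]
    rw [smul_finsum' p (finite_support_smul (finite_extendBy φ.2.1 c.1 _) _)]
    exact finsum_congr fun a => smul_comm _ _ _

lemma deltaDir_bFun (hΓ : Γ.Nondegenerate) (hdel : (Γ.delete j₀).Nondegenerate)
    (r : (Γ.delete j₀).CharClass → (Γ.delete j₀).Char) {φ : Γ.Cube → TPlus}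
    (hφ : (Function.support φ).Finite) (k : (Γ.delete j₀).Char) (I : Finset {j : J // j ≠ j₀})
    (i : {j : J // j ≠ j₀}) :
    (Γ.delete j₀).deltaDir i (bFun r φ) (k, I) = ∑ᶠ a : Γ.Parity j₀, bSign r k a •
      Γ.deltaDir i φ (k.extendBy a, I.map (inclDelete j₀).toEmbedding) := by
  have hM : ∀ i j, (Γ.delete j₀).mat i j = Γ.mat (inclDelete j₀ i) (inclDelete j₀ j) :=
    Γ.delete_mat j₀
  have hw0 : ∀ (a : Γ.Parity j₀) (I' : Finset {j : J // j ≠ j₀}),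
      Γ.wCube (k.extendBy a, I'.map (inclDelete j₀).toEmbedding)
        = (Γ.delete j₀).wCube (k, I') + (Γ.w (k.extendBy a) - (Γ.delete j₀).w k) := by
    intro a I'
    have := wCube_extend hΓ hdel hM (k.extendBy a) k (k.extendBy_coe a) 0 I'
    rwa [Function.extend_zero, Char.shift_zero, Char.shift_zero] at this
  have hw1 : ∀ (a : Γ.Parity j₀) (I' : Finset {j : J // j ≠ j₀}),
      Γ.wCube ((k.extendBy a).shift (E {(i : J)}), I'.map (inclDelete j₀).toEmbedding)
        = (Γ.delete j₀).wCube (k.shift (E {i}), I')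
          + (Γ.w (k.extendBy a) - (Γ.delete j₀).w k) := by
    intro a I'
    have := wCube_extend hΓ hdel hM (k.extendBy a) k (k.extendBy_coe a) (E {i}) I'
    rwa [← E_singleton_map] at this
  rw [deltaDir_apply_of_mem_iff _ i _ k I (I.erase i) fun _ => Finset.mem_erase]
  have hf0 : (Function.support fun a : Γ.Parity j₀ =>
      bSign r k a • φ (k.extendBy a, (I.erase i).map (inclDelete j₀).toEmbedding)).Finite :=
    finite_support_smul (finite_extendBy hφ k _) _
  have hf1 : (Function.support fun a : Γ.Parity j₀ => bSign r k a •
      φ ((k.extendBy a).shift (E {(i : J)}),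
        (I.erase i).map (inclDelete j₀).toEmbedding)).Finite := by
    have h1 := finite_extendBy hφ (k.shift (E {i}))
      ((I.erase i).map (inclDelete j₀).toEmbedding)
    have h2 := h1.preimage (f := parityShift (Γ.mat j₀ i)) (Equiv.injective _).injOn
    refine h2.subset fun a ha h => ha ?_
    simp only at h
    simp only [Char.extendBy_shift, h, smul_zero]
  have e1 : bFun r φ (k.shift (E {i}), I.erase i) = ∑ᶠ a : Γ.Parity j₀, bSign r k a •
      φ ((k.extendBy a).shift (E {(i : J)}), (I.erase i).map (inclDelete j₀).toEmbedding) := by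
    rw [bFun, ← finsum_comp_equiv (parityShift (Γ.mat j₀ i))]
    refine finsum_congr fun a => ?_
    rw [bSign_shift hdel, Char.extendBy_shift]
  rw [e1, bFun, smul_finsum' _ hf0, smul_finsum' _ hf1, ← finsum_sub_distrib]
  · refine finsum_congr fun a => ?_
    rw [deltaDir_apply, hw0]
    have he : (I.map (inclDelete j₀).toEmbedding).erase (i : J)
        = (I.erase i).map (inclDelete j₀).toEmbedding := (map_erase I i).symm
    rw [he, hw0, hw1, add_sub_add_right_eq_sub, add_sub_add_right_eq_sub, smul_sub,
      smul_comm (bSign r k a), smul_comm (bSign r k a)]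
  · exact finite_support_smul hf0 _
  · exact finite_support_smul hf1 _

lemma delta_bFun (hΓ : Γ.Nondegenerate) (hdel : (Γ.delete j₀).Nondegenerate)
    (r : (Γ.delete j₀).CharClass → (Γ.delete j₀).Char) {q : ℕ} {φ : Γ.Cube → TPlus}
    (hφ : φ ∈ Γ.cochains q) : (Γ.delete j₀).delta (bFun r φ) = bFun r (Γ.delta φ) := by
  ext ⟨k, I⟩
  rw [delta_apply, bFun]
  simp only [delta_apply, Finset.sum_map, Finset.smul_sum]
  have hdir : ∀ i : {j : J // j ≠ j₀}, (Function.support fun a : Γ.Parity j₀ => bSign r k a •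
      Γ.deltaDir i φ (k.extendBy a, I.map (inclDelete j₀).toEmbedding)).Finite := by
    intro i
    have h1 := finite_extendBy hφ.1 k ((I.map (inclDelete j₀).toEmbedding).erase (i : J))
    have h2 := (finite_extendBy hφ.1 (k.shift (E {i}))
      ((I.map (inclDelete j₀).toEmbedding).erase (i : J))).preimage
        (f := parityShift (Γ.mat j₀ i)) (Equiv.injective _).injOn
    refine (h1.union h2).subset fun a ha => ?_
    by_contra hcon
    simp only [Set.mem_union, Function.mem_support, Set.mem_preimage, not_or, not_not] at hcon
    refine ha ?_
    simp only [deltaDir_apply, Char.extendBy_shift, hcon.1, hcon.2, smul_zero, sub_zero]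
  rw [finsum_sum_comm]
  · refine Finset.sum_congr rfl fun i _ => ?_
    rw [deltaDir_bFun hΓ hdel r hφ.1, smul_finsum' _ (hdir i)]
    refine finsum_congr fun a => ?_
    have hs : sgn (I.map (inclDelete j₀).toEmbedding) (i : J) = sgn I i :=
      sgn_map (f := inclDelete j₀) I i
    simp only [RelEmbedding.coe_toEmbedding, OrderEmbedding.subtype_apply, hs]
    exact smul_comm _ _ _
  · intro i _
    refine (hdir i).subset fun a ha h => ha ?_
    simp only [RelEmbedding.coe_toEmbedding, OrderEmbedding.subtype_apply]
    rw [smul_comm]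
    simp only at h
    rw [h, smul_zero]

/-- The morphism of complexes `B̄^* : ℱ^*(Γ) → ℱ^*(Γ∖j₀)` (for a choice `r` of representatives of the
classes of characteristic elements of `Γ∖j₀`). -/
def bMap (hΓ : Γ.Nondegenerate) (hdel : (Γ.delete j₀).Nondegenerate)
    (r : (Γ.delete j₀).CharClass → (Γ.delete j₀).Char) :
    Γ.cochainComplex ⟶ (Γ.delete j₀).cochainComplex :=
  CochainComplex.ofHom (fun q => ModuleCat.ofHom (bHom r q)) fun q => by
    rw [cochainComplex_d, cochainComplex_d]
    exact ModuleCat.hom_ext (LinearMap.ext fun φ => Subtype.ext (delta_bFun hΓ hdel r φ.2))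

/-! ### The operator `A` -/

/-- The inclusion of the vertices of `Γ` into the vertices of `Γ^b`. -/
abbrev inclAttach : J ↪o WithTop J := WithTop.coeOrderHom

/-- Odd integers. -/
abbrev OddInt : Type := {a : ℤ // Odd a}

variable (j₀) in
/-- The characteristic element `b(k) + a E_{new}^*` of `Γ^b`, for `k ∈ Char(Γ)` and `a` odd (the
operator `b` for the pair `Γ = Γ^b∖new`). -/
def Char.attachBy (k : Γ.Char) (a : OddInt) : (Γ.attach j₀).Char :=
  ⟨WithTop.recTopCoe a.1 k.1, by
    rw [isChar_iff]
    intro x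
    induction x using WithTop.recTopCoe with
    | top =>
      obtain ⟨m, hm⟩ := a.2
      change a.1 ≡ -1 [ZMOD 2]
      rw [Int.ModEq]
      omega
    | coe j => exact (Γ.isChar_iff _).1 k.2 j⟩

/-- The map `π_* : Char(Γ^b) → Char(Γ_{j₀}^+)` of blowing down the new vertex. Since
`(π_* x, E_j) = (x, π^* E_j)` with `π^* E_j = E_j` for `j ≠ j₀` and `π^* E_{j₀} = E_{j₀} + E_{new}`, it
maps `∑ a_j E_j^* + a E_{new}^*` to `∑ a_j E_j^* + a E_{j₀}^*`. -/
def Char.blowDown (k : (Γ.attach j₀).Char) : (Γ.incr j₀).Char :=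
  ⟨fun j => k.1 j + if j = j₀ then k.1 ⊤ else 0, by
    rw [isChar_iff]
    intro j
    have h1 := ((Γ.attach j₀).isChar_iff _).1 k.2 j
    have h2 := ((Γ.attach j₀).isChar_iff _).1 k.2 ⊤
    change k.1 j ≡ Γ.e j [ZMOD 2] at h1
    change k.1 ⊤ ≡ -1 [ZMOD 2] at h2
    by_cases hj : j = j₀
    · subst hj
      simp only [incr, Function.update_self, if_true]
      rw [Int.ModEq] at *
      omega
    · simpa only [incr, Function.update_of_ne hj, hj, if_false, add_zero] using h1⟩

lemma Char.blowDown_apply (k : (Γ.attach j₀).Char) (j : J) :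
    k.blowDown.1 j = k.1 j + if j = j₀ then k.1 ⊤ else 0 := rfl

lemma Char.attachBy_top (k : Γ.Char) (a : OddInt) : (k.attachBy j₀ a).1 ⊤ = a.1 := rfl

lemma Char.attachBy_coe (k : Γ.Char) (a : OddInt) (j : J) :
    (k.attachBy j₀ a).1 (inclAttach j) = k.1 j := rfl

/-- Translation of the parameter `a` by an even number. -/
def oddShift (n : ℤ) : OddInt ≃ OddInt where
  toFun a := ⟨a.1 - 2 * n, by
    obtain ⟨m, hm⟩ := a.2
    exact ⟨m - n, by omega⟩⟩
  invFun a := ⟨a.1 + 2 * n, by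
    obtain ⟨m, hm⟩ := a.2
    exact ⟨m + n, by omega⟩⟩
  left_inv a := Subtype.ext (by simp)
  right_inv a := Subtype.ext (by simp)

lemma extend_inclAttach_top (l : J → ℤ) : Function.extend inclAttach l 0 ⊤ = 0 :=
  extend_not_range l (by rintro ⟨i, hi⟩; exact WithTop.coe_ne_top hi)

lemma extend_inclAttach_coe (l : J → ℤ) (j : J) :
    Function.extend inclAttach l 0 (j : WithTop J) = l j :=
  extend_map (f := inclAttach) l j

lemma attach_mat_mulVec_extend_top (l : J → ℤ) :
    (Γ.attach j₀).mat.mulVec (Function.extend inclAttach l 0) ⊤ = l j₀ := by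
  simp only [Matrix.mulVec, dotProduct, sum_withTop, extend_inclAttach_top, extend_inclAttach_coe,
    attach_mat_top_coe]
  simp

lemma attach_mat_mulVec_extend_coe (l : J → ℤ) (j : J) :
    (Γ.attach j₀).mat.mulVec (Function.extend inclAttach l 0) (j : WithTop J)
      = Γ.mat.mulVec l j :=
  mulVec_extend (f := inclAttach) (fun i j => (Γ.attach_mat_coe j₀ i j).symm) l j

lemma Char.attachBy_shift (k : Γ.Char) (a : OddInt) (l : J → ℤ) :
    (k.attachBy j₀ a).shift (Function.extend inclAttach l 0)
      = (k.shift l).attachBy j₀ (oddShift (l j₀) a) := by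
  apply Char.ext
  ext x
  induction x using WithTop.recTopCoe with
  | top =>
    rw [attachBy_top, shift_apply, attachBy_top, attach_mat_mulVec_extend_top]
    rfl
  | coe j =>
    have h1 := attachBy_coe (j₀ := j₀) (k.shift l) (oddShift (l j₀) a) j
    have h2 := attachBy_coe (j₀ := j₀) k a j
    rw [WithTop.coeOrderHom_apply] at h1 h2
    rw [h1, shift_apply, shift_apply, h2, attach_mat_mulVec_extend_coe]

lemma Char.blowDown_shift (k : (Γ.attach j₀).Char) (l : J → ℤ) :
    (k.shift (Function.extend inclAttach l 0)).blowDown = k.blowDown.shift l := by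
  apply Char.ext
  ext j
  simp only [blowDown_apply, shift_apply, attach_mat_mulVec_extend_top,
    attach_mat_mulVec_extend_coe, incr_mat_mulVec]
  by_cases hj : j = j₀
  · simp only [hj, if_true]; ring
  · simp only [hj, if_false]; ring

lemma w_attach (h : (Γ.incr j₀).Nondegenerate) (k : (Γ.attach j₀).Char) :
    (Γ.attach j₀).w k = (Γ.incr j₀).w k.blowDown + (((k.1 ⊤ : ℤ) : ℚ) ^ 2 - 1) / 8 := by
  set u : J → ℚ := (Γ.incr j₀).matQ⁻¹.mulVec fun j => (k.blowDown.1 j : ℚ) with hu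
  have hMu : (Γ.incr j₀).matQ.mulVec u = fun j => (k.blowDown.1 j : ℚ) := by
    rw [hu, Matrix.mulVec_mulVec, Matrix.mul_nonsing_inv _ (isUnit_iff_ne_zero.mpr h),
      Matrix.one_mulVec]
  set v : WithTop J → ℚ := WithTop.recTopCoe (u j₀ - k.1 ⊤) u with hv
  have hvt : v ⊤ = u j₀ - k.1 ⊤ := rfl
  have hvc : ∀ j : J, v j = u j := fun j => rfl
  have hbd : ∀ j, k.blowDown.1 j = k.1 j + if j = j₀ then k.1 ⊤ else 0 := fun j => rfl
  have hMv : (Γ.attach j₀).matQ.mulVec v = fun x => (k.1 x : ℚ) := by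
    ext x
    induction x using WithTop.recTopCoe with
    | top => rw [attach_matQ_mulVec_top, hvt, hvc]; ring
    | coe j =>
      have h1 := congrFun hMu j
      simp only [incr_matQ_mulVec, hbd] at h1
      rw [attach_matQ_mulVec_coe]
      simp only [hvc, hvt]
      by_cases hj : j = j₀
      · simp only [hj, if_true] at h1 ⊢; push_cast at h1; linarith
      · simp only [hj, if_false] at h1 ⊢; push_cast at h1; linarith
  have e1 := (Γ.attach j₀).dualForm_eq (Nondegenerate.attach h) k.1 k.1 v hMv
  have e2 := (Γ.incr j₀).dualForm_eq h k.blowDown.1 k.blowDown.1 u hMu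
  have e3 : (fun x => (k.1 x : ℚ)) ⬝ᵥ v
      = (fun j => (k.blowDown.1 j : ℚ)) ⬝ᵥ u - ((k.1 ⊤ : ℤ) : ℚ) ^ 2 := by
    have : ∀ j : J, ((k.1 j + if j = j₀ then k.1 ⊤ else 0 : ℤ) : ℚ) * u j
        = (k.1 j : ℚ) * u j + if j = j₀ then (k.1 ⊤ : ℚ) * u j else 0 := by
      intro j
      by_cases hj : j = j₀ <;> simp [hj, add_mul]
    simp only [dotProduct, sum_withTop, hvt, hvc, hbd, this, Finset.sum_add_distrib]
    simp
    ring
  have hc : (Fintype.card (WithTop J) : ℚ) = Fintype.card J + 1 := by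
    have : Fintype.card (WithTop J) = Fintype.card J + 1 := Fintype.card_option
    rw [this]; push_cast; rfl
  rw [w, w, e1, e2, e3, hc]
  ring

/-- The exponent `w_{Γ^b}(k', I) - w_{Γ^+}(π_*(k'), I)` for `k' = b(k) + a E_{new}^*`. -/
def aExp (j₀ : J) (k : Γ.Char) (a : OddInt) (I : Finset J) : ℚ :=
  (Γ.attach j₀).wCube (k.attachBy j₀ a, I.map inclAttach.toEmbedding)
    - (Γ.incr j₀).wCube ((k.attachBy j₀ a).blowDown, I)

lemma odd_sq (a : OddInt) : ∃ n : ℕ, (((a.1 : ℤ) : ℚ) ^ 2 - 1) / 8 = n := by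
  obtain ⟨m, hm⟩ := a.2
  obtain ⟨c, hc⟩ := Int.even_mul_succ_self m
  have hc0 : 0 ≤ c := by
    rcases le_or_gt 0 m with h | h <;> nlinarith
  lift c to ℕ using hc0
  refine ⟨c, ?_⟩
  have hc' : (m : ℚ) * (m + 1) = c + c := by exact_mod_cast hc
  rw [hm]
  push_cast
  linarith

lemma w_attachBy_shift (h : (Γ.incr j₀).Nondegenerate) (k : Γ.Char) (a : OddInt) (l : J → ℤ) :
    (Γ.attach j₀).w ((k.attachBy j₀ a).shift (Function.extend inclAttach l 0))
      = (Γ.incr j₀).w ((k.attachBy j₀ a).blowDown.shift l)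
        + ((((oddShift (l j₀) a).1 : ℤ) : ℚ) ^ 2 - 1) / 8 := by
  rw [w_attach h, Char.blowDown_shift, Char.attachBy_shift, Char.attachBy_top]

lemma aExp_ge (h : (Γ.incr j₀).Nondegenerate) (k : Γ.Char) (a : OddInt) (I : Finset J) :
    ∃ n : ℤ, (n = 0 ∨ n = 1) ∧ ((((oddShift n a).1 : ℤ) : ℚ) ^ 2 - 1) / 8 ≤ aExp j₀ k a I := by
  obtain ⟨I', hI', he⟩ := Finset.exists_mem_eq_sup' (s := I.powerset)
    ⟨∅, Finset.empty_mem_powerset _⟩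
    fun I' => (Γ.incr j₀).w ((k.attachBy j₀ a).blowDown.shift (E I'))
  refine ⟨E I' j₀, ?_, ?_⟩
  · by_cases hj : j₀ ∈ I' <;> simp [E, hj]
  · have h1 := w_attachBy_shift h k a (E I')
    have h2 : (Γ.attach j₀).w ((k.attachBy j₀ a).shift (Function.extend inclAttach (E I') 0))
        ≤ (Γ.attach j₀).wCube (k.attachBy j₀ a, I.map inclAttach.toEmbedding) := by
      rw [← E_map]
      exact Finset.le_sup' (fun I' => (Γ.attach j₀).w ((k.attachBy j₀ a).shift (E I')))
        (Finset.mem_powerset.mpr (Finset.map_subset_map.mpr (Finset.mem_powerset.mp hI')))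
    have h3 : (Γ.incr j₀).wCube ((k.attachBy j₀ a).blowDown, I)
        = (Γ.incr j₀).w ((k.attachBy j₀ a).blowDown.shift (E I')) := he
    rw [aExp, h3]
    linarith

lemma aExp_nonneg (h : (Γ.incr j₀).Nondegenerate) (k : Γ.Char) (a : OddInt) (I : Finset J) :
    0 ≤ aExp j₀ k a I := by
  obtain ⟨n, -, hn⟩ := aExp_ge h k a I
  obtain ⟨m, hm⟩ := odd_sq (oddShift n a)
  rw [hm] at hn
  exact le_trans (Nat.cast_nonneg m) hn

lemma aExp_int (h : (Γ.incr j₀).Nondegenerate) (k : Γ.Char) (a : OddInt) (I : Finset J) :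
    ∃ n : ℤ, aExp j₀ k a I = n := by
  obtain ⟨m, hm⟩ := (Γ.attach j₀).wCube_sub_w_int (k.attachBy j₀ a) 0
    (I.map inclAttach.toEmbedding)
  obtain ⟨n, hn⟩ := (Γ.incr j₀).wCube_sub_w_int (k.attachBy j₀ a).blowDown 0 I
  obtain ⟨t, ht⟩ := odd_sq a
  have h1 := w_attach h (k.attachBy j₀ a)
  rw [Char.attachBy_top, ht] at h1
  rw [Char.shift_zero] at hm hn
  refine ⟨m - n + t, ?_⟩
  rw [aExp]
  push_cast
  linarith

lemma aExp_eq (h : (Γ.incr j₀).Nondegenerate) (k : Γ.Char) (a : OddInt) {I : Finset J}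
    (hI : j₀ ∉ I) : aExp j₀ k a I = (((a.1 : ℤ) : ℚ) ^ 2 - 1) / 8 := by
  have key : ∀ I' ⊆ I, (Γ.attach j₀).w ((k.attachBy j₀ a).shift (E (I'.map inclAttach.toEmbedding)))
      = (Γ.incr j₀).w ((k.attachBy j₀ a).blowDown.shift (E I'))
        + (((a.1 : ℤ) : ℚ) ^ 2 - 1) / 8 := by
    intro I' hI'
    have h0 : E I' j₀ = 0 := if_neg fun hj => hI (hI' hj)
    rw [E_map, w_attachBy_shift h, h0]
    simp [oddShift]
  rw [aExp, sub_eq_iff_eq_add']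
  apply le_antisymm
  · refine Finset.sup'_le _ _ fun I' hI' => ?_
    obtain ⟨I'', hI'', rfl⟩ := Finset.subset_map_iff.mp (Finset.mem_powerset.mp hI')
    rw [key _ hI'']
    gcongr
    exact Finset.le_sup' (fun I' => (Γ.incr j₀).w ((k.attachBy j₀ a).blowDown.shift (E I')))
      (Finset.mem_powerset.mpr hI'')
  · rw [← le_sub_iff_add_le]
    refine Finset.sup'_le _ _ fun I' hI' => ?_
    rw [le_sub_iff_add_le, ← key _ (Finset.mem_powerset.mp hI')]
    exact Finset.le_sup' (fun I' => (Γ.attach j₀).w ((k.attachBy j₀ a).shift (E I')))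
      (Finset.mem_powerset.mpr (Finset.map_subset_map.mpr (Finset.mem_powerset.mp hI')))

lemma finite_aExp_lt (h : (Γ.incr j₀).Nondegenerate) (N : ℕ) :
    {a : OddInt | ∃ (k : Γ.Char) (I : Finset J), aExp j₀ k a I < N}.Finite := by
  have hfin : (Set.Icc (-(8 * N + 10) : ℤ) (8 * N + 10)).Finite := Set.finite_Icc _ _
  refine Set.Finite.of_finite_image (f := Subtype.val) (hfin.subset ?_) Subtype.val_injective.injOn
  rintro _ ⟨a, ⟨k, I, hlt⟩, rfl⟩
  obtain ⟨n, hn, hle⟩ := aExp_ge h k a I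
  have h1 : (((oddShift n a).1 : ℤ) : ℚ) ^ 2 < 8 * N + 1 := by linarith
  have h2 : (a.1 - 2 * n) ^ 2 < 8 * (N : ℤ) + 1 := by
    have : (oddShift n a).1 = a.1 - 2 * n := rfl
    rw [this] at h1
    exact_mod_cast h1
  have hN : (0 : ℤ) ≤ N := Int.natCast_nonneg N
  constructor
  · by_contra hcon
    rcases hn with rfl | rfl <;> nlinarith
  · by_contra hcon
    rcases hn with rfl | rfl <;> nlinarith

lemma exists_pow_smul_eq_zero {ι : Type*} {φ : ι → TPlus} (hφ : (Function.support φ).Finite) :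
    ∃ N : ℕ, ∀ c, (X ^ N : ℤ[X]) • φ c = 0 := by
  choose N hN using fun c => TPlus.exists_pow_smul_eq_zero (φ c)
  obtain ⟨M, hM⟩ := (hφ.image N).bddAbove
  refine ⟨M, fun c => ?_⟩
  by_cases hc : φ c = 0
  · rw [hc, smul_zero]
  · exact pow_smul_eq_zero_of_le (hN c) (hM ⟨c, hc, rfl⟩)

/-- The operator `A^q`, i.e. the composition of `φ ↦ φ ∘ π_*^h` and `φ ↦ φ ∘ B_q` through the complex of
`Γ^b`: `(A^q φ)(k, I) = ∑_{a odd} U^{w_{Γ^b}(k_a, I) - w_{Γ^+}(π_*(k_a), I)} φ(π_*(k_a), I)`, where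
`k_a = b(k) + a E_{new}^*`. The sum is finite for `φ` of finite support. -/
def aFun (φ : (Γ.incr j₀).Cube → TPlus) : Γ.Cube → TPlus :=
  fun c => ∑ᶠ a : OddInt, uPow (aExp j₀ c.1 a c.2) • φ ((c.1.attachBy j₀ a).blowDown, c.2)

lemma Char.blowDown_attachBy_injective (a : OddInt) :
    Function.Injective fun k : Γ.Char => (k.attachBy j₀ a).blowDown := by
  intro k k' h
  apply Char.ext
  ext j
  have h1 := congrFun (congrArg Subtype.val h) j
  simp only [blowDown_apply, attachBy_top, add_left_inj] at h1
  exact h1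

lemma finite_blowDown {φ : (Γ.incr j₀).Cube → TPlus} (hφ : (Function.support φ).Finite)
    (k : Γ.Char) (I : Finset J) :
    (Function.support fun a : OddInt => φ ((k.attachBy j₀ a).blowDown, I)).Finite := by
  refine hφ.preimage
    (f := fun a : OddInt => (((k.attachBy j₀ a).blowDown, I) : (Γ.incr j₀).Cube))
    fun a _ a' _ h => ?_
  have h1 : (k.attachBy j₀ a).blowDown = (k.attachBy j₀ a').blowDown := congrArg Prod.fst h
  have h2 : (k.attachBy j₀ a).blowDown.1 j₀ = (k.attachBy j₀ a').blowDown.1 j₀ := by rw [h1]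
  have h3 : ∀ a : OddInt, (k.attachBy j₀ a).blowDown.1 j₀ = k.1 j₀ + a.1 := by
    intro a
    change k.1 j₀ + (if j₀ = j₀ then a.1 else 0) = _
    rw [if_pos rfl]
  rw [h3, h3] at h2
  exact Subtype.ext (add_left_cancel h2)

lemma aFun_mem (h : (Γ.incr j₀).Nondegenerate) {q : ℕ} {φ : (Γ.incr j₀).Cube → TPlus}
    (hφ : φ ∈ (Γ.incr j₀).cochains q) : aFun φ ∈ Γ.cochains q := by
  have key : ∀ c, aFun φ c ≠ 0 → ∃ a : OddInt,
      uPow (aExp j₀ c.1 a c.2) • φ ((c.1.attachBy j₀ a).blowDown, c.2) ≠ 0 :=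
    fun c hc => exists_of_finsum_ne_zero hc
  constructor
  · obtain ⟨N, hN⟩ := exists_pow_smul_eq_zero hφ.1
    have hfin : (⋃ a ∈ {a : OddInt | ∃ (k : Γ.Char) (I : Finset J), aExp j₀ k a I < N},
        (fun c : Γ.Cube => (((c.1.attachBy j₀ a).blowDown, c.2) : (Γ.incr j₀).Cube)) ⁻¹'
          Function.support φ).Finite := by
      refine (finite_aExp_lt h N).biUnion fun a _ => hφ.1.preimage ?_
      rintro ⟨k, I⟩ - ⟨k', I'⟩ - heq
      have h1 := Char.blowDown_attachBy_injective a (congrArg Prod.fst heq)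
      have h2 : I = I' := congrArg Prod.snd heq
      exact Prod.ext h1 h2
    refine hfin.subset fun c hc => ?_
    obtain ⟨a, ha⟩ := key c hc
    simp only [Set.mem_iUnion]
    refine ⟨a, ⟨c.1, c.2, ?_⟩, fun h0 => ha ?_⟩
    · by_contra hge
      exact ha (pow_smul_eq_zero_of_le (hN _) (Nat.le_floor (not_lt.mp hge)))
    · simp only at h0
      rw [h0, smul_zero]
  · intro c hc
    obtain ⟨a, ha⟩ := key c hc
    exact hφ.2 ((c.1.attachBy j₀ a).blowDown, c.2) fun h0 => ha (by rw [h0, smul_zero])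

/-- `A^q : ℱ^q(Γ_{j₀}^+) → ℱ^q(Γ)`. -/
def aHom (h : (Γ.incr j₀).Nondegenerate) (q : ℕ) :
    (Γ.incr j₀).cochains q →ₗ[ℤ[X]] Γ.cochains q where
  toFun φ := ⟨aFun φ.1, aFun_mem h φ.2⟩
  map_add' φ ψ := by
    refine Subtype.ext (funext fun c => ?_)
    simp only [aFun, Submodule.coe_add, Pi.add_apply, smul_add]
    exact finsum_add_distrib (finite_support_smul (finite_blowDown φ.2.1 c.1 _) _)
      (finite_support_smul (finite_blowDown ψ.2.1 c.1 _) _)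
  map_smul' p φ := by
    refine Subtype.ext (funext fun c => ?_)
    simp only [aFun, Submodule.coe_smul, Pi.smul_apply, RingHom.id_apply]
    rw [smul_finsum' p (finite_support_smul (finite_blowDown φ.2.1 c.1 _) _)]
    exact finsum_congr fun a => smul_comm _ _ _

lemma deltaDir_aFun (hΓ : Γ.Nondegenerate) (h : (Γ.incr j₀).Nondegenerate)
    {φ : (Γ.incr j₀).Cube → TPlus} (hφ : (Function.support φ).Finite) (k : Γ.Char)
    {I : Finset J} {i : J} (hi : i ∈ I) :
    Γ.deltaDir i (aFun φ) (k, I) = ∑ᶠ a : OddInt, uPow (aExp j₀ k a I) •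
      (Γ.incr j₀).deltaDir i φ ((k.attachBy j₀ a).blowDown, I) := by
  have hb := Nondegenerate.attach h
  have hM : ∀ i j, Γ.mat i j = (Γ.attach j₀).mat (inclAttach i) (inclAttach j) :=
    fun i j => (Γ.attach_mat_coe j₀ i j).symm
  have hw : ∀ (a : OddInt) (l : J → ℤ) (I' : Finset J),
      (Γ.attach j₀).wCube ((k.shift l).attachBy j₀ (oddShift (l j₀) a),
        I'.map inclAttach.toEmbedding)
        = Γ.wCube (k.shift l, I') + ((Γ.attach j₀).w (k.attachBy j₀ a) - Γ.w k) := by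
    intro a l I'
    rw [← Char.attachBy_shift]
    exact wCube_extend hb hΓ hM (k.attachBy j₀ a) k (k.attachBy_coe a) l I'
  have hw0 : ∀ (a : OddInt) (I' : Finset J),
      (Γ.attach j₀).wCube (k.attachBy j₀ a, I'.map inclAttach.toEmbedding)
        = Γ.wCube (k, I') + ((Γ.attach j₀).w (k.attachBy j₀ a) - Γ.w k) := by
    intro a I'
    have := wCube_extend hb hΓ hM (k.attachBy j₀ a) k (k.attachBy_coe a) 0 I'
    rwa [Function.extend_zero, Char.shift_zero, Char.shift_zero] at this
  set σ : OddInt ≃ OddInt := oddShift (E {i} j₀) with hσ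
  have hbs : ∀ a, ((k.shift (E {i})).attachBy j₀ (σ a)).blowDown
      = (k.attachBy j₀ a).blowDown.shift (E {i}) := by
    intro a
    rw [← Char.blowDown_shift, Char.attachBy_shift]
  have hf0 := finite_support_smul (finite_blowDown hφ k (I.erase i))
    fun a => uPow (aExp j₀ k a (I.erase i))
  have hf1 : (Function.support fun a : OddInt =>
      uPow (aExp j₀ (k.shift (E {i})) (σ a) (I.erase i)) •
        φ ((k.attachBy j₀ a).blowDown.shift (E {i}), I.erase i)).Finite := by
    refine finite_support_smul ?_ _
    have := (finite_blowDown hφ (k.shift (E {i})) (I.erase i)).preimage (f := σ)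
      σ.injective.injOn
    refine this.subset fun a ha h0 => ha ?_
    simp only [hbs] at h0
    exact h0
  have e1 : aFun φ (k.shift (E {i}), I.erase i) = ∑ᶠ a : OddInt,
      uPow (aExp j₀ (k.shift (E {i})) (σ a) (I.erase i)) •
        φ ((k.attachBy j₀ a).blowDown.shift (E {i}), I.erase i) := by
    rw [aFun, ← finsum_comp_equiv σ]
    refine finsum_congr fun a => ?_
    rw [hbs]
  have a0 : ∀ {Δ : PlumbingGraph J} (k : Δ.Char), 0 ≤ Δ.wCube (k, I) - Δ.wCube (k, I.erase i) :=
    fun k => sub_nonneg.mpr (wCube_mono _ k (Finset.erase_subset _ _))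
  have a1 : ∀ {Δ : PlumbingGraph J} (k : Δ.Char),
      0 ≤ Δ.wCube (k, I) - Δ.wCube (k.shift (E {i}), I.erase i) :=
    fun k => sub_nonneg.mpr (wCube_shift_le _ k hi)
  have b0 : ∀ {Δ : PlumbingGraph J} (k : Δ.Char),
      ∃ n : ℤ, Δ.wCube (k, I) - Δ.wCube (k, I.erase i) = n := by
    intro Δ k
    simpa [Char.shift_zero] using Δ.wCube_sub_int k 0 I (I.erase i)
  have b1 : ∀ {Δ : PlumbingGraph J} (k : Δ.Char),
      ∃ n : ℤ, Δ.wCube (k, I) - Δ.wCube (k.shift (E {i}), I.erase i) = n :=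
    fun {Δ} k => Δ.wCube_sub_int k (E {i}) I (I.erase i)
  rw [deltaDir_apply, e1, aFun, smul_finsum' _ hf0, smul_finsum' _ hf1, ← finsum_sub_distrib]
  · refine finsum_congr fun a => ?_
    rw [deltaDir_apply, smul_sub]
    simp only [smul_smul]
    rw [uPow_mul (a0 _) (aExp_nonneg h _ _ _) (b0 _) (aExp_int h _ _ _),
      uPow_mul (a1 _) (aExp_nonneg h _ _ _) (b1 _) (aExp_int h _ _ _),
      uPow_mul (aExp_nonneg h _ _ _) (a0 _) (aExp_int h _ _ _) (b0 _),
      uPow_mul (aExp_nonneg h _ _ _) (a1 _) (aExp_int h _ _ _) (b1 _)]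
    congr 3
    · rw [aExp, aExp, hw0, hw0]
      ring
    · rw [aExp, aExp, hbs, hσ, hw, hw0]
      ring
  · exact finite_support_smul hf0 _
  · exact finite_support_smul hf1 _

lemma delta_aFun (hΓ : Γ.Nondegenerate) (h : (Γ.incr j₀).Nondegenerate) {q : ℕ}
    {φ : (Γ.incr j₀).Cube → TPlus} (hφ : φ ∈ (Γ.incr j₀).cochains q) :
    Γ.delta (aFun φ) = aFun ((Γ.incr j₀).delta φ) := by
  ext ⟨k, I⟩
  rw [delta_apply, aFun]
  simp only [delta_apply, Finset.smul_sum]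
  have hdir : ∀ i : J, (Function.support fun a : OddInt => uPow (aExp j₀ k a I) •
      (Γ.incr j₀).deltaDir i φ ((k.attachBy j₀ a).blowDown, I)).Finite := by
    intro i
    refine finite_support_smul ?_ _
    have h1 := finite_blowDown hφ.1 k (I.erase i)
    have h2 := (finite_blowDown hφ.1 (k.shift (E {i})) (I.erase i)).preimage
      (f := oddShift (E {i} j₀)) (Equiv.injective _).injOn
    refine (h1.union h2).subset fun a ha => ?_
    by_contra hcon
    simp only [Set.mem_union, Function.mem_support, Set.mem_preimage, not_or, not_not,
      ← Char.attachBy_shift, Char.blowDown_shift] at hcon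
    refine ha ?_
    simp only [deltaDir_apply, hcon.1, hcon.2, smul_zero, sub_zero]
  rw [finsum_sum_comm]
  · refine Finset.sum_congr rfl fun i hi => ?_
    rw [deltaDir_aFun hΓ h hφ.1 k hi, smul_finsum' _ (hdir i)]
    exact finsum_congr fun a => smul_comm _ _ _
  · intro i _
    have := finite_support_smul (hdir i) fun _ => sgn I i
    refine this.subset fun a ha h0 => ha ?_
    simp only at h0 ⊢
    rw [smul_comm]
    exact h0

/-- The morphism of complexes `A^* : ℱ^*(Γ_{j₀}^+) → ℱ^*(Γ)`. -/
def aMap (hΓ : Γ.Nondegenerate) (h : (Γ.incr j₀).Nondegenerate) :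
    (Γ.incr j₀).cochainComplex ⟶ Γ.cochainComplex :=
  CochainComplex.ofHom (fun q => ModuleCat.ofHom (aHom h q)) fun q => by
    rw [cochainComplex_d, cochainComplex_d]
    exact ModuleCat.hom_ext (LinearMap.ext fun φ => Subtype.ext (delta_aFun hΓ h φ.2))

/-! ### The surgery sequence -/

lemma bFun_aFun (h : (Γ.incr j₀).Nondegenerate)
    (r : (Γ.delete j₀).CharClass → (Γ.delete j₀).Char) {q : ℕ} {φ : (Γ.incr j₀).Cube → TPlus}
    (hφ : φ ∈ (Γ.incr j₀).cochains q) : bFun r (aFun φ) = 0 := by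
  ext ⟨k, I⟩
  set I' : Finset J := I.map (inclDelete j₀).toEmbedding with hI'
  have hj₀ : j₀ ∉ I' := by
    intro hj
    obtain ⟨i, -, hi⟩ := Finset.mem_map.mp hj
    exact i.2 hi
  set F : Γ.Parity j₀ × OddInt → TPlus := fun p => bSign r k p.1 •
    uPow (aExp j₀ (k.extendBy p.1) p.2 I') • φ (((k.extendBy p.1).attachBy j₀ p.2).blowDown, I')
    with hF
  have hbd : ∀ (c : Γ.Parity j₀) (a : OddInt) (j : J),
      ((k.extendBy c).attachBy j₀ a).blowDown.1 j
        = if j = j₀ then c.1 + a.1 else (k.extendBy c).1 j := by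
    intro c a j
    rw [Char.blowDown_apply, Char.attachBy_top]
    change (k.extendBy c).1 j + _ = _
    by_cases hj : j = j₀
    · subst hj
      simp only [if_true, Char.extendBy_self]
    · simp only [hj, if_false, add_zero]
  obtain ⟨N, hN⟩ := exists_pow_smul_eq_zero hφ.1
  have hfin : (Function.support F).Finite := by
    have h1 : (⋃ a ∈ {a : OddInt | ∃ (k : Γ.Char) (I : Finset J), aExp j₀ k a I < N},
        (fun c : Γ.Parity j₀ => (c, a)) '' ((fun c : Γ.Parity j₀ =>
          ((((k.extendBy c).attachBy j₀ a).blowDown, I') : (Γ.incr j₀).Cube)) ⁻¹'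
            Function.support φ)).Finite := by
      refine (finite_aExp_lt h N).biUnion fun a _ => (hφ.1.preimage ?_).image _
      intro c _ c' _ heq
      have h1 : ((k.extendBy c).attachBy j₀ a).blowDown.1 j₀
          = ((k.extendBy c').attachBy j₀ a).blowDown.1 j₀ := by
        exact congrFun (congrArg Subtype.val (congrArg Prod.fst heq)) j₀
      rw [hbd, hbd, if_pos rfl, if_pos rfl] at h1
      exact Subtype.ext (add_right_cancel h1)
    refine h1.subset ?_
    rintro ⟨c, a⟩ hc
    simp only [Set.mem_iUnion]
    refine ⟨a, ⟨k.extendBy c, I', ?_⟩, c, fun h0 => hc ?_, rfl⟩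
    · by_contra hge
      refine hc ?_
      have : uPow (aExp j₀ (k.extendBy c) a I') •
          φ (((k.extendBy c).attachBy j₀ a).blowDown, I') = 0 :=
        pow_smul_eq_zero_of_le (hN _) (Nat.le_floor (not_lt.mp hge))
      simp only [hF, this, smul_zero]
    · simp only at h0
      simp only [hF, h0, smul_zero]
  have e1 : bFun r (aFun φ) (k, I) = ∑ᶠ p, F p := by
    rw [finsum_curry F hfin, bFun]
    refine finsum_congr fun c => ?_
    rw [aFun, smul_finsum' _ (finite_support_smul (finite_blowDown hφ.1 _ _) _)]
  rw [e1, Pi.zero_apply, finsum_eq_sum F hfin]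
  set σ : Γ.Parity j₀ × OddInt → Γ.Parity j₀ × OddInt := fun p =>
    (⟨p.1.1 + 2 * p.2.1, by
      have h := p.1.2
      rw [Int.ModEq] at h ⊢
      omega⟩, ⟨-p.2.1, p.2.2.neg⟩) with hσ
  have hFσ : ∀ p, F (σ p) = -F p := by
    rintro ⟨c, a⟩
    have hs : bSign r k (σ (c, a)).1 = -bSign r k c := by
      have : signExponent r k (σ (c, a)).1 / 2 = signExponent r k c / 2 + ((a.1 : ℤ) : ℚ) := by
        simp only [signExponent, hσ]
        push_cast
        ring
      rw [bSign, bSign, this, Int.floor_add_intCast, Int.negOnePow_add, Int.negOnePow_odd _ a.2]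
      simp
    have hk : ((k.extendBy (σ (c, a)).1).attachBy j₀ (σ (c, a)).2).blowDown
        = ((k.extendBy c).attachBy j₀ a).blowDown := by
      apply Char.ext
      ext j
      rw [hbd, hbd]
      by_cases hj : j = j₀
      · simp only [hj, if_true, hσ]; ring
      · simp only [hj, if_false]
        exact (k.extendBy_coe _ ⟨j, hj⟩).trans (k.extendBy_coe c ⟨j, hj⟩).symm
    have he : aExp j₀ (k.extendBy (σ (c, a)).1) (σ (c, a)).2 I' = aExp j₀ (k.extendBy c) a I' := by
      rw [aExp_eq h _ _ hj₀, aExp_eq h _ _ hj₀]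
      simp [hσ]
    simp only [hF]
    rw [hs, hk, he, neg_smul]
  refine Finset.sum_involution (fun p _ => σ p) ?_ ?_ ?_ ?_
  · intro p _
    rw [hFσ, add_neg_cancel]
  · rintro ⟨c, a⟩ _ _ heq
    have h1 : -a.1 = a.1 := congrArg (fun p : Γ.Parity j₀ × OddInt => p.2.1) heq
    obtain ⟨m, hm⟩ := a.2
    omega
  · intro p hp
    simp only [Set.Finite.mem_toFinset, Function.mem_support] at hp ⊢
    rw [hFσ]
    exact neg_ne_zero.mpr hp
  · rintro ⟨c, a⟩ _
    refine Prod.ext (Subtype.ext ?_) (Subtype.ext ?_)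
    · simp [hσ]
    · simp [hσ]

/-- The short sequence of complexes
`0 → ℱ^*(Γ_{j₀}^+) → ℱ^*(Γ) → ℱ^*(Γ∖j₀) → 0` with the maps `A^*` and `B̄^*`. -/
def surgerySequence (hΓ : Γ.Nondegenerate) (hdel : (Γ.delete j₀).Nondegenerate)
    (h : (Γ.incr j₀).Nondegenerate) (r : (Γ.delete j₀).CharClass → (Γ.delete j₀).Char) :
    ShortComplex (CochainComplex (ModuleCat ℤ[X]) ℕ) :=
  ShortComplex.mk (aMap hΓ h) (bMap hΓ hdel r) <| HomologicalComplex.hom_ext _ _ fun _ =>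
    ModuleCat.hom_ext (LinearMap.ext fun φ => Subtype.ext (bFun_aFun h r φ.2))

/-- The map `B̄^q : ℍ^q(Γ) → ℍ^q(Γ∖j₀)` in lattice cohomology. -/
def bCohomology (hΓ : Γ.Nondegenerate) (hdel : (Γ.delete j₀).Nondegenerate)
    (r : (Γ.delete j₀).CharClass → (Γ.delete j₀).Char) (q : ℕ) :
    Γ.latticeCohomology q ⟶ (Γ.delete j₀).latticeCohomology q :=
  HomologicalComplex.homologyMap (bMap hΓ hdel r) q

/-- The connecting map `C^q : ℍ^q(Γ∖j₀) → ℍ^{q+1}(Γ_{j₀}^+)` of the long exact cohomology sequence of the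
short exact sequence of complexes `0 → ℱ^*(Γ_{j₀}^+) → ℱ^*(Γ) → ℱ^*(Γ∖j₀) → 0`. -/
def cCohomology {hΓ : Γ.Nondegenerate} {hdel : (Γ.delete j₀).Nondegenerate}
    {h : (Γ.incr j₀).Nondegenerate} {r : (Γ.delete j₀).CharClass → (Γ.delete j₀).Char}
    (hS : (surgerySequence hΓ hdel h r).ShortExact) (q : ℕ) :
    (Γ.delete j₀).latticeCohomology q ⟶ (Γ.incr j₀).latticeCohomology (q + 1) :=
  hS.δ q (q + 1) rfl

end PlumbingGraph

end

set_option linter.unusedSectionVars false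

/-! Fix $I$. Both operators act along the lines $k+2\mathbb Z E_{j_0}^*$. Writing $a=2n+1$, the
operator $A$ becomes on each line a matrix of powers of $U$ indexed by integers. Its exponent is
$n(n+1)/2$ if $j_0\notin I$. If $j_0\in I$ it is corrected to $n(n+1)/2+\max(0,h)-\max(0,h+n)$,
where the height $h$ of $(k,I)$ is the weight difference of its two faces in direction $j_0$
(`aExp_of_mem`). Moving by $n$ along the line changes $h$ by exactly $n$, so one point of each line
has height $0$.

Every element of $\mathcal T_0^+$ is killed by a power of $U$, so exactness can be checked to
leading order, by induction on that power. To leading order only exponents $0$ survive, and they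
occur for few $n\in\{-1,0,1\}$ (`activeSet`). A row of $A$ then couples a point with its neighbour
further from height $0$, and with both neighbours at height $0$; if $j_0\notin I$ it always couples
it with the same side. Finite support makes such a system injective (`eq_zero_of_aFun_eq_zero`,
`aHom_injective`). Read by columns, the same pattern shows that, modulo $\operatorname{im}A$ and
lower order, a cochain at one cube slides along its line: to height $0$, where it is absorbed, if
$j_0\in I$, or to $k_{j_0}=e_{j_0}$ if $j_0\notin I$ (`cochains_le_imageSupBase`). On cochains
supported at $j_0\notin I$, $k_{j_0}=e_{j_0}$, the map $\overline B$ is injective, and $\overline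
BA=0$, so $\ker\overline B=\operatorname{im}A$.

For the canonical submodule let $p=(E_{j_0}^*)^2$. Negative definiteness of $\Gamma_{j_0}^+$ gives
$-1<p<0$. Orthogonal projection along $E_{j_0}^*$ gives $w_\Gamma(K)=w_{\Gamma\setminus
j_0}(k)-(ps^2+1)/8$ for an extension $K$ of $k$ with slope $s=(K,E_{j_0}^*)/p$ (`w_extendBy`). Given
$x$ at a class $c$, extend a minimal representative to $K$ with $|s|\le1$, and divide $\pm x$ by the
power of $U$ found at $K$ to get $y$ at $[K]$. Then $\overline B^0\varepsilon(y)$ contains $x$ at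
$c$. Every other contribution comes from $K+2l$ with $l_{j_0}\ne0$ and has gained at least
$\epsilon=(-1/p-1)/2>0$ in weight (`w_extendBy_shift_ge`). Subtracting and iterating lowers the
order by a fixed amount each time, and the weights are bounded below, so the process stops
(`single_mem_liftable_step`). -/

noncomputable section

/-! ### Divisibility of $\mathcal T_0^+$ by $U$. -/

namespace LatticeCohomology

/-- Multiplication by a power of `U` is surjective on `𝒯₀⁺`. -/
lemma TPlus.exists_pow_smul_eq (n : ℕ) (x : TPlus) : ∃ y : TPlus, (X ^ n : ℤ[X]) • y = x := by
  obtain ⟨f, rfl⟩ := Submodule.Quotient.mk_surjective _ x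
  refine ⟨Submodule.Quotient.mk (LaurentPolynomial.T (-n) * f), ?_⟩
  rw [← Submodule.Quotient.mk_smul, Algebra.smul_def, LaurentPolynomial.algebraMap_eq_toLaurent,
    Polynomial.toLaurent_X_pow, ← mul_assoc, ← LaurentPolynomial.T_add]
  simp

lemma uPow_natCast (n : ℕ) : uPow n = X ^ n := by
  rw [uPow, Nat.floor_natCast]

end LatticeCohomology

namespace PlumbingGraph

open LatticeCohomology

variable {J : Type*} [Fintype J] [LinearOrder J] {Γ : PlumbingGraph J} {j₀ : J}

/-! ### Cochains supported at one cube -/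

open Classical in
/-- The cochain with value `x` at the cube `c` and zero elsewhere. -/
def single (c : Γ.Cube) (x : TPlus) : Γ.Cube → TPlus := Pi.single c x

lemma single_self (c : Γ.Cube) (x : TPlus) : single c x c = x := by
  classical
  simp [single]

lemma single_of_ne {c c' : Γ.Cube} (hc : c' ≠ c) (x : TPlus) : single c x c' = 0 := by
  classical
  simp [single, hc]

lemma single_mem (c : Γ.Cube) (x : TPlus) : single c x ∈ Γ.cochains c.2.card := by
  have key : ∀ c', single c x c' ≠ 0 → c' = c := by
    intro c' h
    by_contra hne
    exact h (single_of_ne hne x)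
  refine ⟨(Set.finite_singleton c).subset fun c' hc' => key c' hc', fun c' hc' => ?_⟩
  rw [key c' hc']

lemma single_mem_of_card {c : Γ.Cube} {q : ℕ} (hc : c.2.card = q) (x : TPlus) :
    single c x ∈ Γ.cochains q :=
  hc ▸ single_mem c x

/-- A submodule containing all restrictions of a finitely supported function to a single cube
contains the function. -/
lemma mem_of_single_mem {P : Submodule ℤ[X] (Γ.Cube → TPlus)} {φ : Γ.Cube → TPlus}
    (hφ : (Function.support φ).Finite) (h : ∀ c, φ c ≠ 0 → single c (φ c) ∈ P) : φ ∈ P := by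
  classical
  have : φ = ∑ c ∈ hφ.toFinset, single c (φ c) := by
    ext c
    rw [Finset.sum_apply]
    by_cases hc : φ c = 0
    · rw [hc]
      refine (Finset.sum_eq_zero fun c' hc' => ?_).symm
      refine single_of_ne ?_ _
      rintro rfl
      simp [hc] at hc'
    · rw [Finset.sum_eq_single c]
      · rw [single_self]
      · intro c' _ hne
        exact single_of_ne hne.symm _
      · intro h0
        simp [hc] at h0
  rw [this]
  exact Submodule.sum_mem _ fun c hc => h c (by simpa using hc)

/-! ### Translation along the dual vector of `j₀` -/

variable (j₀) in
/-- The characteristic element `k + 2n E_{j₀}^*`. -/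
def Char.bump (k : Γ.Char) (n : ℤ) : Γ.Char :=
  ⟨fun j => k.1 j + if j = j₀ then 2 * n else 0, by
    rw [isChar_iff]
    intro j
    have h := (Γ.isChar_iff _).1 k.2 j
    by_cases hj : j = j₀
    · simp only [hj, if_true] at h ⊢
      rw [Int.ModEq] at h ⊢
      omega
    · simpa [hj] using h⟩

lemma Char.bump_self (k : Γ.Char) (n : ℤ) : (k.bump j₀ n).1 j₀ = k.1 j₀ + 2 * n := by
  simp [bump]

lemma Char.bump_of_ne (k : Γ.Char) (n : ℤ) {j : J} (hj : j ≠ j₀) : (k.bump j₀ n).1 j = k.1 j := by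
  simp [bump, hj]

lemma Char.bump_zero (k : Γ.Char) : k.bump j₀ 0 = k := by
  apply Char.ext
  ext j
  simp [bump]

lemma Char.bump_bump (k : Γ.Char) (m n : ℤ) : (k.bump j₀ m).bump j₀ n = k.bump j₀ (m + n) := by
  apply Char.ext
  ext j
  by_cases hj : j = j₀
  · subst hj
    simp only [bump_self]
    ring
  · simp only [bump_of_ne _ _ hj]

lemma Char.bump_injective (k : Γ.Char) : Function.Injective fun n => k.bump j₀ n := by
  intro m n h
  have h1 := congrFun (congrArg Subtype.val h) j₀
  simp only [bump_self] at h1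
  omega

/-- The odd number `2n + 1`. -/
def oddOf : ℤ ≃ OddInt where
  toFun n := ⟨2 * n + 1, n, rfl⟩
  invFun a := (a.1 - 1) / 2
  left_inv n := by simp
  right_inv a := by
    obtain ⟨a, m, rfl⟩ := a
    simp

lemma oddOf_val (n : ℤ) : (oddOf n).1 = 2 * n + 1 := rfl

variable (j₀) in
/-- The characteristic element of `Γ_{j₀}^+` with the coordinates of `k + E_{j₀}^*`. -/
def Char.up (k : Γ.Char) : (Γ.incr j₀).Char := (k.attachBy j₀ (oddOf 0)).blowDown

lemma Char.up_apply (k : Γ.Char) (j : J) :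
    (k.up j₀).1 j = k.1 j + if j = j₀ then 1 else 0 := rfl

lemma Char.up_injective : Function.Injective fun k : Γ.Char => k.up j₀ :=
  Char.blowDown_attachBy_injective _

lemma Char.up_surjective : Function.Surjective fun k : Γ.Char => k.up j₀ := by
  intro k
  refine ⟨⟨fun j => k.1 j - if j = j₀ then 1 else 0, ?_⟩, ?_⟩
  · rw [isChar_iff]
    intro j
    have h := ((Γ.incr j₀).isChar_iff _).1 k.2 j
    by_cases hj : j = j₀
    · subst hj
      simp only [incr, Function.update_self, if_true] at h ⊢
      rw [Int.ModEq] at h ⊢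
      omega
    · simpa [hj, incr] using h
  · apply Char.ext
    ext j
    exact sub_add_cancel _ _

/-- Adding $(2n+1)E_{j_0}^*$ is moving $n$ steps along the line and then passing to $\Gamma_{j_0}^+$
by $E_{j_0}^*$. This identifies the cubes of $\Gamma_{j_0}^+$ with those of $\Gamma$, so that $A$
can be read as a square matrix on each line. -/
lemma Char.blowDown_attachBy (k : Γ.Char) (n : ℤ) :
    (k.attachBy j₀ (oddOf n)).blowDown = (k.bump j₀ n).up j₀ := by
  apply Char.ext
  ext j
  rw [up_apply, blowDown_apply, attachBy_top, oddOf_val]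
  change k.1 j + _ = _
  by_cases hj : j = j₀
  · subst hj
    simp only [if_true, bump_self]
    ring
  · simp only [hj, if_false, bump_of_ne _ _ hj]

lemma aFun_eq (φ : (Γ.incr j₀).Cube → TPlus) (k : Γ.Char) (I : Finset J) :
    aFun φ (k, I) = ∑ᶠ n : ℤ, uPow (aExp j₀ k (oddOf n) I) • φ ((k.bump j₀ n).up j₀, I) := by
  rw [aFun, ← finsum_comp_equiv oddOf]
  simp only [Char.blowDown_attachBy]

/-! ### The exponents of `A` -/

variable (Γ) in
/-- The number `-((k + E_I, E_I))`, i.e. twice the difference `w(k + 2E_I) - w(k)`. -/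
def quad (k : J → ℤ) (I : Finset J) : ℤ := ∑ i ∈ I, k i - ∑ i ∈ I, ∑ j ∈ I, Γ.mat i j

lemma quad_eq (k : J → ℤ) (I : Finset J) :
    Γ.quad k I = k ⬝ᵥ E I - E I ⬝ᵥ (Γ.mat.mulVec (E I)) := by
  simp [quad, dotProduct, Matrix.mulVec, E]

lemma even_quad (k : Γ.Char) (I : Finset J) : Even (Γ.quad k.1 I) := by
  obtain ⟨c, hc⟩ := k.2 (E I)
  rw [quad_eq]
  exact ⟨-c, by linarith⟩

lemma quad_insert (k : J → ℤ) {I : Finset J} (hI : j₀ ∉ I) :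
    Γ.quad k (insert j₀ I) = Γ.quad k I + (k j₀ - Γ.e j₀) - 2 * ∑ i ∈ I, Γ.mat i j₀ := by
  simp only [quad, Finset.sum_insert hI, Finset.sum_add_distrib, mat_self, Γ.mat_symm j₀]
  ring

variable (Γ) in
/-- The difference `w(k, I) - w(k)`. -/
def relWeight (k : J → ℤ) (I : Finset J) : ℤ :=
  I.powerset.sup' ⟨∅, Finset.empty_mem_powerset _⟩ fun I' => Γ.quad k I' / 2

lemma relWeight_le_iff {k : J → ℤ} {I : Finset J} {c : ℤ} :
    Γ.relWeight k I ≤ c ↔ ∀ I' ⊆ I, Γ.quad k I' / 2 ≤ c :=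
  (Finset.sup'_le_iff _ _).trans (by simp only [Finset.mem_powerset])

/-- Only coordinates and matrix entries inside $I$ enter the difference. This makes weights of cubes
comparable between $\Gamma$ and $\Gamma_{j_0}^+$ without inverting either matrix. -/
lemma wCube_sub_w (hΓ : Γ.Nondegenerate) (k : Γ.Char) (I : Finset J) :
    Γ.wCube (k, I) - Γ.w k = Γ.relWeight k.1 I := by
  have key : ∀ I', Γ.w (k.shift (E I')) = Γ.w k + ((Γ.quad k.1 I' / 2 : ℤ) : ℚ) := by
    intro I'
    rw [w_shift _ hΓ, Int.cast_div (even_quad k I').two_dvd (by norm_num), quad_eq]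
    push_cast
    rfl
  rw [sub_eq_iff_eq_add']
  apply le_antisymm
  · refine Finset.sup'_le _ _ fun I' hI' => ?_
    rw [key]
    gcongr
    exact Finset.le_sup' (fun I' => Γ.quad k.1 I' / 2) hI'
  · obtain ⟨I', hI', he⟩ := Finset.exists_mem_eq_sup' (s := I.powerset)
      ⟨∅, Finset.empty_mem_powerset _⟩ fun I' => Γ.quad k.1 I' / 2
    rw [relWeight, he, ← key]
    exact Finset.le_sup' (fun I' => Γ.w (k.shift (E I'))) hI'

variable (Γ j₀) in
/-- The number `w(k + 2E_{j₀}, I) - w(k)` for `j₀ ∉ I` is the sum of this number, which does not depend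
on the coordinate of `k` at `j₀`, and `(k_{j₀} - e_{j₀}) / 2`. -/
def relWeightShift (k : J → ℤ) (I : Finset J) : ℤ :=
  I.powerset.sup' ⟨∅, Finset.empty_mem_powerset _⟩ fun I' =>
    Γ.quad k I' / 2 - ∑ i ∈ I', Γ.mat i j₀

lemma relWeightShift_le_iff {k : J → ℤ} {I : Finset J} {c : ℤ} :
    Γ.relWeightShift j₀ k I ≤ c ↔ ∀ I' ⊆ I, Γ.quad k I' / 2 - ∑ i ∈ I', Γ.mat i j₀ ≤ c :=
  (Finset.sup'_le_iff _ _).trans (by simp only [Finset.mem_powerset])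

/-- The vertices of the cube are split into the two faces in direction $j_0$. The coordinate
$k_{j_0}$ contributes only a constant on the far face. -/
lemma relWeight_eq_max (k : Γ.Char) {I : Finset J} (hI : j₀ ∈ I) :
    Γ.relWeight k.1 I = max (Γ.relWeight k.1 (I.erase j₀))
      (Γ.relWeightShift j₀ k.1 (I.erase j₀) + (k.1 j₀ - Γ.e j₀) / 2) := by
  -- The integer divisions are exact: `quad` is even and $k_{j_0}\equiv e_{j_0}$ modulo $2$.
  have hins : ∀ I' ⊆ I.erase j₀, Γ.quad k.1 (insert j₀ I') / 2
      = Γ.quad k.1 I' / 2 - ∑ i ∈ I', Γ.mat i j₀ + (k.1 j₀ - Γ.e j₀) / 2 := by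
    intro I' hI'
    have h1 : j₀ ∉ I' := fun hj => Finset.notMem_erase _ _ (hI' hj)
    obtain ⟨c, hc⟩ := even_quad k I'
    rw [quad_insert _ h1, hc]
    have h2 := (Γ.isChar_iff _).1 k.2 j₀
    rw [Int.ModEq] at h2
    omega
  refine eq_of_forall_ge_iff fun c => ?_
  rw [max_le_iff, ← le_sub_iff_add_le, relWeight_le_iff, relWeight_le_iff, relWeightShift_le_iff]
  constructor
  · intro h
    refine ⟨fun I' hI' => h I' (hI'.trans (Finset.erase_subset _ _)), fun I' hI' => ?_⟩
    have := h (insert j₀ I') (Finset.insert_subset hI (hI'.trans (Finset.erase_subset _ _)))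
    rw [hins I' hI'] at this
    linarith
  · rintro ⟨h1, h2⟩ I' hI'
    by_cases hj : j₀ ∈ I'
    · have h3 : I'.erase j₀ ⊆ I.erase j₀ := Finset.erase_subset_erase _ hI'
      have h4 := hins _ h3
      have h5 := h2 _ h3
      rw [Finset.insert_erase hj] at h4
      rw [h4]
      linarith
    · exact h1 I' (Finset.subset_erase.mpr ⟨hI', hj⟩)

lemma quad_congr {Γ' : PlumbingGraph J} {k k' : J → ℤ} {I : Finset J} (hk : ∀ j ∈ I, k j = k' j)
    (hM : ∀ i ∈ I, ∀ j ∈ I, Γ.mat i j = Γ'.mat i j) : Γ.quad k I = Γ'.quad k' I := by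
  rw [quad, quad, Finset.sum_congr rfl hk]
  congr 1
  exact Finset.sum_congr rfl fun i hi => Finset.sum_congr rfl fun j hj => hM i hi j hj

lemma relWeight_congr {Γ' : PlumbingGraph J} {k k' : J → ℤ} {I : Finset J}
    (hk : ∀ j ∈ I, k j = k' j) (hM : ∀ i ∈ I, ∀ j ∈ I, Γ.mat i j = Γ'.mat i j) :
    Γ.relWeight k I = Γ'.relWeight k' I := by
  refine Finset.sup'_congr _ rfl fun I' hI' => ?_
  rw [Finset.mem_powerset] at hI'
  rw [quad_congr (fun j hj => hk j (hI' hj)) fun i hi j hj => hM i (hI' hi) j (hI' hj)]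

/-- Compared with `relWeight_congr`, the rows in $I$ must agree in all columns, because the column
of $j_0\notin I$ enters as well. -/
lemma relWeightShift_congr {Γ' : PlumbingGraph J} {k k' : J → ℤ} {I : Finset J}
    (hk : ∀ j ∈ I, k j = k' j) (hM : ∀ i ∈ I, ∀ j, Γ.mat i j = Γ'.mat i j) :
    Γ.relWeightShift j₀ k I = Γ'.relWeightShift j₀ k' I := by
  refine Finset.sup'_congr _ rfl fun I' hI' => ?_
  rw [Finset.mem_powerset] at hI'
  rw [quad_congr (fun j hj => hk j (hI' hj)) fun i hi j hj => hM i (hI' hi) j,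
    Finset.sum_congr rfl fun i hi => hM i (hI' hi) j₀]

variable (j₀) in
/-- The difference of the weights of the two faces of the cube `(k, I)` in the direction `j₀`. -/
def Char.height (k : Γ.Char) (I : Finset J) : ℤ :=
  Γ.relWeightShift j₀ k.1 (I.erase j₀) + (k.1 j₀ - Γ.e j₀) / 2 - Γ.relWeight k.1 (I.erase j₀)

/-- Neither face maximum sees the coordinate at $j_0$. Hence height is a coordinate on each line,
with exactly one point of height $0$. -/
lemma Char.height_bump (k : Γ.Char) (n : ℤ) (I : Finset J) :
    (k.bump j₀ n).height j₀ I = k.height j₀ I + n := by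
  have hk : ∀ j ∈ I.erase j₀, (k.bump j₀ n).1 j = k.1 j :=
    fun j hj => bump_of_ne _ _ (Finset.ne_of_mem_erase hj)
  rw [height, height, relWeight_congr hk fun _ _ _ _ => rfl,
    relWeightShift_congr hk fun _ _ _ => rfl, bump_self]
  omega

/-- Relative weights in $\Gamma^b$ of a cube with directions in $\Gamma$ are those of $\Gamma$. The
base points differ by the blow-up term $((2n+1)^2-1)/8=n(n+1)/2$. -/
lemma aExp_eq_sub (hΓ : Γ.Nondegenerate) (h : (Γ.incr j₀).Nondegenerate) (k : Γ.Char) (n : ℤ)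
    (I : Finset J) :
    aExp j₀ k (oddOf n) I = ((n * (n + 1) / 2 : ℤ) : ℚ) + (Γ.wCube (k, I) - Γ.w k)
      - ((Γ.incr j₀).wCube ((k.bump j₀ n).up j₀, I) - (Γ.incr j₀).w ((k.bump j₀ n).up j₀)) := by
  have h1 := wCube_extend (Nondegenerate.attach h) hΓ (f := inclAttach)
    (fun i j => (Γ.attach_mat_coe j₀ i j).symm) (k.attachBy j₀ (oddOf n)) k
    (k.attachBy_coe _) 0 I
  rw [Function.extend_zero, Char.shift_zero, Char.shift_zero] at h1
  have h2 := w_attach h (k.attachBy j₀ (oddOf n))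
  rw [aExp, h1, h2, Char.blowDown_attachBy, Char.attachBy_top, oddOf_val]
  have h3 : ((n * (n + 1) / 2 : ℤ) : ℚ) = n * (n + 1) / 2 := by
    rw [Int.cast_div (Int.even_mul_succ_self n).two_dvd (by norm_num)]
    push_cast
    ring
  rw [h3]
  push_cast
  ring

lemma aExp_of_notMem (h : (Γ.incr j₀).Nondegenerate) (k : Γ.Char) (n : ℤ) {I : Finset J}
    (hI : j₀ ∉ I) : aExp j₀ k (oddOf n) I = ((n * (n + 1) / 2 : ℤ) : ℚ) := by
  rw [aExp_eq h _ _ hI, Int.cast_div (Int.even_mul_succ_self n).two_dvd (by norm_num), oddOf_val]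
  push_cast
  ring

/-- Each relative weight is that of the near face plus $\max(0,\text{height})$. In $\Gamma_{j_0}^+$
the coordinate at $j_0$ grows by $2n+1$ and the decoration by $1$, so the near face is unchanged and
the height becomes $h+n$. -/
lemma aExp_of_mem (hΓ : Γ.Nondegenerate) (h : (Γ.incr j₀).Nondegenerate) (k : Γ.Char) (n : ℤ)
    {I : Finset J} (hI : j₀ ∈ I) : aExp j₀ k (oddOf n) I
      = ((n * (n + 1) / 2 + max 0 (k.height j₀ I) - max 0 (k.height j₀ I + n) : ℤ) : ℚ) := by
  have hk : ∀ j ∈ I.erase j₀, ((k.bump j₀ n).up j₀).1 j = k.1 j := by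
    intro j hj
    have hj' := Finset.ne_of_mem_erase hj
    rw [Char.up_apply, if_neg hj', add_zero, Char.bump_of_ne _ _ hj']
  have hM : ∀ i ∈ I.erase j₀, ∀ j, (Γ.incr j₀).mat i j = Γ.mat i j := by
    intro i hi j
    rw [incr_mat, if_neg fun h => Finset.ne_of_mem_erase hi h.1, add_zero]
  rw [aExp_eq_sub hΓ h, wCube_sub_w hΓ, wCube_sub_w h, ← Int.cast_add, ← Int.cast_sub, Int.cast_inj,
    relWeight_eq_max k hI, relWeight_eq_max _ hI, relWeight_congr hk fun i hi j _ => hM i hi j,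
    relWeightShift_congr hk hM, Char.up_apply, if_pos rfl, Char.bump_self, Char.height]
  simp only [incr, Function.update_self]
  omega

/-! ### Injectivity of `A` -/

lemma eq_zero_or_eq_neg_one_of_mul_succ_lt {n : ℤ} (h : n * (n + 1) / 2 < 1) : n = 0 ∨ n = -1 := by
  have h1 : n * (n + 1) < 2 := by omega
  have h2 : n < 1 := by nlinarith
  have h3 : -2 < n := by nlinarith
  omega

/-- Since $\max(0,h+n)-\max(0,h)\le\max(0,n)$, this bounds the exponent below by $1$ outside
$\{-1,0,1\}$, whatever the height. -/
lemma one_add_max_le_mul_succ {n : ℤ} (h : n ≠ 0) (h' : n ≠ -1) (h'' : n ≠ 1) :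
    1 + max 0 n ≤ n * (n + 1) / 2 := by
  rcases le_or_gt 0 n with hn | hn
  · rw [max_eq_right hn]
    have : 2 ≤ n := by omega
    have : 2 * (1 + n) ≤ n * (n + 1) := by nlinarith
    omega
  · rw [max_eq_left hn.le]
    have : n ≤ -2 := by omega
    have : 2 ≤ n * (n + 1) := by nlinarith
    omega

variable (j₀) in
/-- The numbers `n` for which the exponent of `U` in the `n`-th term of `A` at `(k, I)` vanishes. -/
def activeSet (k : Γ.Char) (I : Finset J) : Finset ℤ :=
  if j₀ ∈ I then
    if k.height j₀ I = 0 then {-1, 0, 1} else if 0 < k.height j₀ I then {0, 1} else {-1, 0}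
  else {-1, 0}

lemma aExp_of_mem_activeSet (hΓ : Γ.Nondegenerate) (h : (Γ.incr j₀).Nondegenerate) {k : Γ.Char}
    {I : Finset J} {n : ℤ} (hn : n ∈ activeSet j₀ k I) : aExp j₀ k (oddOf n) I = 0 := by
  by_cases hI : j₀ ∈ I
  · rw [aExp_of_mem hΓ h _ _ hI, Int.cast_eq_zero]
    rw [activeSet, if_pos hI] at hn
    split_ifs at hn with h1 h2 <;> simp only [Finset.mem_insert, Finset.mem_singleton] at hn <;>
      rcases hn with rfl | hn <;> (try rcases hn with rfl | rfl) <;> norm_num <;> omega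
  · rw [aExp_of_notMem h _ _ hI, Int.cast_eq_zero]
    rw [activeSet, if_neg hI] at hn
    simp only [Finset.mem_insert, Finset.mem_singleton] at hn
    rcases hn with rfl | rfl <;> norm_num

/-- With `aExp_of_mem_activeSet` this is the dichotomy behind leading-order arguments: an exponent
is $0$ or at least $1$. -/
lemma one_le_aExp_of_notMem_activeSet (hΓ : Γ.Nondegenerate) (h : (Γ.incr j₀).Nondegenerate)
    {k : Γ.Char} {I : Finset J} {n : ℤ} (hn : n ∉ activeSet j₀ k I) :
    1 ≤ aExp j₀ k (oddOf n) I := by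
  by_cases hI : j₀ ∈ I
  · rw [aExp_of_mem hΓ h _ _ hI, ← Int.cast_one, Int.cast_le]
    rw [activeSet, if_pos hI] at hn
    by_cases hn0 : n = 0
    · subst hn0
      split_ifs at hn <;> simp at hn
    by_cases hn1 : n = 1
    -- $n=1$ is inactive only for negative height; the next case, $n=-1$, only for positive height.
    · subst hn1
      split_ifs at hn <;> simp at hn
      norm_num
      omega
    by_cases hn2 : n = -1
    · subst hn2
      split_ifs at hn <;> simp at hn
      norm_num
      omega
    have := one_add_max_le_mul_succ hn0 hn2 hn1
    omega
  · rw [aExp_of_notMem h _ _ hI, ← Int.cast_one, Int.cast_le]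
    by_contra hlt
    apply hn
    rw [activeSet, if_neg hI]
    rcases eq_zero_or_eq_neg_one_of_mul_succ_lt (not_le.mp hlt) with rfl | rfl <;> simp

lemma pow_smul_uPow_smul_eq_zero {x : TPlus} {N : ℕ} (hx : (X ^ (N + 1) : ℤ[X]) • x = 0) {e : ℚ}
    (he : 1 ≤ e) : (X ^ N : ℤ[X]) • uPow e • x = 0 := by
  rw [uPow, smul_smul, ← pow_add]
  refine pow_smul_eq_zero_of_le hx ?_
  have : 1 ≤ ⌊e⌋₊ := Nat.le_floor (by exact_mod_cast he)
  omega

lemma uPow_smul_of_X_smul_eq_zero {x : TPlus} (hx : (X : ℤ[X]) • x = 0) {e : ℚ} (he : 1 ≤ e) :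
    uPow e • x = 0 := by
  simpa using pow_smul_uPow_smul_eq_zero (N := 0) (by simpa using hx) he

lemma uPow_zero_smul (x : TPlus) : uPow 0 • x = x := by
  simp [uPow]

/-- On the kernel of `U`, only the terms with exponent zero contribute to `A`. -/
lemma aFun_eq_sum (hΓ : Γ.Nondegenerate) (h : (Γ.incr j₀).Nondegenerate)
    {φ : (Γ.incr j₀).Cube → TPlus} (hφ : ∀ c, (X : ℤ[X]) • φ c = 0) (k : Γ.Char) (I : Finset J) :
    aFun φ (k, I) = ∑ n ∈ activeSet j₀ k I, φ ((k.bump j₀ n).up j₀, I) := by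
  rw [aFun_eq, finsum_eq_sum_of_support_subset (s := activeSet j₀ k I)]
  · refine Finset.sum_congr rfl fun n hn => ?_
    rw [aExp_of_mem_activeSet hΓ h hn, uPow_zero_smul]
  · intro n hn
    by_contra hn'
    exact hn (uPow_smul_of_X_smul_eq_zero (hφ _) (one_le_aExp_of_notMem_activeSet hΓ h hn'))

/-- A nonzero value at $m$ would propagate, with alternating sign, to all larger integers. -/
lemma eq_zero_of_add_succ_eq_zero {G : Type*} [AddCommGroup G] {f : ℤ → G}
    (hf : (Function.support f).Finite) {m : ℤ} (h : ∀ n, m ≤ n → f n + f (n + 1) = 0) :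
    f m = 0 := by
  by_contra hm
  have key : ∀ i : ℕ, f (m + i) ≠ 0 := by
    intro i
    induction i with
    | zero => simpa using hm
    | succ i ih =>
      intro h0
      have := h (m + i) (by omega)
      rw [add_assoc] at this
      push_cast at h0
      rw [h0, add_zero] at this
      exact ih this
  refine Set.infinite_of_injective_forall_mem (f := fun i : ℕ => m + i) ?_ key hf
  intro a b hab
  simpa using hab

lemma eq_zero_of_add_pred_eq_zero {G : Type*} [AddCommGroup G] {f : ℤ → G}
    (hf : (Function.support f).Finite) {m : ℤ} (h : ∀ n, n ≤ m → f n + f (n - 1) = 0) :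
    f m = 0 := by
  have := eq_zero_of_add_succ_eq_zero (f := fun n => f (-n)) (m := -m)
    (hf.preimage (f := fun n : ℤ => -n) neg_injective.injOn) (fun n hn => by
      have := h (-n) (by omega)
      rwa [neg_add, ← sub_eq_add_neg])
  simpa using this

/-- On $\ker U$ the rows of $A$ at positive height read $f(n)+f(n+1)=0$ and at negative height
$f(n)+f(n-1)=0$. Finite support kills both halves of the line, and the row at height $0$ then kills
$f(0)$. If $j_0\notin I$, all rows read $f(n)+f(n-1)=0$. -/
lemma eq_zero_of_aFun_eq_zero (hΓ : Γ.Nondegenerate) (h : (Γ.incr j₀).Nondegenerate)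
    {φ : (Γ.incr j₀).Cube → TPlus} (hfin : (Function.support φ).Finite)
    (hφ : ∀ c, (X : ℤ[X]) • φ c = 0) (hA : aFun φ = 0) : φ = 0 := by
  ext ⟨k, I⟩
  obtain ⟨k, rfl⟩ := Char.up_surjective k
  have hf : ∀ k : Γ.Char,
      (Function.support fun n : ℤ => φ ((k.bump j₀ n).up j₀, I)).Finite := by
    intro k
    refine hfin.preimage (f := fun n : ℤ => (((k.bump j₀ n).up j₀, I) : (Γ.incr j₀).Cube)) ?_
    intro m _ n _ hmn
    exact k.bump_injective (Char.up_injective (congrArg Prod.fst hmn))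
  have hrow : ∀ (k : Γ.Char) (n : ℤ),
      ∑ m ∈ activeSet j₀ (k.bump j₀ n) I, φ ((k.bump j₀ (n + m)).up j₀, I) = 0 := by
    intro k n
    have := congrFun hA (k.bump j₀ n, I)
    rw [aFun_eq_sum hΓ h hφ] at this
    simpa only [Char.bump_bump, Pi.zero_apply] using this
  by_cases hI : j₀ ∈ I
  -- The line is re-centred at its point of height $0$, so the argument of $f$ is the height.
  · set f : ℤ → TPlus := fun n => φ (((k.bump j₀ (-k.height j₀ I)).bump j₀ n).up j₀, I) with hfdef
    have hpos : ∀ m, 1 ≤ m → f m = 0 := by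
      intro m hm
      refine eq_zero_of_add_succ_eq_zero (hf _) fun n hn => ?_
      have := hrow (k.bump j₀ (-k.height j₀ I)) n
      rw [activeSet, if_pos hI, Char.height_bump, Char.height_bump, if_neg (by omega),
        if_pos (by omega)] at this
      simpa using this
    have hneg : ∀ m, m ≤ -1 → f m = 0 := by
      intro m hm
      refine eq_zero_of_add_pred_eq_zero (hf _) fun n hn => ?_
      have := hrow (k.bump j₀ (-k.height j₀ I)) n
      rw [activeSet, if_pos hI, Char.height_bump, Char.height_bump, if_neg (by omega),
        if_neg (by omega)] at this
      simpa [add_comm, sub_eq_add_neg] using this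
    have hzero : f 0 = 0 := by
      have := hrow (k.bump j₀ (-k.height j₀ I)) 0
      rw [activeSet, if_pos hI, Char.height_bump, Char.height_bump, if_pos (by omega)] at this
      have h1 := hpos 1 le_rfl
      have h2 := hneg (-1) le_rfl
      simp only [hfdef] at h1 h2
      simpa [h1, h2] using this
    have hall : ∀ m, f m = 0 := by
      intro m
      rcases lt_trichotomy m 0 with hm | rfl | hm
      · exact hneg m (by omega)
      · exact hzero
      · exact hpos m hm
    have := hall (k.height j₀ I)
    simpa only [hfdef, Char.bump_bump, neg_add_cancel, Char.bump_zero, Pi.zero_apply] using this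
  · have := eq_zero_of_add_pred_eq_zero (hf k) (m := 0) fun n _ => by
      have := hrow k n
      rw [activeSet, if_neg hI] at this
      simpa [add_comm, sub_eq_add_neg] using this
    simpa only [Char.bump_zero, Pi.zero_apply] using this

/-- If $U^{N+1}\varphi=0$ and $A\varphi=0$, then $U^N\varphi$ lies in the kernels of both $U$ and
$A$, hence vanishes. The order thus descends to $0$. -/
lemma aHom_injective (hΓ : Γ.Nondegenerate) (h : (Γ.incr j₀).Nondegenerate) (q : ℕ) :
    Function.Injective (aHom h q) := by
  rw [injective_iff_map_eq_zero]
  intro φ hφ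
  obtain ⟨N, hN⟩ := exists_pow_smul_eq_zero φ.2.1
  have hN' : (X ^ N : ℤ[X]) • φ = 0 := Subtype.ext (funext hN)
  clear hN
  induction N with
  | zero => simpa using hN'
  | succ N ih =>
    refine ih (Subtype.ext ?_)
    refine eq_zero_of_aFun_eq_zero hΓ h ((X ^ N : ℤ[X]) • φ).2.1 (fun c => ?_) ?_
    · have := congrFun (congrArg Subtype.val hN') c
      rw [pow_succ', mul_smul] at this
      exact this
    · have : aHom h q ((X ^ N : ℤ[X]) • φ) = 0 := by rw [map_smul, hφ, smul_zero]
      exact congrArg Subtype.val this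
/-! ### The kernel of `B̄` -/

lemma aFun_single_bump (k : Γ.Char) (I : Finset J) (x : TPlus) (m : ℤ) :
    aFun (single (k.up j₀, I) x) (k.bump j₀ m, I)
      = uPow (aExp j₀ (k.bump j₀ m) (oddOf (-m)) I) • x := by
  rw [aFun_eq, finsum_eq_single _ (-m)]
  · rw [Char.bump_bump, add_neg_cancel, Char.bump_zero, single_self]
  · intro n hn
    rw [single_of_ne, smul_zero]
    intro heq
    have h1 : (k.bump j₀ m).bump j₀ n = k.bump j₀ 0 := by
      rw [Char.bump_zero]
      exact Char.up_injective (congrArg Prod.fst heq)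
    rw [Char.bump_bump] at h1
    have := k.bump_injective h1
    omega

lemma aFun_single_of_ne (k : Γ.Char) (I : Finset J) (x : TPlus) {c : Γ.Cube}
    (hc : ∀ m, c ≠ (k.bump j₀ m, I)) : aFun (single (k.up j₀, I) x) c = 0 := by
  obtain ⟨k', I'⟩ := c
  rw [aFun_eq]
  refine finsum_eq_zero_of_forall_eq_zero fun n => ?_
  rw [single_of_ne, smul_zero]
  intro heq
  have h1 : k'.bump j₀ n = k := Char.up_injective (congrArg Prod.fst heq)
  have h2 : I' = I := congrArg Prod.snd heq
  refine hc (-n) ?_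
  rw [← h1, h2, Char.bump_bump, add_neg_cancel, Char.bump_zero]

variable (j₀) in
/-- The numbers `m` for which the exponent of `U` in the value of `A (single (k.up, I) x)` at
`(k + 2m E_{j₀}^*, I)` vanishes. -/
def activeColumn (k : Γ.Char) (I : Finset J) : Finset ℤ :=
  if j₀ ∈ I then
    if k.height j₀ I = 0 then {0} else if 0 < k.height j₀ I then {-1, 0} else {0, 1}
  else {0, 1}

/-- Transposition of the zero pattern: the entry of the column of $k$ in the row $k+2mE_{j_0}^*$ has
offset $-m$, and that row has height $h+m$. -/
lemma neg_mem_activeSet_bump_iff (k : Γ.Char) (I : Finset J) (m : ℤ) :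
    -m ∈ activeSet j₀ (k.bump j₀ m) I ↔ m ∈ activeColumn j₀ k I := by
  rw [activeSet, activeColumn, Char.height_bump]
  split_ifs <;> simp only [Finset.mem_insert, Finset.mem_singleton] <;> omega

open Classical in
lemma sum_single_bump_apply (k : Γ.Char) (I : Finset J) (x : TPlus) (D : Finset ℤ) (m : ℤ) :
    (∑ n ∈ D, single (k.bump j₀ n, I) x) (k.bump j₀ m, I) = if m ∈ D then x else 0 := by
  have key : ∀ n, single (k.bump j₀ n, I) x (k.bump j₀ m, I) = if n = m then x else 0 := by
    intro n
    split_ifs with hnm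
    · rw [hnm, single_self]
    · exact single_of_ne (fun heq => hnm (k.bump_injective (congrArg Prod.fst heq)).symm) x
  simp only [Finset.sum_apply, key, Finset.sum_ite_eq']

/-- Up to an error of smaller order in `U`, the image under `A` of a cochain supported at one cube is the
sum of the translates of this cochain at the cubes with exponent zero. -/
lemma pow_smul_aFun_single_sub (hΓ : Γ.Nondegenerate) (h : (Γ.incr j₀).Nondegenerate) (k : Γ.Char)
    (I : Finset J) {x : TPlus} {N : ℕ} (hx : (X ^ (N + 1) : ℤ[X]) • x = 0) (c : Γ.Cube) :
    (X ^ N : ℤ[X]) • (aFun (single (k.up j₀, I) x)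
      - ∑ n ∈ activeColumn j₀ k I, single (k.bump j₀ n, I) x) c = 0 := by
  classical
  by_cases hc : ∃ m, c = (k.bump j₀ m, I)
  · obtain ⟨m, rfl⟩ := hc
    rw [Pi.sub_apply, aFun_single_bump, sum_single_bump_apply]
    by_cases hm : m ∈ activeColumn j₀ k I
    · rw [if_pos hm, aExp_of_mem_activeSet hΓ h ((neg_mem_activeSet_bump_iff k I m).mpr hm),
        uPow_zero_smul, sub_self, smul_zero]
    · rw [if_neg hm, sub_zero]
      exact pow_smul_uPow_smul_eq_zero hx (one_le_aExp_of_notMem_activeSet hΓ h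
        (mt (neg_mem_activeSet_bump_iff k I m).mp hm))
  · push Not at hc
    rw [Pi.sub_apply, aFun_single_of_ne k I x hc, Finset.sum_apply,
      Finset.sum_eq_zero fun n _ => single_of_ne (hc n) x, sub_zero, smul_zero]

variable (Γ j₀) in
/-- The `q`-cochains supported at the cubes `(k, I)` with `j₀ ∉ I` and `k_{j₀} = e_{j₀}`. -/
def baseCochains (q : ℕ) : Submodule ℤ[X] (Γ.Cube → TPlus) where
  carrier := {φ | φ ∈ Γ.cochains q ∧ ∀ c : Γ.Cube, φ c ≠ 0 → j₀ ∉ c.2 ∧ c.1.1 j₀ = Γ.e j₀}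
  add_mem' {φ ψ} hφ hψ := by
    refine ⟨add_mem hφ.1 hψ.1, fun c hc => ?_⟩
    by_cases h : φ c = 0
    · exact hψ.2 c fun h' => hc (by simp [h, h'])
    · exact hφ.2 c h
  zero_mem' := ⟨zero_mem _, by simp⟩
  smul_mem' p φ hφ := ⟨Submodule.smul_mem _ p hφ.1, fun c hc => hφ.2 c fun h => hc (by simp [h])⟩

/-- The sum of the image of `A^q` and of the submodule `baseCochains`. -/
def imageSupBase (h : (Γ.incr j₀).Nondegenerate) (q : ℕ) : Submodule ℤ[X] (Γ.Cube → TPlus) :=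
  LinearMap.range ((Γ.cochains q).subtype ∘ₗ aHom h q) ⊔ Γ.baseCochains j₀ q

lemma aFun_mem_imageSupBase (h : (Γ.incr j₀).Nondegenerate) {q : ℕ}
    {φ : (Γ.incr j₀).Cube → TPlus} (hφ : φ ∈ (Γ.incr j₀).cochains q) :
    aFun φ ∈ imageSupBase h q :=
  Submodule.mem_sup_left ⟨⟨φ, hφ⟩, rfl⟩

/-- Each column of $A$ gives a relation modulo lower order. If $j_0\in I$, it expresses a cochain of
nonzero height through the one a step closer to height $0$, and the column at height $0$ is a single
cube. If $j_0\notin I$, neighbours on a line are negatives of each other, so all reduce to the point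
with $k_{j_0}=e_{j_0}$. -/
lemma single_mem_imageSupBase (hΓ : Γ.Nondegenerate) (h : (Γ.incr j₀).Nondegenerate) {N : ℕ}
    {I : Finset J}
    (ih : ∀ φ ∈ Γ.cochains I.card, (∀ c, (X ^ N : ℤ[X]) • φ c = 0) → φ ∈ imageSupBase h I.card)
    {x : TPlus} (hx : (X ^ (N + 1) : ℤ[X]) • x = 0) (k : Γ.Char) :
    single (k, I) x ∈ imageSupBase h I.card := by
  have hcol : ∀ k : Γ.Char, ∑ n ∈ activeColumn j₀ k I, single (k.bump j₀ n, I) x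
      ∈ imageSupBase h I.card := by
    intro k
    have h1 := aFun_mem_imageSupBase h (single_mem ((k.up j₀, I) : (Γ.incr j₀).Cube) x)
    -- The error between the column of $A$ and its leading part is killed by $U^N$, so the inductive
    -- hypothesis covers it.
    have h2 := ih (aFun (single (k.up j₀, I) x)
      - ∑ n ∈ activeColumn j₀ k I, single (k.bump j₀ n, I) x)
      (sub_mem (aFun_mem h (single_mem _ x)) (sum_mem fun n _ => single_mem (k.bump j₀ n, I) x))
      (pow_smul_aFun_single_sub hΓ h k I hx)
    exact (Submodule.sub_mem_iff_right _ h1).mp h2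
  by_cases hI : j₀ ∈ I
  -- Induction on the distance to height $0$.
  · have hmain : ∀ n : ℕ, ∀ k : Γ.Char, (k.height j₀ I).natAbs = n →
        single (k, I) x ∈ imageSupBase h I.card := by
      intro n
      induction n with
      | zero =>
        intro k hk
        have := hcol k
        rw [activeColumn, if_pos hI, if_pos (by omega)] at this
        simpa [Char.bump_zero] using this
      | succ n ihn =>
        intro k hk
        have h1 := hcol k
        rcases lt_or_ge 0 (k.height j₀ I) with hpos | hneg
        · rw [activeColumn, if_pos hI, if_neg (by omega), if_pos hpos, Finset.sum_pair (by norm_num),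
            Char.bump_zero] at h1
          refine (Submodule.add_mem_iff_right _ (ihn (k.bump j₀ (-1)) ?_)).mp h1
          rw [Char.height_bump]
          omega
        · rw [activeColumn, if_pos hI, if_neg (by omega), if_neg (by omega),
            Finset.sum_pair (by norm_num), Char.bump_zero] at h1
          refine (Submodule.add_mem_iff_left _ (ihn (k.bump j₀ 1) ?_)).mp h1
          rw [Char.height_bump]
          omega
    exact hmain _ k rfl
  · have hpair : ∀ k : Γ.Char, single (k, I) x + single (k.bump j₀ 1, I) x
        ∈ imageSupBase h I.card := by
      intro k
      have := hcol k
      rwa [activeColumn, if_neg hI, Finset.sum_pair (by norm_num), Char.bump_zero] at this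
    obtain ⟨m, hm⟩ : ∃ m, k.1 j₀ = Γ.e j₀ + 2 * m := by
      have := (Γ.isChar_iff _).1 k.2 j₀
      rw [Int.ModEq] at this
      exact ⟨(k.1 j₀ - Γ.e j₀) / 2, by omega⟩
    have hbase : single (k.bump j₀ (-m), I) x ∈ imageSupBase h I.card := by
      refine Submodule.mem_sup_right ⟨single_mem _ x, fun c hc => ?_⟩
      obtain rfl : c = (k.bump j₀ (-m), I) := by
        by_contra hne
        exact hc (single_of_ne hne x)
      refine ⟨hI, ?_⟩
      rw [Char.bump_self]
      omega
    have hall : ∀ n : ℤ, single ((k.bump j₀ (-m)).bump j₀ n, I) x ∈ imageSupBase h I.card := by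
      intro n
      induction n with
      | zero => rwa [Char.bump_zero]
      | succ i ihi =>
        have := hpair ((k.bump j₀ (-m)).bump j₀ i)
        rw [Char.bump_bump _ (i : ℤ) 1] at this
        exact (Submodule.add_mem_iff_right _ ihi).mp this
      | pred i ihi =>
        have := hpair ((k.bump j₀ (-m)).bump j₀ (-i - 1))
        rw [Char.bump_bump _ (-i - 1) 1, sub_add_cancel] at this
        exact (Submodule.add_mem_iff_left _ ihi).mp this
    have := hall m
    rwa [Char.bump_bump, neg_add_cancel, Char.bump_zero] at this

lemma cochains_le_imageSupBase (hΓ : Γ.Nondegenerate) (h : (Γ.incr j₀).Nondegenerate) (q : ℕ) :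
    Γ.cochains q ≤ imageSupBase h q := by
  have key : ∀ N : ℕ, ∀ φ ∈ Γ.cochains q, (∀ c, (X ^ N : ℤ[X]) • φ c = 0) →
      φ ∈ imageSupBase h q := by
    intro N
    induction N with
    | zero =>
      intro φ _ h0
      obtain rfl : φ = 0 := funext fun c => by simpa using h0 c
      exact zero_mem _
    | succ N ih =>
      intro φ hφ h0
      refine mem_of_single_mem hφ.1 fun c hc => ?_
      obtain rfl := hφ.2 c hc
      exact single_mem_imageSupBase hΓ h ih (h0 c) c.1
  intro φ hφ
  obtain ⟨N, hN⟩ := exists_pow_smul_eq_zero hφ.1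
  exact key N φ hφ hN

/-! ### The operator `B̄` on cochains with small support -/

lemma bSign_mul_self (r : (Γ.delete j₀).CharClass → (Γ.delete j₀).Char) (k : (Γ.delete j₀).Char)
    (a : Γ.Parity j₀) : bSign r k a * bSign r k a = 1 := by
  rw [bSign, ← Units.val_mul, Int.units_mul_self, Units.val_one]

lemma bSign_smul_eq_zero {r : (Γ.delete j₀).CharClass → (Γ.delete j₀).Char}
    {k : (Γ.delete j₀).Char} {a : Γ.Parity j₀} {x : TPlus} (hx : bSign r k a • x = 0) : x = 0 := by
  have h1 : (bSign r k a * bSign r k a) • x = 0 := by rw [mul_smul, hx, smul_zero]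
  rwa [bSign_mul_self, one_smul] at h1

/-- The restriction of a characteristic element to `Γ∖j₀`. -/
def Char.restrict (k : Γ.Char) : (Γ.delete j₀).Char :=
  ⟨fun j => k.1 j, by
    rw [isChar_iff]
    intro j
    exact (Γ.isChar_iff _).1 k.2 j⟩

lemma Char.restrict_extendBy (k : Γ.Char) (a : Γ.Parity j₀) (ha : k.1 j₀ = a.1) :
    (k.restrict (j₀ := j₀)).extendBy a = k := by
  apply Char.ext
  ext j
  by_cases hj : j = j₀
  · subst hj
    rw [extendBy_self, ha]
  · exact extendBy_coe _ _ ⟨j, hj⟩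

lemma exists_map_inclDelete {I : Finset J} (hI : j₀ ∉ I) :
    ∃ I' : Finset {j : J // j ≠ j₀}, I'.map (inclDelete j₀).toEmbedding = I := by
  refine ⟨I.subtype _, Finset.subtype_map_of_mem fun j hj => ?_⟩
  rintro rfl
  exact hI hj

/-- Only the summand $a=e_{j_0}$ can be nonzero, so $\overline B$ reads off each value up to sign.
-/
lemma eq_zero_of_mem_baseCochains (r : (Γ.delete j₀).CharClass → (Γ.delete j₀).Char) {q : ℕ}
    {φ : Γ.Cube → TPlus} (hφ : φ ∈ Γ.baseCochains j₀ q) (hb : bFun r φ = 0) : φ = 0 := by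
  ext ⟨k, I⟩
  by_contra hne
  obtain ⟨hI, hk⟩ := hφ.2 _ hne
  obtain ⟨I', rfl⟩ := exists_map_inclDelete hI
  have h1 := congrFun hb (k.restrict (j₀ := j₀), I')
  rw [bFun, finsum_eq_single _ (⟨Γ.e j₀, rfl⟩ : Γ.Parity j₀)] at h1
  · have := bSign_smul_eq_zero h1
    rw [Char.restrict_extendBy _ _ hk] at this
    exact hne this
  · intro a ha
    by_contra h0
    refine ha (Subtype.ext ?_)
    exact (Char.extendBy_self _ _).symm.trans (hφ.2 _ fun h => h0 (by rw [h, smul_zero])).2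

/-- Write $\varphi=A\psi+\beta$ with $\beta$ a base cochain. As $\overline BA=0$, also $\overline
B\beta=0$, which forces $\beta=0$. -/
lemma exists_aHom_eq (hΓ : Γ.Nondegenerate) (h : (Γ.incr j₀).Nondegenerate)
    (r : (Γ.delete j₀).CharClass → (Γ.delete j₀).Char) {q : ℕ} {φ : Γ.cochains q}
    (hφ : bHom r q φ = 0) : ∃ ψ, aHom h q ψ = φ := by
  obtain ⟨_, ⟨ψ, rfl⟩, β, hβ, he⟩ :=
    Submodule.mem_sup.mp (cochains_le_imageSupBase hΓ h q φ.2)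
  have he' : aHom h q ψ + ⟨β, hβ.1⟩ = φ := Subtype.ext he
  refine ⟨ψ, ?_⟩
  have h1 : bHom r q (aHom h q ψ) = 0 := Subtype.ext (bFun_aFun h r ψ.2)
  rw [← he', map_add, h1, zero_add] at hφ
  have h2 : β = 0 := eq_zero_of_mem_baseCochains r hβ (congrArg Subtype.val hφ)
  subst h2
  rw [← he']
  exact (add_zero _).symm

lemma bFun_single (r : (Γ.delete j₀).CharClass → (Γ.delete j₀).Char) (k : (Γ.delete j₀).Char)
    (I : Finset {j : J // j ≠ j₀}) (a : Γ.Parity j₀) (x : TPlus) :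
    bFun r (single (k.extendBy a, I.map (inclDelete j₀).toEmbedding) x)
      = single (k, I) (bSign r k a • x) := by
  ext ⟨k', I'⟩
  by_cases hc : ((k', I') : (Γ.delete j₀).Cube) = (k, I)
  · obtain ⟨rfl, rfl⟩ := Prod.mk.inj hc
    rw [single_self, bFun, finsum_eq_single _ a]
    · rw [single_self]
    · intro a' ha'
      rw [single_of_ne, smul_zero]
      intro heq
      refine ha' ?_
      have := Char.extendBy_injective (a₁ := (k', a')) (a₂ := (k', a)) (congrArg Prod.fst heq)
      exact congrArg Prod.snd this
  · rw [single_of_ne hc]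
    refine finsum_eq_zero_of_forall_eq_zero fun a' => ?_
    rw [single_of_ne, smul_zero]
    intro heq
    have h1 := Char.extendBy_injective (a₁ := (k', a')) (a₂ := (k, a)) (congrArg Prod.fst heq)
    have h2 := Finset.map_injective _ (congrArg Prod.snd heq)
    exact hc (Prod.ext (Prod.mk.inj h1).1 h2)

lemma bHom_surjective (r : (Γ.delete j₀).CharClass → (Γ.delete j₀).Char) (q : ℕ) :
    Function.Surjective (bHom r q) := by
  intro θ
  have hθ : θ.1 ∈ LinearMap.range (((Γ.delete j₀).cochains q).subtype ∘ₗ bHom r q) := by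
    refine mem_of_single_mem θ.2.1 ?_
    rintro ⟨k, I⟩ hc
    have hq : (I.map (inclDelete j₀).toEmbedding).card = q := by
      rw [Finset.card_map]
      exact θ.2.2 _ hc
    set a : Γ.Parity j₀ := ⟨Γ.e j₀, rfl⟩
    refine ⟨⟨single (k.extendBy a, I.map (inclDelete j₀).toEmbedding)
      (bSign r k a • θ.1 (k, I)), single_mem_of_card hq _⟩, ?_⟩
    refine (bFun_single r k I a _).trans ?_
    rw [smul_smul, bSign_mul_self, one_smul]
  obtain ⟨φ, hφ⟩ := hθ
  exact ⟨φ, Subtype.ext hφ⟩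

/-! ### The weights of `Γ` and `Γ∖j₀` -/

variable (Γ j₀) in
/-- The rational vector `-E_{j₀}^*`, in the basis `E_j`. -/
def dualVec : J → ℚ := Γ.matQ⁻¹.mulVec (Pi.single j₀ 1)

lemma matQ_mulVec_dualVec (hΓ : Γ.Nondegenerate) :
    Γ.matQ.mulVec (Γ.dualVec j₀) = Pi.single j₀ 1 := by
  rw [dualVec, Matrix.mulVec_mulVec, Matrix.mul_nonsing_inv _ (isUnit_iff_ne_zero.mpr hΓ),
    Matrix.one_mulVec]

/-- If `Γ_{j₀}^+` is negative definite then `-1 < (E_{j₀}^*)² < 0`. -/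
lemma NegDef.dualVec_mem_Ioo (h : (Γ.incr j₀).NegDef) : Γ.dualVec j₀ j₀ ∈ Set.Ioo (-1 : ℚ) 0 := by
  have hM := matQ_mulVec_dualVec (j₀ := j₀) h.of_incr.nondegenerate
  have hne : Γ.dualVec j₀ ≠ 0 := by
    intro h0
    rw [h0, Matrix.mulVec_zero] at hM
    simpa using congrFun hM j₀
  have h1 := h _ hne
  -- Testing the form of $\Gamma_{j_0}^+$ on $E_{j_0}^*$ gives $p(1+p)<0$ with $p=(E_{j_0}^*)^2$,
  -- the $j_0$-coordinate of `dualVec`.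
  have h2 : (Γ.incr j₀).matQ.mulVec (Γ.dualVec j₀)
      = Pi.single j₀ (1 + Γ.dualVec j₀ j₀) := by
    ext i
    rw [incr_matQ_mulVec, hM]
    by_cases hi : i = j₀
    · subst hi; simp
    · simp [hi]
  rw [h2, dotProduct_single] at h1
  constructor <;> nlinarith

/-- The solution `u` of `M u = k`, i.e. the coordinates of `-k` in the basis `E_j`. -/
def Char.coords (k : Γ.Char) : J → ℚ := Γ.matQ⁻¹.mulVec fun j => (k.1 j : ℚ)

lemma Char.matQ_mulVec_coords (hΓ : Γ.Nondegenerate) (k : Γ.Char) :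
    Γ.matQ.mulVec k.coords = fun j => (k.1 j : ℚ) := by
  rw [coords, Matrix.mulVec_mulVec, Matrix.mul_nonsing_inv _ (isUnit_iff_ne_zero.mpr hΓ),
    Matrix.one_mulVec]

lemma Char.coords_eq (hΓ : Γ.Nondegenerate) {k : Γ.Char} {u : J → ℚ}
    (hu : Γ.matQ.mulVec u = fun j => (k.1 j : ℚ)) : k.coords = u := by
  rw [coords, ← hu, Matrix.mulVec_mulVec, Matrix.nonsing_inv_mul _ (isUnit_iff_ne_zero.mpr hΓ),
    Matrix.one_mulVec]

lemma Char.dotProduct_dualVec (hΓ : Γ.Nondegenerate) (k : Γ.Char) :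
    (fun j => (k.1 j : ℚ)) ⬝ᵥ Γ.dualVec j₀ = k.coords j₀ := by
  rw [← k.matQ_mulVec_coords hΓ, dotProduct_comm, Matrix.dotProduct_mulVec,
    ← Matrix.mulVec_transpose, matQ_transpose, matQ_mulVec_dualVec hΓ, single_dotProduct, one_mul]

variable (j₀) in
/-- The number `(k, E_{j₀}^*) / (E_{j₀}^*)²`. -/
def Char.slope (k : Γ.Char) : ℚ := k.coords j₀ / Γ.dualVec j₀ j₀

lemma Char.coords_shift (hΓ : Γ.Nondegenerate) (k : Γ.Char) (l : J → ℤ) :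
    (k.shift l).coords = k.coords - (2 : ℚ) • fun j => (l j : ℚ) := by
  apply coords_eq hΓ
  rw [Matrix.mulVec_sub, Matrix.mulVec_smul, matQ_mul_cast, k.matQ_mulVec_coords hΓ]
  ext j
  simp only [shift_apply, Pi.sub_apply, Pi.smul_apply, smul_eq_mul]
  push_cast
  ring

lemma Char.slope_shift (hΓ : Γ.Nondegenerate) (k : Γ.Char) (l : J → ℤ) :
    (k.shift l).slope j₀ = k.slope j₀ - 2 * l j₀ / Γ.dualVec j₀ j₀ := by
  rw [slope, slope, coords_shift hΓ, Pi.sub_apply, Pi.smul_apply, smul_eq_mul]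
  ring

/-- Adding $tE_{j_0}^*$ adds $t(E_{j_0}^*)^2$ to $(k,E_{j_0}^*)$; dividing by $(E_{j_0}^*)^2$
normalises the slope to move in step with $a$. -/
lemma Char.slope_extendBy (hΓ : Γ.Nondegenerate) (hp : Γ.dualVec j₀ j₀ ≠ 0)
    (k : (Γ.delete j₀).Char) (a a' : Γ.Parity j₀) :
    (k.extendBy a').slope j₀ = (k.extendBy a).slope j₀ + (a'.1 - a.1) := by
  have : (k.extendBy a').coords = (k.extendBy a).coords + ((a'.1 : ℚ) - a.1) • Γ.dualVec j₀ := by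
    apply coords_eq hΓ
    rw [Matrix.mulVec_add, Matrix.mulVec_smul, matQ_mulVec_dualVec hΓ, matQ_mulVec_coords hΓ]
    ext j
    by_cases hj : j = j₀
    · subst hj
      simp [extendBy_self]
    · have h1 := extendBy_coe k a ⟨j, hj⟩
      have h2 := extendBy_coe k a' ⟨j, hj⟩
      simp only at h1 h2
      simp [h1, h2, hj]
  rw [slope, slope, this, Pi.add_apply, Pi.smul_apply, smul_eq_mul]
  field_simp

lemma sum_delete {M : Type*} [AddCommMonoid M] (f : J → M) (hf : f j₀ = 0) :
    ∑ j : {j : J // j ≠ j₀}, f j = ∑ j, f j := by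
  refine Fintype.sum_of_injective Subtype.val Subtype.val_injective _ _ (fun j hj => ?_)
    fun _ => rfl
  by_cases h : j = j₀
  · rw [h, hf]
  · exact absurd ⟨⟨j, h⟩, rfl⟩ hj

/-- Pythagoras: $K-sE_{j_0}^*$ is orthogonal to $E_{j_0}^*$, lies in the span of the other $E_j$,
and is $k$ there. Hence $K^2=k^2+ps^2$. The extra $1$ is the deleted vertex. -/
lemma w_extendBy (hΓ : Γ.Nondegenerate) (hdel : (Γ.delete j₀).Nondegenerate)
    (hp : Γ.dualVec j₀ j₀ ≠ 0) (k : (Γ.delete j₀).Char) (a : Γ.Parity j₀) :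
    Γ.w (k.extendBy a) = (Γ.delete j₀).w k
      - (Γ.dualVec j₀ j₀ * (k.extendBy a).slope j₀ ^ 2 + 1) / 8 := by
  set K := k.extendBy a with hK
  -- The slope is chosen so that $y_{j_0}=0$; then $y$ solves the linear system of $\Gamma\setminus
  -- j_0$ for $k$.
  set y : J → ℚ := K.coords - K.slope j₀ • Γ.dualVec j₀ with hy
  have hKk : ∀ j : {j : J // j ≠ j₀}, K.1 j = k.1 j := k.extendBy_coe a
  have hs : K.slope j₀ * Γ.dualVec j₀ j₀ = K.coords j₀ := div_mul_cancel₀ _ hp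
  have hy0 : y j₀ = 0 := by
    rw [hy, Pi.sub_apply, Pi.smul_apply, smul_eq_mul, hs, sub_self]
  have hMy : Γ.matQ.mulVec y = fun j => (K.1 j : ℚ) - K.slope j₀ * (Pi.single j₀ 1 : J → ℚ) j := by
    rw [hy, Matrix.mulVec_sub, Matrix.mulVec_smul, matQ_mulVec_dualVec hΓ,
      K.matQ_mulVec_coords hΓ]
    rfl
  have hdelM : (Γ.delete j₀).matQ.mulVec (fun j => y j) = fun j => (k.1 j : ℚ) := by
    ext i
    have h1 := congrFun hMy i
    simp only [Pi.single_apply, i.2, if_false, mul_zero, sub_zero, hKk] at h1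
    rw [← h1]
    refine Eq.trans ?_ (sum_delete (j₀ := j₀) (fun j => Γ.matQ i j * y j) (by simp [hy0]))
    refine Finset.sum_congr rfl fun j _ => ?_
    change (Γ.delete j₀).matQ i j * y j = Γ.matQ i j * y j
    rw [matQ, matQ, Matrix.map_apply, Matrix.map_apply, delete_mat]
  have e1 := (Γ.delete j₀).dualForm_eq hdel k.1 k.1 _ hdelM
  have e2 : (fun j => (k.1 j : ℚ)) ⬝ᵥ (fun j : {j : J // j ≠ j₀} => y j)
      = (fun j => (K.1 j : ℚ)) ⬝ᵥ y := by
    refine Eq.trans ?_ (sum_delete (j₀ := j₀) (fun j => (K.1 j : ℚ) * y j) (by simp [hy0]))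
    exact Finset.sum_congr rfl fun j _ => by rw [hKk]
  have e3 : (fun j => (K.1 j : ℚ)) ⬝ᵥ y
      = Γ.dualForm K.1 K.1 - K.slope j₀ * (K.slope j₀ * Γ.dualVec j₀ j₀) := by
    rw [hy, dotProduct_sub, dotProduct_smul, K.dotProduct_dualVec hΓ, hs]
    rfl
  have hc : (Fintype.card J : ℚ) = Fintype.card {j : J // j ≠ j₀} + 1 := by
    have : Fintype.card {j : J // j ≠ j₀} = Fintype.card J - 1 := by simp
    have h1 : 0 < Fintype.card J := Fintype.card_pos_iff.mpr ⟨j₀⟩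
    rw [this]
    push_cast [Nat.cast_sub (show 1 ≤ Fintype.card J from h1)]
    ring
  rw [w, w, e1, e2, e3, hc]
  ring

lemma NegDef.neg_card_le_w (h : Γ.NegDef) (k : Γ.Char) : -(Fintype.card J : ℚ) / 8 ≤ Γ.w k := by
  have h1 : Γ.dualForm k.1 k.1 ≤ 0 := by
    have hM := k.matQ_mulVec_coords h.nondegenerate
    rw [Γ.dualForm_eq h.nondegenerate _ _ _ hM, ← hM, dotProduct_comm]
    by_cases h0 : k.coords = 0
    · simp [h0]
    · exact (h _ h0).le
  rw [w]
  linarith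

/-- Every characteristic element of `Γ∖j₀` has an extension of slope in `[-1, 1]`. -/
lemma Char.exists_abs_slope_le (hΓ : Γ.Nondegenerate) (hp : Γ.dualVec j₀ j₀ ≠ 0)
    (k : (Γ.delete j₀).Char) : ∃ a : Γ.Parity j₀, |(k.extendBy a).slope j₀| ≤ 1 := by
  set a₀ : Γ.Parity j₀ := ⟨Γ.e j₀, rfl⟩
  set s := (k.extendBy a₀).slope j₀
  -- Parity lets the slope move in steps of $2$, so some value is within distance $1$ of $0$.
  refine ⟨parityShift (round (s / 2)) a₀, ?_⟩
  have h1 : (parityShift (round (s / 2)) a₀ : Γ.Parity j₀).1 = a₀.1 - 2 * round (s / 2) := rfl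
  rw [slope_extendBy hΓ hp k a₀, h1]
  have h2 := abs_sub_round (s / 2)
  rw [abs_le] at h2 ⊢
  push_cast
  constructor <;> linarith

/-! ### The operator `B̄` on the canonical submodule -/

lemma charClass_shift (k : Γ.Char) (l : J → ℤ) : Γ.charClass (k.shift l) = Γ.charClass k :=
  Quotient.sound (s := Γ.charSetoid) (Setoid.symm' _ ⟨_, rfl⟩)

lemma exists_eq_shift {k k' : Γ.Char} (h : Γ.charClass k = Γ.charClass k') :
    ∃ l, k' = k.shift l :=
  Quotient.exact (s := Γ.charSetoid) h

lemma Char.extendBy_shift_extend (k : (Γ.delete j₀).Char) (a : Γ.Parity j₀)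
    (l : {j : J // j ≠ j₀} → ℤ) :
    (k.extendBy a).shift (Function.extend (inclDelete j₀) l 0) = (k.shift l).extendBy
      (parityShift (Γ.mat.mulVec (Function.extend (inclDelete j₀) l 0) j₀) a) := by
  apply Char.ext
  ext j
  by_cases hj : j = j₀
  · subst hj
    rw [extendBy_self, shift_apply, extendBy_self]
    rfl
  · have h1 := extendBy_coe (k.shift l)
      (parityShift (Γ.mat.mulVec (Function.extend (inclDelete j₀) l 0) j₀) a) ⟨j, hj⟩
    have h2 := extendBy_coe k a ⟨j, hj⟩
    have h3 := mulVec_extend (f := inclDelete j₀) (Γ.delete_mat j₀) l ⟨j, hj⟩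
    simp only [OrderEmbedding.subtype_apply] at h1 h2 h3
    rw [h1, shift_apply, shift_apply, h2, h3]

lemma dualForm_toDual_restrictE (hdel : (Γ.delete j₀).Nondegenerate)
    (l : {j : J // j ≠ j₀} → ℤ) : (Γ.delete j₀).dualForm ((Γ.delete j₀).toDual l) (restrictE Γ j₀)
      = Γ.mat.mulVec (Function.extend (inclDelete j₀) l 0) j₀ := by
  have hR : ∀ j : {j : J // j ≠ j₀}, restrictE Γ j₀ j = -Γ.mat j₀ j := by
    intro j
    have : E {j₀} = Pi.single j₀ 1 := by
      ext m; simp [E, Pi.single_apply]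
    rw [restrictE, toDual, this, Matrix.mulVec_single_one, Pi.neg_apply, mat_symm]
    rfl
  have h1 : restrictE Γ j₀ ⬝ᵥ l = -Γ.mat.mulVec (Function.extend (inclDelete j₀) l 0) j₀ := by
    have h2 := sum_delete (j₀ := j₀)
      (fun j => Γ.mat j₀ j * Function.extend (inclDelete j₀) l 0 j)
      (by simp only [extend_inclDelete_self, mul_zero])
    change _ = -∑ j, Γ.mat j₀ j * Function.extend (inclDelete j₀) l 0 j
    rw [← h2, ← Finset.sum_neg_distrib]
    refine Finset.sum_congr rfl fun j _ => ?_
    have h3 := extend_map (f := inclDelete j₀) l j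
    rw [OrderEmbedding.subtype_apply] at h3
    rw [hR, h3]
    ring
  rw [dualForm_comm, dualForm_toDual _ hdel, h1]
  push_cast
  ring

/-- In $n(k,a)$ the pairing with $R(E_{j_0})$ grows by $2(l,E_{j_0})$, while $a$ drops by the same
amount; the representative depends only on the class. -/
lemma bSign_shift_extend (hdel : (Γ.delete j₀).Nondegenerate)
    (r : (Γ.delete j₀).CharClass → (Γ.delete j₀).Char) (k : (Γ.delete j₀).Char)
    (a : Γ.Parity j₀) (l : {j : J // j ≠ j₀} → ℤ) :
    bSign r (k.shift l) (parityShift (Γ.mat.mulVec (Function.extend (inclDelete j₀) l 0) j₀) a)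
      = bSign r k a := by
  have : signExponent r (k.shift l)
      (parityShift (Γ.mat.mulVec (Function.extend (inclDelete j₀) l 0) j₀) a)
      = signExponent r k a := by
    rw [signExponent, signExponent, charClass_shift, Char.shift_val, add_sub_right_comm,
      dualForm_add_left, two_smul, dualForm_add_left, dualForm_toDual_restrictE hdel]
    simp only [parityShift, Equiv.coe_fn_mk]
    push_cast
    ring
  rw [bSign, bSign, this]

/-- The value of `B̄⁰ ε(x)` at `k` is a sum over the extensions of `k`. -/
lemma bFun_augmentationFun (hN : Γ.NegDef) (r : (Γ.delete j₀).CharClass → (Γ.delete j₀).Char)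
    (x : Γ.CharClass →₀ TPlus) (k : (Γ.delete j₀).Char) :
    bFun r (hN.augmentationFun x) (k, ∅) = ∑ᶠ a : Γ.Parity j₀, bSign r k a •
      uPow (Γ.w (k.extendBy a) - hN.minWeight (Γ.charClass (k.extendBy a))) •
        x (Γ.charClass (k.extendBy a)) := by
  simp [bFun, NegDef.augmentationFun]

lemma finite_support_bFun_augmentationFun (hN : Γ.NegDef)
    (r : (Γ.delete j₀).CharClass → (Γ.delete j₀).Char)
    (x : Γ.CharClass →₀ TPlus) (k : (Γ.delete j₀).Char) :
    (Function.support fun a : Γ.Parity j₀ => bSign r k a •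
      uPow (Γ.w (k.extendBy a) - hN.minWeight (Γ.charClass (k.extendBy a))) •
        x (Γ.charClass (k.extendBy a))).Finite := by
  refine finite_support_smul ?_ _
  simpa [NegDef.augmentationFun] using finite_extendBy (hN.augmentationFun_mem x).1 k ∅

/-- Shifting by $2l$ with $l$ supported off $j_0$ permutes the extensions, preserves signs and
classes in $\Gamma$, and changes all weights by the same amount in $\Gamma$ and in $\Gamma\setminus
j_0$. Hence $\overline B^0\varepsilon(x)$ has the shape of an augmentation, determined by its values
at minimal representatives. -/
lemma bFun_augmentationFun_shift (hN : Γ.NegDef) (hdel : (Γ.delete j₀).Nondegenerate)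
    (r : (Γ.delete j₀).CharClass → (Γ.delete j₀).Char) (x : Γ.CharClass →₀ TPlus)
    (k : (Γ.delete j₀).Char) (l : {j : J // j ≠ j₀} → ℤ)
    (hk : (Γ.delete j₀).w k ≤ (Γ.delete j₀).w (k.shift l)) :
    bFun r (hN.augmentationFun x) (k.shift l, ∅)
      = uPow ((Γ.delete j₀).w (k.shift l) - (Γ.delete j₀).w k) •
        bFun r (hN.augmentationFun x) (k, ∅) := by
  rw [bFun_augmentationFun, bFun_augmentationFun,
    smul_finsum' _ (finite_support_bFun_augmentationFun hN r x k),
    ← finsum_comp_equiv (parityShift (Γ.mat.mulVec (Function.extend (inclDelete j₀) l 0) j₀))]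
  refine finsum_congr fun a => ?_
  have hw := w_shift_extend hN.nondegenerate hdel (f := inclDelete j₀) (Γ.delete_mat j₀)
    (k.extendBy a) k (k.extendBy_coe a) l
  rw [bSign_shift_extend hdel, ← Char.extendBy_shift_extend, charClass_shift,
    smul_comm (uPow ((Γ.delete j₀).w (k.shift l) - (Γ.delete j₀).w k)) (bSign r k a), smul_smul,
    uPow_mul (sub_nonneg.mpr hk) (sub_nonneg.mpr (hN.minWeight_le _))
      ((Γ.delete j₀).w_shift_sub_int k l) (hN.sub_minWeight_int _), hw]
  congr 3
  ring

/-- An element of minimal weight in a class. -/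
def NegDef.minRep (h : Γ.NegDef) (c : Γ.CharClass) : Γ.Char := (h.minWeight_isLeast c).1.choose

lemma NegDef.charClass_minRep (h : Γ.NegDef) (c : Γ.CharClass) : Γ.charClass (h.minRep c) = c :=
  (h.minWeight_isLeast c).1.choose_spec.1

lemma NegDef.w_minRep (h : Γ.NegDef) (c : Γ.CharClass) : Γ.w (h.minRep c) = h.minWeight c :=
  (h.minWeight_isLeast c).1.choose_spec.2

/-- A bound uniform in the class is the starting level of the induction in
`exists_cocycle_bHom_eq_augmentation`. -/
lemma NegDef.exists_le_minWeight (h : Γ.NegDef) : ∃ ρ : ℚ, ∀ c, ρ ≤ h.minWeight c :=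
  ⟨-(Fintype.card J : ℚ) / 8, fun c => h.w_minRep c ▸ h.neg_card_le_w _⟩

/-- `B̄⁰` maps `𝕋(Γ)` into `𝕋(Γ∖j₀)`. -/
lemma exists_bFun_augmentationFun_eq (hN : Γ.NegDef) (hd : (Γ.delete j₀).NegDef)
    (r : (Γ.delete j₀).CharClass → (Γ.delete j₀).Char) (x : Γ.CharClass →₀ TPlus) :
    ∃ z : (Γ.delete j₀).CharClass →₀ TPlus,
      bFun r (hN.augmentationFun x) = hd.augmentationFun z ∧
        ∀ c, z c = bFun r (hN.augmentationFun x) (hd.minRep c, ∅) := by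
  have hmem := bFun_mem r (hN.augmentationFun_mem x)
  refine ⟨Finsupp.ofSupportFinite (fun c => bFun r (hN.augmentationFun x) (hd.minRep c, ∅)) ?_,
    ?_, fun c => rfl⟩
  -- Finitely many classes are met, because the cochain itself has finite support.
  · refine (hmem.1.image fun c => (Γ.delete j₀).charClass c.1).subset fun c hc => ?_
    exact ⟨(hd.minRep c, ∅), hc, hd.charClass_minRep c⟩
  · ext ⟨k, I⟩
    by_cases hI : I = ∅
    · subst hI
      obtain ⟨l, hl⟩ := exists_eq_shift (hd.charClass_minRep ((Γ.delete j₀).charClass k))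
      have hle := hd.minWeight_le k
      rw [← hd.w_minRep] at hle
      have := bFun_augmentationFun_shift hN hd.nondegenerate r x
        (hd.minRep ((Γ.delete j₀).charClass k)) l (by rwa [← hl])
      rw [← hl, hd.w_minRep] at this
      simp only [NegDef.augmentationFun, LinearMap.coe_mk, AddHom.coe_mk, if_true] at this ⊢
      exact this
    · rw [(Γ.delete j₀).cochains_apply_eq_zero hmem (by simpa using hI)]
      simp [NegDef.augmentationFun, hI]

/-! ### Growth of the weight and lifting of canonical classes level by level. -/

/-- Two extensions of characteristic elements of `Γ∖j₀` which differ by `2l` with `l_{j₀} = 0`. -/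
lemma Char.eq_shift_of_extendBy_eq {k k' : (Γ.delete j₀).Char} {a a' : Γ.Parity j₀} {l : J → ℤ}
    (hl : l j₀ = 0) (h : k'.extendBy a' = (k.extendBy a).shift l) :
    k' = k.shift fun j => l j := by
  have he : l = Function.extend (inclDelete j₀) (fun j : {j : J // j ≠ j₀} => l j) 0 := by
    ext j
    by_cases hj : j = j₀
    · rw [hj, hl, extend_inclDelete_self]
    · exact (extend_map (f := inclDelete j₀) (fun j : {j : J // j ≠ j₀} => l j) ⟨j, hj⟩).symm
  rw [he, extendBy_shift_extend] at h
  have := Char.extendBy_injective (a₁ := (k', a')) (a₂ := (k.shift _, _)) h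
  exact (Prod.mk.inj this).1

/-- The lower bound for the growth of the weight away from extensions of small slope. -/
lemma w_extendBy_shift_ge (h : (Γ.incr j₀).NegDef) {k k' : (Γ.delete j₀).Char}
    {a a' : Γ.Parity j₀} {l : J → ℤ} (ha : |(k.extendBy a).slope j₀| ≤ 1) (hl : l j₀ ≠ 0)
    (hkk : k'.extendBy a' = (k.extendBy a).shift l) :
    (Γ.delete j₀).w k' - (Γ.delete j₀).w k + (-(Γ.dualVec j₀ j₀)⁻¹ - 1) / 2
      ≤ Γ.w (k'.extendBy a') - Γ.w (k.extendBy a) := by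
  obtain ⟨hp1, hp0⟩ := h.dualVec_mem_Ioo
  have hΓ := h.of_incr.nondegenerate
  have hdel := (h.of_incr.delete (j₀ := j₀)).nondegenerate
  rw [w_extendBy hΓ hdel hp0.ne, w_extendBy hΓ hdel hp0.ne, hkk, Char.slope_shift hΓ]
  generalize (k.extendBy a).slope j₀ = s at ha
  generalize Γ.dualVec j₀ j₀ = p at hp1 hp0
  obtain ⟨n, hn⟩ : ∃ n : ℚ, n = l j₀ := ⟨_, rfl⟩
  have hn1 : 1 ≤ |n| := by
    rw [hn]
    exact_mod_cast Int.one_le_abs hl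
  rw [← hn]
  have hP : 1 < -p⁻¹ := by
    rw [← inv_neg]
    exact (one_lt_inv₀ (by linarith)).mpr (by linarith)
  have e1 : p * (s - 2 * n / p) ^ 2 = p * s ^ 2 - 4 * (s * n) - 4 * (-p⁻¹) * n ^ 2 := by
    have hpne := hp0.ne
    field_simp
    ring
  have h1 : -|n| ≤ s * n := by
    have h2 : |s * n| ≤ |n| := by
      rw [abs_mul]
      exact mul_le_of_le_one_left (abs_nonneg _) ha
    linarith [neg_abs_le (s * n)]
  rw [e1]
  generalize -p⁻¹ = P at hP
  have h3 : n ^ 2 = |n| ^ 2 := (sq_abs n).symm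
  rw [h3]
  -- With $P=-1/p>1$ the gain is $(Pn^2+sn)/2\ge(P|n|^2-|n|)/2$, which is at least $(P-1)/2$ because
  -- $|n|\ge1$.
  nlinarith [mul_nonneg (sub_nonneg.mpr hn1) (sub_nonneg.mpr hP.le)]

/-- The elements whose image under the augmentation of `Γ∖j₀` is the image under `B̄⁰` of a cocycle. -/
def liftable (h : (Γ.delete j₀).NegDef) (r : (Γ.delete j₀).CharClass → (Γ.delete j₀).Char) :
    Submodule ℤ[X] ((Γ.delete j₀).CharClass →₀ TPlus) :=
  ((LinearMap.ker (Γ.deltaHom 0)).map (bHom r 0)).comap h.augmentation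

lemma mem_liftable_of_bFun_augmentationFun (hN : Γ.NegDef) (hd : (Γ.delete j₀).NegDef)
    (r : (Γ.delete j₀).CharClass → (Γ.delete j₀).Char) {x : Γ.CharClass →₀ TPlus}
    {z : (Γ.delete j₀).CharClass →₀ TPlus}
    (hz : bFun r (hN.augmentationFun x) = hd.augmentationFun z) : z ∈ liftable hd r :=
  ⟨hN.augmentation x, Subtype.ext (hN.delta_augmentationFun x), Subtype.ext hz⟩

lemma mem_of_forall_single_mem {ι : Type*} {P : Submodule ℤ[X] (ι →₀ TPlus)} {z : ι →₀ TPlus}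
    (h : ∀ i, Finsupp.single i (z i) ∈ P) : z ∈ P := by
  rw [← Finsupp.sum_single z]
  exact Submodule.sum_mem _ fun i _ => h i

lemma smul_finsum_eq_zero {ι : Type*} {f : ι → TPlus} {p : ℤ[X]} (h : ∀ i, p • f i = 0) :
    p • ∑ᶠ i, f i = 0 := by
  refine finsum_induction (fun x => p • x = 0) (smul_zero p) (fun x y hx hy => ?_) h
  rw [smul_add, hx, hy, add_zero]

lemma smul_finsum_sub_eq_zero {ι : Type*} {f : ι → TPlus} (hf : (Function.support f).Finite)
    {p : ℤ[X]} (i : ι) (h : ∀ j ≠ i, p • f j = 0) : p • (∑ᶠ j, f j - f i) = 0 := by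
  classical
  have h1 : ∑ᶠ j, f j = ∑ᶠ j, (if j = i then 0 else f j) + f i := by
    have h2 : f i = ∑ᶠ j, if j = i then f j else 0 := by
      rw [finsum_eq_single _ i fun j hj => if_neg hj, if_pos rfl]
    rw [h2, ← finsum_add_distrib]
    · refine finsum_congr fun j => ?_
      split_ifs <;> simp
    · refine hf.subset fun j hj h0 => hj ?_
      simp only [h0, ite_self]
    · refine hf.subset fun j hj h0 => hj ?_
      simp only [h0, ite_self]
  rw [h1, add_sub_cancel_right]
  refine smul_finsum_eq_zero fun j => ?_
  split_ifs with hj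
  · exact smul_zero p
  · exact h j hj

/-- Elements of bounded order lift along `B̄⁰`. The bound on the order is in terms of the level `ρ`;
decreasing the level by `(-1/(E_{j₀}^*)² - 1)/2` is the induction step. -/
lemma single_mem_liftable_step (h : (Γ.incr j₀).NegDef)
    (r : (Γ.delete j₀).CharClass → (Γ.delete j₀).Char) (hd : (Γ.delete j₀).NegDef) {ρ : ℚ}
    (ih : ∀ c x, (X ^ ⌈ρ - hd.minWeight c⌉₊ : ℤ[X]) • x = 0 →
      Finsupp.single c x ∈ liftable hd r)
    (c : (Γ.delete j₀).CharClass) {x : TPlus}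
    (hx : (X ^ ⌈ρ + (-(Γ.dualVec j₀ j₀)⁻¹ - 1) / 2 - hd.minWeight c⌉₊ : ℤ[X]) • x = 0) :
    Finsupp.single c x ∈ liftable hd r := by
  have hN := h.of_incr
  have hp0 := h.dualVec_mem_Ioo.2
  set v : ℚ := ρ + (-(Γ.dualVec j₀ j₀)⁻¹ - 1) / 2 - hd.minWeight c with hv
  -- The natural-number ceiling sends $v\le0$ to $0$, so the order condition then says $x=0$.
  rcases le_or_gt v 0 with hv0 | hv0
  · rw [Nat.ceil_eq_zero.mpr hv0, pow_zero, one_smul] at hx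
    rw [hx, Finsupp.single_zero]
    exact zero_mem _
  obtain ⟨a, ha⟩ := (hd.minRep c).exists_abs_slope_le hN.nondegenerate hp0.ne
  set K := (hd.minRep c).extendBy a with hK
  set F₀ := ⌊Γ.w K - hN.minWeight (Γ.charClass K)⌋₊ with hF₀
  -- The floor loses nothing, as the difference is a non-negative integer.
  have hF₀' : (F₀ : ℚ) = Γ.w K - hN.minWeight (Γ.charClass K) := by
    obtain ⟨n, hn⟩ := hN.sub_minWeight_int K
    have h0 := sub_nonneg.mpr (hN.minWeight_le K)
    rw [hF₀, hn] at *
    lift n to ℕ using by exact_mod_cast h0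
    simp
  -- Divisibility gives $y$ whose term at the extension $K$ is exactly $x$, the sign being its own
  -- inverse. The price is an order larger by $F_0$.
  obtain ⟨y, hy⟩ := TPlus.exists_pow_smul_eq F₀ (bSign r (hd.minRep c) a • x)
  have hyv : ∀ n, ⌈v⌉₊ + F₀ ≤ n → (X ^ n : ℤ[X]) • y = 0 := by
    intro n hn
    refine pow_smul_eq_zero_of_le ?_ hn
    rw [pow_add, mul_smul, hy, smul_comm, hx, smul_zero]
  obtain ⟨z, hz, hzc⟩ := exists_bFun_augmentationFun_eq hN hd r
    (Finsupp.single (Γ.charClass K) y)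
  set T : (c' : (Γ.delete j₀).CharClass) → Γ.Parity j₀ → TPlus := fun c' a' =>
    bSign r (hd.minRep c') a' • uPow (Γ.w ((hd.minRep c').extendBy a')
      - hN.minWeight (Γ.charClass ((hd.minRep c').extendBy a'))) •
      (Finsupp.single (Γ.charClass K) y) (Γ.charClass ((hd.minRep c').extendBy a')) with hT
  have hzT : ∀ c', z c' = ∑ᶠ a', T c' a' := by
    intro c'
    rw [hzc, bFun_augmentationFun]
  have hTa : T c a = x := by
    change bSign r (hd.minRep c) a • uPow (Γ.w K - hN.minWeight (Γ.charClass K)) •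
      (Finsupp.single (Γ.charClass K) y) (Γ.charClass K) = x
    rw [Finsupp.single_eq_same, uPow, ← hF₀, hy, smul_smul, bSign_mul_self, one_smul]
  -- Every other term of $\overline B^0\varepsilon(y)$ has the order allowed at the lower level
  -- $\rho$.
  have hTne : ∀ c' a', (c' ≠ c ∨ a' ≠ a) →
      (X ^ ⌈ρ - hd.minWeight c'⌉₊ : ℤ[X]) • T c' a' = 0 := by
    intro c' a' hne
    simp only [hT]
    by_cases hcl : Γ.charClass K = Γ.charClass ((hd.minRep c').extendBy a')
    swap
    · rw [Finsupp.single_eq_of_ne (Ne.symm hcl), smul_zero, smul_zero, smul_zero]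
    obtain ⟨l, hl⟩ := exists_eq_shift hcl
    -- If $l_{j_0}=0$, the shift stays inside $\Gamma\setminus j_0$, so the classes agree and so do
    -- the chosen minimal representatives. The slope is then unchanged, which forces $a'=a$.
    have hl0 : l j₀ ≠ 0 := by
      intro hl0
      have h1 := Char.eq_shift_of_extendBy_eq hl0 hl
      have h2 : c' = c := by
        rw [← hd.charClass_minRep c', h1, charClass_shift, hd.charClass_minRep]
      subst h2
      have h3 := Char.slope_extendBy hN.nondegenerate hp0.ne (hd.minRep c') a a'
      rw [hl, Char.slope_shift hN.nondegenerate, hl0] at h3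
      have h4 : (a'.1 : ℚ) = a.1 := by
        simp only [Int.cast_zero, mul_zero, zero_div, sub_zero] at h3
        linarith
      rcases hne with hne | hne
      · exact hne rfl
      · exact hne (Subtype.ext (by exact_mod_cast h4))
    have hge := w_extendBy_shift_ge h ha hl0 hl
    rw [hd.w_minRep, hd.w_minRep] at hge
    have hle := hN.minWeight_le ((hd.minRep c').extendBy a')
    obtain ⟨n, hn⟩ := hN.sub_minWeight_int ((hd.minRep c').extendBy a')
    rw [← hcl] at hle hn ⊢
    lift n to ℕ using by
      have := sub_nonneg.mpr hle
      rw [hn] at this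
      exact_mod_cast this
    rw [Int.cast_natCast] at hn
    rw [Finsupp.single_eq_same, hn, uPow_natCast, smul_comm, smul_smul, ← pow_add, hyv, smul_zero]
    have h5 := Nat.le_ceil (ρ - hd.minWeight c')
    -- The exponent satisfies $n\ge F_0+\min w_{c'}-\min w_c+\epsilon$. Adding $\rho-\min w_{c'}$
    -- cancels $\min w_{c'}$ and leaves $v+F_0$, which bounds the order of $y$ before rounding.
    have h6 : v + F₀ ≤ ((⌈ρ - hd.minWeight c'⌉₊ + n : ℕ) : ℚ) := by
      push_cast
      rw [hF₀', ← hn]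
      linarith
    have h7 : F₀ ≤ ⌈ρ - hd.minWeight c'⌉₊ + n := by
      have : (F₀ : ℚ) ≤ ((⌈ρ - hd.minWeight c'⌉₊ + n : ℕ) : ℚ) := by linarith
      exact_mod_cast this
    have h8 : ⌈v⌉₊ ≤ ⌈ρ - hd.minWeight c'⌉₊ + n - F₀ := by
      rw [Nat.ceil_le, Nat.cast_sub h7]
      linarith
    omega
  have hzmem : z ∈ liftable hd r := mem_liftable_of_bFun_augmentationFun hN hd r hz
  -- At $c$ the term $x$ is removed and the remaining terms are of level $\rho$; at other classes
  -- all terms already are. The inductive hypothesis lifts the difference.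
  have hdiff : z - Finsupp.single c x ∈ liftable hd r := by
    refine mem_of_forall_single_mem fun c' => ih c' _ ?_
    rw [Finsupp.sub_apply, hzT]
    by_cases hc : c' = c
    · subst hc
      rw [Finsupp.single_eq_same, ← hTa]
      refine smul_finsum_sub_eq_zero ?_ a fun a' ha' => hTne c' a' (Or.inr ha')
      exact finite_support_bFun_augmentationFun hN r _ _
    · rw [Finsupp.single_eq_of_ne hc, sub_zero]
      exact smul_finsum_eq_zero fun a' => hTne c' a' (Or.inl hc)
  exact (Submodule.sub_mem_iff_right _ hzmem).mp hdiff

/-- The levels are $\rho_0+m\epsilon$. At $m=0$ only $x=0$ is admitted. Since $\epsilon>0$ does not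
depend on the class, every torsion order is reached after finitely many steps. -/
lemma exists_cocycle_bHom_eq_augmentation (h : (Γ.incr j₀).NegDef)
    (r : (Γ.delete j₀).CharClass → (Γ.delete j₀).Char)
    (x : (Γ.delete j₀).CharClass →₀ TPlus) :
    ∃ φ : Γ.cochains 0, Γ.delta φ.1 = 0 ∧ bHom r 0 φ = h.of_incr.delete.augmentation x := by
  set hd := h.of_incr.delete (j₀ := j₀)
  obtain ⟨hp1, hp0⟩ := h.dualVec_mem_Ioo
  set ε : ℚ := (-(Γ.dualVec j₀ j₀)⁻¹ - 1) / 2 with hε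
  have hε0 : 0 < ε := by
    have hP : 1 < -(Γ.dualVec j₀ j₀)⁻¹ := by
      rw [← inv_neg]
      exact (one_lt_inv₀ (by linarith)).mpr (by linarith)
    linarith
  obtain ⟨ρ₀, hρ₀⟩ := hd.exists_le_minWeight
  have key : ∀ (m : ℕ) (c : (Γ.delete j₀).CharClass) (x : TPlus),
      (X ^ ⌈ρ₀ + m * ε - hd.minWeight c⌉₊ : ℤ[X]) • x = 0 →
        Finsupp.single c x ∈ liftable hd r := by
    intro m
    induction m with
    | zero =>
      intro c x hx
      have h1 := hρ₀ c
      have h2 : ρ₀ + (0 : ℕ) * ε - hd.minWeight c ≤ 0 := by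
        push_cast
        linarith
      rw [Nat.ceil_eq_zero.mpr h2, pow_zero, one_smul] at hx
      rw [hx, Finsupp.single_zero]
      exact zero_mem _
    | succ m ih =>
      intro c x hx
      refine single_mem_liftable_step h r hd ih c ?_
      rw [← hε]
      push_cast at hx
      rwa [add_assoc, ← add_one_mul]
  have hmem : x ∈ liftable hd r := by
    refine mem_of_forall_single_mem fun c => ?_
    obtain ⟨N, hN⟩ := TPlus.exists_pow_smul_eq_zero (x c)
    -- Chosen so that $\rho_0+m\epsilon-\min w_c\ge N$, the order of $x_c$.
    obtain ⟨m, hm⟩ := exists_nat_ge ((N + hd.minWeight c - ρ₀) / ε)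
    refine key m c _ (pow_smul_eq_zero_of_le hN ?_)
    rw [div_le_iff₀ hε0] at hm
    have h1 := Nat.le_ceil (ρ₀ + m * ε - hd.minWeight c)
    have h2 : (N : ℚ) ≤ (⌈ρ₀ + m * ε - hd.minWeight c⌉₊ : ℚ) := by linarith
    exact_mod_cast h2
  obtain ⟨φ, hφ, he⟩ := hmem
  exact ⟨φ, congrArg Subtype.val hφ, he⟩

/-! ### The surgery exact sequence -/

lemma surgerySequence_shortExact (hΓ : Γ.Nondegenerate) (hdel : (Γ.delete j₀).Nondegenerate)
    (h : (Γ.incr j₀).Nondegenerate) (r : (Γ.delete j₀).CharClass → (Γ.delete j₀).Char) :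
    (surgerySequence hΓ hdel h r).ShortExact := by
  refine HomologicalComplex.shortExact_of_degreewise_shortExact _ fun q => ?_
  have hm : Mono ((surgerySequence hΓ hdel h r).map (HomologicalComplex.eval _ _ q)).f :=
    (ModuleCat.mono_iff_injective _).mpr (aHom_injective hΓ h q)
  have he : Epi ((surgerySequence hΓ hdel h r).map (HomologicalComplex.eval _ _ q)).g :=
    (ModuleCat.epi_iff_surjective _).mpr (bHom_surjective r q)
  refine ⟨(ShortComplex.moduleCat_exact_iff _).mpr fun φ hφ => ?_⟩
  exact exists_aHom_eq (Γ := Γ) hΓ h r (φ := φ) hφ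

/-- A class in `ℍ⁰(Γ∖j₀)` is in the image of `B̄⁰` if some cochain representing it is the image of a
cocycle of `Γ`. -/
lemma homologyπ_mem_range_bCohomology (hΓ : Γ.Nondegenerate) (hdel : (Γ.delete j₀).Nondegenerate)
    (r : (Γ.delete j₀).CharClass → (Γ.delete j₀).Char) (z : (Γ.delete j₀).cochainComplex.cycles 0)
    (φ : Γ.cochains 0) (hφ : Γ.delta φ.1 = 0)
    (hz : (Γ.delete j₀).cochainComplex.iCycles 0 z = bHom r 0 φ) :
    (Γ.delete j₀).cochainComplex.homologyπ 0 z ∈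
      LinearMap.range (bCohomology hΓ hdel r 0).hom := by
  -- The inclusion of $\ker\delta$ turns the cocycle $\varphi$ into an element of the categorical
  -- cycles.
  let s : ModuleCat.of ℤ[X] (LinearMap.ker (Γ.deltaHom 0)) ⟶ Γ.cochainComplex.X 0 :=
    ModuleCat.ofHom (LinearMap.ker (Γ.deltaHom 0)).subtype
  have hs : s ≫ Γ.cochainComplex.d 0 1 = 0 := by
    rw [Γ.cochainComplex_d 0]
    exact ModuleCat.hom_ext (LinearMap.ext fun x => x.2)
  let z' : Γ.cochainComplex.cycles 0 :=
    Γ.cochainComplex.liftCycles s 1 (by simp) hs ⟨φ, Subtype.ext hφ⟩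
  have hz' : Γ.cochainComplex.iCycles 0 z' = φ := by
    change (Γ.cochainComplex.liftCycles s 1 (by simp) hs ≫ Γ.cochainComplex.iCycles 0) _ = _
    rw [HomologicalComplex.liftCycles_i]
    rfl
  have hzz' : HomologicalComplex.cyclesMap (bMap hΓ hdel r) 0 z' = z := by
    apply (ModuleCat.mono_iff_injective ((Γ.delete j₀).cochainComplex.iCycles 0)).mp inferInstance
    rw [hz, ← ConcreteCategory.comp_apply, HomologicalComplex.cyclesMap_i,
      ConcreteCategory.comp_apply, hz']
    rfl
  refine ⟨Γ.cochainComplex.homologyπ 0 z', ?_⟩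
  change (Γ.cochainComplex.homologyπ 0 ≫
    HomologicalComplex.homologyMap (bMap hΓ hdel r) 0) z' = _
  rw [HomologicalComplex.homologyπ_naturality, ConcreteCategory.comp_apply, hzz']

lemma canonicalSubmodule_le_range_bCohomology (h : (Γ.incr j₀).NegDef)
    (r : (Γ.delete j₀).CharClass → (Γ.delete j₀).Char) :
    h.of_incr.delete.canonicalSubmodule ≤ LinearMap.range
      (bCohomology h.of_incr.nondegenerate h.of_incr.delete.nondegenerate r 0).hom := by
  rintro _ ⟨x, rfl⟩
  obtain ⟨φ, hφ, hb⟩ := exists_cocycle_bHom_eq_augmentation h r x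
  refine homologyπ_mem_range_bCohomology _ _ r _ φ hφ ?_
  rw [hb]
  exact congrArg (fun f => f.hom x) (HomologicalComplex.liftCycles_i (Γ.delete j₀).cochainComplex
    (ModuleCat.ofHom h.of_incr.delete.augmentation) 1 (by simp) h.of_incr.delete.augmentation_d)

end PlumbingGraph

end

theorem theorem6p2 {J : Type*} [Fintype J] [LinearOrder J] (Γ : PlumbingGraph J) (j₀ : J)
    (h : (Γ.incr j₀).NegDef)
    (r : (Γ.delete j₀).CharClass → (Γ.delete j₀).Char)
    (hr : ∀ c : (Γ.delete j₀).CharClass, (Γ.delete j₀).charClass (r c) = c) :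
    ∃ hS : (PlumbingGraph.surgerySequence h.of_incr.nondegenerate
        h.of_incr.delete.nondegenerate h.nondegenerate r).ShortExact,
      h.of_incr.delete.canonicalSubmodule ≤
          LinearMap.range (PlumbingGraph.bCohomology h.of_incr.nondegenerate
            h.of_incr.delete.nondegenerate r 0).hom ∧
        h.of_incr.delete.canonicalSubmodule ≤
          LinearMap.ker (PlumbingGraph.cCohomology hS 0).hom := by
  have hS := PlumbingGraph.surgerySequence_shortExact h.of_incr.nondegenerate
    h.of_incr.delete.nondegenerate h.nondegenerate r
  have hB := PlumbingGraph.canonicalSubmodule_le_range_bCohomology h r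
  refine ⟨hS, hB, hB.trans ?_⟩
  rintro _ ⟨x, rfl⟩
  -- $\overline{\mathbb B}^0$ and $\mathbb C^0$ are consecutive in the long exact sequence, so their
  -- composition is zero.
  exact congrArg (fun f => f.hom x) (hS.comp_δ 0 1 rfl)
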